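/- **Setting.** Let $\mathcal A$ be an infinite set of arms whose initial mean rewards $\mu_1(a)$, $a\in\mathcal A$, are i.i.d. uniform on $[0,1]$. At each time step $t=1,\dots,T$ a policy pulls an arm $a_t$ and receives the reward $r_t=\mu_t(a_t)+\eta_t$, where the noise terms $\eta_t$ are $1$-sub-Gaussian, independent of each other, of the initial means and of the policy's randomization. Pulling an arm makes it rot: for rotting rates $0\le\varrho_t\le\varrho$, $$\mu_t(a)=\mu_1(a)-\sum_{s=1}^{t-1}\varrho_s\,\mathbb 1(a_s=a).$$ The regret is $R(T)=\sum_{t=1}^T\bigl(1-\mu_t(a_t)\bigr)$. **Policy (Adaptive UCB-Threshold Policy).** It knows $T$, but not $\varrho$ or the rates $\varrho_t$. Let $H=\lceil\sqrt T\rceil$, $\mathcal B=\{2^{-3},2^{-4},\dots,2^{-\lceil(3/2)\log_2H\rceil}\}$, $B=|\mathcal B|$, $\alpha=\min\{1,\sqrt{B\log B/((e-1)\lceil T/H\rceil)}\}$, and let $C>0$ be a constant. Start with weights $w(\beta)=1$ for $\beta\in\mathcal B$. For each block $i=1,\dots,\lceil T/H\rceil$, consisting of the time steps $(i-1)H+1,\dots,\min\{iH,T\}$: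 1. Draw $\tilde\beta\in\mathcal B$ with $\tilde\beta=\beta$ with probability $p(\beta)=(1-\alpha)\,w(\beta)/\sum_{k\in\mathcal B}w(k)+\alpha/B$. At the first step of the block select a new (never selected) arm and pull it. 2. At every later step $t$ of the block, let $a$ be the arm pulled at step $t-1$ and let $n_{i,s}(a)$ be the number of pulls of $a$ in block $i$ before step $s$. If $$\frac{\sum_{s=(i-1)H+1}^{t-1}\bigl(r_s+\tilde\beta\,n_{i,s}(a)\bigr)\mathbb 1(a_s=a)}{n_{i,t}(a)}-\tilde\beta\,n_{i,t}(a)+\sqrt{\frac{10\log H}{n_{i,t}(a)}}\ \ge\ 1-\tilde\beta^{1/3},$$ pull $a$ again; otherwise discard $a$, select a new arm and pull it. 3. At the end of the block multiply $w(\tilde\beta)$ by $$\exp\left(\frac{\alpha}{B\,p(\tilde\beta)}\left(\frac12+\frac{\sum_{t=(i-1)H+1}^{\min\{iH,T\}}r_t}{2CH\log T+4\sqrt{H\log T}}\right)\right).$$ New arms are selected in the order of a fixed sequence of distinct arms. **Theorem.** There is $C_0>0$ such that for every constant $C\ge C_0$ the following holds. If the maximum rotting rate $\varrho=\varrho(T)\ge0$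 satisfies $\varrho=o(1)$ as $T\to\infty$, then the policy satisfies $$\mathbb E[R(T)]=\tilde O\bigl(\max\{\varrho^{1/3}T,\;T^{3/4}\}\bigr)$$ in the worst case over the rotting rates. That is, there are constants $K>0$ and $k\in\mathbb N$ depending only on $C$ such that for every function $\varrho(\cdot)\ge 0$ with $\varrho(T)\to0$ there is $T_0$ such that, for all $T\ge T_0$, all rates with $0\le\varrho_t\le\varrho(T)$ for all $t$, and all noise distributions as above, $R(T)$ is integrable and $$\mathbb E[R(T)]\le K(\log T)^k\max\{\varrho(T)^{1/3}T,\;T^{3/4}\}.$$ -/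

import Mathlib

open Filter Topology MeasureTheory ProbabilityTheory

namespace RottingBandit

noncomputable section

universe u

/-! ### The environment -/

/-- The mean reward `μ_t(a)` of arm `a` just before time step `t` (time starts at `1`), when the
initial means are `m`, the rotting rates are `ρ`, and `arm s` is the arm pulled at time `s`:
`μ_t(a) = m a - ∑_{1 ≤ s < t} ρ_s 1(a_s = a)`. -/
def meanReward {𝒜 : Type u} (m : 𝒜 → ℝ) (ρ : ℕ → ℝ) (arm : ℕ → 𝒜) (t : ℕ) (a : 𝒜) : ℝ :=
  open Classical in m a - ∑ s ∈ Finset.Ico 1 t, if arm s = a then ρ s else 0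

/-! ### Parameters of the policy; they depend on the horizon `T` only -/

/-- Block length `H = ⌈√T⌉`. -/
def blockLength (T : ℕ) : ℕ := ⌈Real.sqrt (T : ℝ)⌉₊

/-- Number of blocks `⌈T / H⌉`. -/
def numBlocks (T : ℕ) : ℕ := ⌈(T : ℝ) / (blockLength T : ℝ)⌉₊

/-- The candidate rates are `2^{-j}`, with `j` in `{3, …, ⌈(3/2) log₂ H⌉}`. Candidates are
referred to by their exponents `j`. -/
def exponents (T : ℕ) : Finset ℕ :=
  Finset.Icc 3 ⌈(3 / 2 : ℝ) * Real.logb 2 (blockLength T : ℝ)⌉₊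

/-- The candidate rate `2^{-j}`. -/
def rate (j : ℕ) : ℝ := ((2 : ℝ) ^ j)⁻¹

/-- The number `B` of candidate rates. -/
def numCandidates (T : ℕ) : ℕ := (exponents T).card

/-- The exploration parameter `α = min {1, √(B log B / ((e - 1) ⌈T / H⌉))}`. -/
def mixing (T : ℕ) : ℝ :=
  min 1 (Real.sqrt ((numCandidates T : ℝ) * Real.log (numCandidates T : ℝ) /
    ((Real.exp 1 - 1) * (numBlocks T : ℝ))))

/-- The (one-based) index `i` of the block that contains time step `t ≥ 1`. -/
def blockIndex (T t : ℕ) : ℕ := (t - 1) / blockLength T + 1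

/-- First time step `(i - 1) H + 1` of the block that contains time step `t ≥ 1`. -/
def blockFirst (T t : ℕ) : ℕ := (blockIndex T t - 1) * blockLength T + 1

/-- Last time step `min (i H) T` of the block that contains time step `t ≥ 1`. -/
def blockLast (T t : ℕ) : ℕ := min (blockIndex T t * blockLength T) T

/-! ### The policy -/

/-- What the policy remembers: the pulled arms and the observed rewards (by time step), the number
of arms that have been selected so far, the weights of the master (by exponent), and the exponent
of the candidate rate that is in use. -/
structure Memory (𝒜 : Type u) where
  arm : ℕ → 𝒜
  reward : ℕ → ℝ
  selected : ℕ
  weight : ℕ → ℝ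
  exponent : ℕ

/-- Number of pulls of arm `a` at time steps `s` with `first ≤ s < t`. -/
def pullCount {𝒜 : Type u} (arm : ℕ → 𝒜) (first t : ℕ) (a : 𝒜) : ℕ :=
  open Classical in ((Finset.Ico first t).filter (fun s => arm s = a)).card

/-- The estimator of the initial mean of arm `a`, from the observations at time steps `s` with
`first ≤ s < t`, for the candidate rate `β`:
`(∑_s (r_s + β n_s(a)) 1(a_s = a)) / n_t(a)`. -/
def initialMeanEst {𝒜 : Type u} (M : Memory 𝒜) (first t : ℕ) (β : ℝ) (a : 𝒜) : ℝ :=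
  open Classical in
  (∑ s ∈ Finset.Ico first t,
      if M.arm s = a then M.reward s + β * (pullCount M.arm first s a : ℝ) else 0) /
    (pullCount M.arm first t a : ℝ)

/-- The index `UCB_{i,t}(a, β)`, where `i` is the block that contains `t`. -/
def ucb {𝒜 : Type u} (T : ℕ) (M : Memory 𝒜) (t : ℕ) (β : ℝ) (a : 𝒜) : ℝ :=
  initialMeanEst M (blockFirst T t) t β a
    - β * (pullCount M.arm (blockFirst T t) t a : ℝ)
    + Real.sqrt (10 * Real.log (blockLength T : ℝ) / (pullCount M.arm (blockFirst T t) t a : ℝ))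

/-- EXP3 probabilities `p(β) = (1 - α) w(β) / ∑_k w(k) + α / B`. -/
def selectProb (T : ℕ) (w : ℕ → ℝ) (j : ℕ) : ℝ :=
  (1 - mixing T) * (w j / ∑ l ∈ exponents T, w l) + mixing T * (1 / (numCandidates T : ℝ))

/-- Draws exponent `j` with probability `p j`, by inversion of the distribution function at `u`,
which is to be uniform on `[0, 1]`. -/
def draw (T : ℕ) (p : ℕ → ℝ) (u : ℝ) : ℕ :=
  sInf {j | j ∈ exponents T ∧ u ≤ ∑ l ∈ (exponents T).filter (fun l => l ≤ j), p l}

/-- The exponent in use at time `t`: drawn anew at the first step of a block (from the auxiliary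
uniform variable of that block), otherwise unchanged. -/
def currentExponent {𝒜 : Type u} (T : ℕ) (u : ℕ → ℝ) (M : Memory 𝒜) (t : ℕ) : ℕ :=
  if t = blockFirst T t then draw T (selectProb T M.weight) (u (blockIndex T t)) else M.exponent

/-- The arm of the previous step is kept at time `t`: `t` is not the first step of a block, and the
index of that arm is at least `1 - δ`, with `δ = β^{1/3}`. -/
def Keeps {𝒜 : Type u} (T : ℕ) (M : Memory 𝒜) (t : ℕ) (β : ℝ) : Prop :=
  t ≠ blockFirst T t ∧ 1 - β ^ (1 / 3 : ℝ) ≤ ucb T M t β (M.arm (t - 1))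

/-- Time step `t` of the policy, when `observe arm a` is the reward that is received if arm `a` is
pulled after the pulls `arm`. New arms are selected in the order of the sequence `abar`. At the last
step of a block the weight of the candidate in use is updated. -/
def step {𝒜 : Type u} (C : ℝ) (T : ℕ) (abar : ℕ → 𝒜) (u : ℕ → ℝ)
    (observe : (ℕ → 𝒜) → 𝒜 → ℝ) (t : ℕ) (M : Memory 𝒜) : Memory 𝒜 :=
  open Classical in
  let j := currentExponent T u M t
  let a := if Keeps T M t (rate j) then M.arm (t - 1) else abar M.selected
  let selected' := if Keeps T M t (rate j) then M.selected else M.selected + 1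
  let reward' := Function.update M.reward t (observe M.arm a)
  let H : ℝ := (blockLength T : ℝ)
  let L : ℝ := Real.log (T : ℝ)
  let gain : ℝ := 1 / 2 + (∑ s ∈ Finset.Icc (blockFirst T t) t, reward' s) /
    (2 * C * H * L + 4 * Real.sqrt (H * L))
  let weight' := if t = blockLast T t then
      Function.update M.weight j (M.weight j *
        Real.exp (mixing T / ((numCandidates T : ℝ) * selectProb T M.weight j) * gain))
    else M.weight
  { arm := Function.update M.arm t a
    reward := reward'
    selected := selected'
    weight := weight'
    exponent := j }

/-- The memory after `t` time steps, in the environment with initial means `m`, rotting rates `ρ`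
and noise `e`: the reward at time `t` is `r_t = μ_t(a_t) + e_t`. All weights are `1` initially. -/
def run {𝒜 : Type u} (C : ℝ) (T : ℕ) (abar : ℕ → 𝒜) (m : 𝒜 → ℝ) (ρ e u : ℕ → ℝ) :
    ℕ → Memory 𝒜
  | 0 =>
    { arm := fun _ => abar 0, reward := fun _ => 0, selected := 0, weight := fun _ => 1,
      exponent := 0 }
  | t + 1 =>
    step C T abar u (fun arm a => meanReward m ρ arm (t + 1) a + e (t + 1)) (t + 1)
      (run C T abar m ρ e u t)

/-- The arm `a_t` that is pulled at time `t ≥ 1`. -/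
def pulledArm {𝒜 : Type u} (C : ℝ) (T : ℕ) (abar : ℕ → 𝒜) (m : 𝒜 → ℝ) (ρ e u : ℕ → ℝ)
    (t : ℕ) : 𝒜 :=
  (run C T abar m ρ e u t).arm t

/-- The regret `R(T) = ∑_{t=1}^T (1 - μ_t(a_t))` of the policy. -/
def regret {𝒜 : Type u} (C : ℝ) (T : ℕ) (abar : ℕ → 𝒜) (m : 𝒜 → ℝ) (ρ e u : ℕ → ℝ) : ℝ :=
  ∑ t ∈ Finset.Icc 1 T,
    (1 - meanReward m ρ (pulledArm C T abar m ρ e u) t (pulledArm C T abar m ρ e u t))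

/-- The random input: the initial means `μ₁ a` of the arms are uniform on `[0, 1]`, the noise terms
`η t` are `1`-sub-Gaussian, the variables `U i` that the policy uses to draw candidate rates are
uniform on `[0, 1]`, and all of these random variables are mutually independent. -/
structure RandomInput {Ω : Type*} [MeasurableSpace Ω] {𝒜 : Type*} (P : Measure Ω)
    (μ₁ : 𝒜 → Ω → ℝ) (η U : ℕ → Ω → ℝ) : Prop where
  measurable_mean : ∀ a, Measurable (μ₁ a)
  measurable_noise : ∀ t, Measurable (η t)
  measurable_unif : ∀ i, Measurable (U i)
  uniform_mean : ∀ a, pdf.IsUniform (μ₁ a) (Set.Icc 0 1) P volume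
  subgaussian_noise : ∀ t, HasSubgaussianMGF (η t) 1 P
  uniform_unif : ∀ i, pdf.IsUniform (U i) (Set.Icc 0 1) P volume
  indep : iIndepFun (fun x : 𝒜 ⊕ ℕ ⊕ ℕ => Sum.elim μ₁ (Sum.elim η U) x) P

end

end RottingBandit

/-!
The regret is the sum of the regrets of the `≈ √T` blocks, and the proof compares two levels.

*Inside a block* the policy is a threshold policy with a fixed candidate rate `β`, threshold
`1 - δ` and `δ = β^{1/3}`, that only sees arms that no earlier block has touched. Suppose that the
noise of the block is tame (`NoiseGood`: all interval sums of length `n` are at most `√(10 n log H)`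
in absolute value, which fails with probability `O(1 / H²)`), and that `β` bounds the rotting rates.
Then the index of an arm is an upper confidence bound for its current mean, up to rotting: an arm
that passes the test with initial gap `Δ` is either pulled only `O(log H / Δ²)` times or has
`Δ = O(δ)`, so it costs `O(log H / max Δ δ)` beyond a share `O(δ)` of every step
(`blockRun_regret_le_sum`). An arm of gap at most `δ / 2` survives for `δ / (2 β)` pulls
(`card_good_mul_le`). Whether the `k`-th arm is selected does not depend on its mean, so Wald's
identity (`RandomInput.integral_sum_arms`) turns both facts into expectations: every selected arm is
good with probability `δ / 2`, hence only `O(H δ)` arms are selected, and each costs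
`E[1 / max Δ δ] log H = O(log² H)`. The expected regret of the block is `H δ` up to logarithms
(`RandomInput.integral_good_regret_le`).

*Between blocks* the policy is EXP3. Whatever `β` is, a tame block cannot collect very negative
total reward, since poor arms fail the test; so on tame noise the scaled gains lie in `[0, 1]`
(`blockGain_mem`). Unbounded noise is dealt with by stopping at the first block with large noise:
the potential argument `exponential_weights` bounds the gains up to that block, and the remainder is
an event of small probability times the trivial bound `O(H²)` on the regret of a block. The block
`i` uses fresh arms and noise, so it is independent of the weights and of the drawn candidate, and
its law does not depend on how many arms were selected before (`RandomInput.integral_mul_fresh`).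
Hence the importance weights are unbiased (`RandomInput.integral_draw`), and the policy does as well
as any constant candidate up to `gainScale · √(number of blocks)`, which is `T^{3/4}` up to
logarithms.

The comparison candidate is the smallest `β` that bounds the rotting rates (`exists_exponent`). It
is at most `2 ϱ`, or else the smallest of all candidates, for which `δ = O(H^{-1/2})`; in both cases
`T δ = O(max (ϱ^{1/3} T) (T^{3/4}))`.
-/

namespace RottingBandit

/-! ### A single block -/

/-- The state of the threshold policy inside one block: how many arms have been selected, how often
the current arm has been pulled, its current mean reward, the sums of `1 - mean reward` and of the
noise over its pulls, and the sum of `1 - mean reward` over all steps of the block so far. -/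
structure BlockState where
  count : ℕ
  pulls : ℕ
  mean : ℝ
  loss : ℝ
  noise : ℝ
  regret : ℝ

/-- The current arm passes the threshold test of candidate rate `β`; here `L = 10 log H`. The
observed rewards of the current arm sum up to `pulls - loss + noise`. The clause `pulls ≠ 0` is the
first step of the block, where there is no current arm. -/
def BlockState.Keep (β L : ℝ) (s : BlockState) : Prop :=
  s.pulls ≠ 0 ∧ 1 - β ^ (1 / 3 : ℝ) ≤
    ((s.pulls - s.loss + s.noise) + β * (s.pulls * (s.pulls - 1) / 2)) / s.pulls
      - β * s.pulls + Real.sqrt (L / s.pulls)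

/-- One step of a block: `ρ` and `e` are the rotting rate and the noise of this step, and `a` is the
initial mean of the next new arm. -/
noncomputable def BlockState.next (β L ρ a e : ℝ) (s : BlockState) : BlockState :=
  open Classical in
  if s.Keep β L then
    ⟨s.count, s.pulls + 1, s.mean - ρ, s.loss + (1 - s.mean), s.noise + e, s.regret + (1 - s.mean)⟩
  else ⟨s.count + 1, 1, a - ρ, 1 - a, e, s.regret + (1 - a)⟩

/-- The block after a number of steps, for candidate rate `β`, rotting rates `ρ`, noise `e`, and
initial means `m` of the new arms in the order of their selection. All sequences start with the
first step of the block at index `0`. -/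
noncomputable def blockRun (β L : ℝ) (ρ m e : ℕ → ℝ) : ℕ → BlockState
  | 0 => ⟨0, 0, 0, 0, 0, 0⟩
  | x + 1 => (blockRun β L ρ m e x).next β L (ρ x) (m (blockRun β L ρ m e x).count) (e x)

/-- The threshold test, solved for the total loss of the current arm. -/
lemma BlockState.keep_iff {β L : ℝ} {s : BlockState} (hL : 0 ≤ L) :
    s.Keep β L ↔ s.pulls ≠ 0 ∧ s.loss ≤ s.pulls * β ^ (1 / 3 : ℝ) + s.noise
      + Real.sqrt (L * s.pulls) - β * (s.pulls * (s.pulls + 1) / 2) := by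
  unfold BlockState.Keep
  refine and_congr_right fun h => ?_
  have hn : (0 : ℝ) < s.pulls := by exact_mod_cast Nat.pos_of_ne_zero h
  have hs : Real.sqrt (L / s.pulls) = Real.sqrt (L * s.pulls) / s.pulls := by
    rw [eq_div_iff hn.ne']
    conv_lhs => rw [← Real.sqrt_sq hn.le]
    rw [Real.sqrt_sq hn.le, ← Real.sqrt_sq hn.le, ← Real.sqrt_mul (by positivity),
      Real.sqrt_sq hn.le]
    congr 1
    field_simp
  rw [hs, ← mul_le_mul_iff_left₀ hn]
  have : (((s.pulls - s.loss + s.noise) + β * (s.pulls * (s.pulls - 1) / 2)) / s.pulls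
      - β * s.pulls + Real.sqrt (L * s.pulls) / s.pulls) * s.pulls =
      (s.pulls - s.loss + s.noise) + β * (s.pulls * (s.pulls - 1) / 2)
        - β * s.pulls * s.pulls + Real.sqrt (L * s.pulls) := by
    field_simp
  rw [this]
  constructor <;> intro h <;> linarith

lemma BlockState.next_of_keep {β L ρ a e : ℝ} {s : BlockState} (h : s.Keep β L) :
    s.next β L ρ a e = ⟨s.count, s.pulls + 1, s.mean - ρ, s.loss + (1 - s.mean), s.noise + e,
      s.regret + (1 - s.mean)⟩ := if_pos h

lemma BlockState.next_of_not_keep {β L ρ a e : ℝ} {s : BlockState} (h : ¬ s.Keep β L) :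
    s.next β L ρ a e = ⟨s.count + 1, 1, a - ρ, 1 - a, e, s.regret + (1 - a)⟩ := if_neg h

lemma blockRun_succ (β L : ℝ) (ρ m e : ℕ → ℝ) (x : ℕ) : blockRun β L ρ m e (x + 1) =
    (blockRun β L ρ m e x).next β L (ρ x) (m (blockRun β L ρ m e x).count) (e x) := rfl

lemma BlockState.count_le_next (β L ρ a e : ℝ) (s : BlockState) :
    s.count ≤ (s.next β L ρ a e).count := by
  by_cases h : s.Keep β L
  · rw [next_of_keep h]
  · rw [next_of_not_keep h]; simp

lemma blockRun_count_le (β L : ℝ) (ρ m e : ℕ → ℝ) (x : ℕ) :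
    (blockRun β L ρ m e x).count ≤ x := by
  induction x with
  | zero => simp [blockRun]
  | succ x ih =>
    rw [blockRun_succ]
    by_cases h : (blockRun β L ρ m e x).Keep β L
    · rw [BlockState.next_of_keep h]; exact ih.trans (Nat.le_succ x)
    · rw [BlockState.next_of_not_keep h]; exact Nat.succ_le_succ ih

/-- As long as at most `k` arms have been selected, the block depends on the means of the first `k`
arms only, and on the noise up to now. -/
lemma blockRun_congr {β L : ℝ} {ρ m m' e e' : ℕ → ℝ} {k x : ℕ}
    (hc : (blockRun β L ρ m e x).count ≤ k) (hm : ∀ i < k, m i = m' i)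
    (he : ∀ y < x, e y = e' y) : blockRun β L ρ m' e' x = blockRun β L ρ m e x := by
  induction x with
  | zero => rfl
  | succ x ih =>
    rw [blockRun_succ] at hc
    have h1 := ih ((BlockState.count_le_next ..).trans hc) fun y hy => he y (by omega)
    rw [blockRun_succ, blockRun_succ, h1, he x (by omega)]
    by_cases h : (blockRun β L ρ m e x).Keep β L
    · rw [BlockState.next_of_keep h, BlockState.next_of_keep h]
    · rw [BlockState.next_of_not_keep h] at hc
      rw [hm _ hc]

/-- What is known about the current arm, with initial mean `m c`, after `x` steps of a block, when
the rotting rates are in `[0, r]`. -/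
structure Tracked (r : ℝ) (m e : ℕ → ℝ) (x c : ℕ) (s : BlockState) : Prop where
  count : s.count = c + 1
  pulls_pos : 1 ≤ s.pulls
  pulls_le : s.pulls ≤ x
  le_mean : m c - r * s.pulls ≤ s.mean
  mean_le : s.mean ≤ m c
  le_loss : s.pulls * (1 - m c) ≤ s.loss
  loss_le : s.loss ≤ s.pulls * (1 - m c) + r * (s.pulls * (s.pulls - 1) / 2)
  noise : s.noise = ∑ y ∈ Finset.Ico (x - s.pulls) x, e y

lemma Tracked.of_new {β L r ρ : ℝ} {m e : ℕ → ℝ} {x : ℕ} {s : BlockState}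
    (h : ¬ s.Keep β L) (h0 : 0 ≤ ρ) (h1 : ρ ≤ r) :
    Tracked r m e (x + 1) s.count (s.next β L ρ (m s.count) (e x)) := by
  rw [BlockState.next_of_not_keep h]
  constructor <;> simp [h0]
  linarith

lemma Tracked.of_keep {β L r ρ a : ℝ} {m e : ℕ → ℝ} {x c : ℕ} {s : BlockState}
    (hs : Tracked r m e x c s)
    (h : s.Keep β L) (h0 : 0 ≤ ρ) (h1 : ρ ≤ r) :
    Tracked r m e (x + 1) c (s.next β L ρ a (e x)) := by
  rw [BlockState.next_of_keep h]
  obtain ⟨g1, g2, g3, g4, g5, g6, g7, g8⟩ := hs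
  constructor <;> simp only [Nat.cast_add, Nat.cast_one]
  · exact g1
  · omega
  · omega
  · linarith
  · linarith
  · linarith
  · linarith
  · rw [g8, Nat.add_sub_add_right, Finset.sum_Ico_succ_top (by omega)]

lemma not_keep_blockRun_zero (β L : ℝ) (ρ m e : ℕ → ℝ) : ¬ (blockRun β L ρ m e 0).Keep β L := by
  simp [blockRun, BlockState.Keep]

lemma exists_tracked {r : ℝ} (β L : ℝ) {ρ : ℕ → ℝ} (m e : ℕ → ℝ) (h : ∀ x, 0 ≤ ρ x ∧ ρ x ≤ r)
    (x : ℕ) : ∃ c, Tracked r m e (x + 1) c (blockRun β L ρ m e (x + 1)) := by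
  induction x with
  | zero =>
    exact ⟨_, Tracked.of_new (not_keep_blockRun_zero _ _ _ _ _) (h 0).1 (h 0).2⟩
  | succ x ih =>
    obtain ⟨c, hc⟩ := ih
    rw [blockRun_succ β L ρ m e (x + 1)]
    by_cases hk : (blockRun β L ρ m e (x + 1)).Keep β L
    · exact ⟨c, hc.of_keep hk (h _).1 (h _).2⟩
    · exact ⟨_, Tracked.of_new hk (h _).1 (h _).2⟩

/-- The noise of a block is tame: the partial sums over all intervals of time steps are as small as
the confidence radius `√(L / n)` asks for. -/
def NoiseGood (H : ℕ) (L : ℝ) (e : ℕ → ℝ) : Prop :=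
  ∀ a b, a ≤ b → b ≤ H → |∑ y ∈ Finset.Ico a b, e y| ≤ Real.sqrt (L * ((b - a : ℕ) : ℝ))

lemma Tracked.abs_noise_le {r L : ℝ} {m e : ℕ → ℝ} {x c H : ℕ} {s : BlockState}
    (hs : Tracked r m e x c s) (he : NoiseGood H L e) (hx : x ≤ H) :
    |s.noise| ≤ Real.sqrt (L * s.pulls) := by
  have := he (x - s.pulls) x (by omega) hx
  rwa [← hs.noise, Nat.sub_sub_self hs.pulls_le] at this

/-- Accounting over arms: if the loss of an arm with initial mean `a` that passes the test after `n`
pulls is at most `θ n + W a`, then an arm costs at most that, plus `1 + r n` for the one pull after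
its last successful test. -/
lemma blockRun_regret_le {β L r θ : ℝ} {ρ m e : ℕ → ℝ} {W : ℝ → ℝ} {H : ℕ}
    (hρ : ∀ x, 0 ≤ ρ x ∧ ρ x ≤ r) (hm : ∀ k, 0 ≤ m k ∧ m k ≤ 1) (hθ : 0 ≤ θ)
    (hW : ∀ a, 0 ≤ a → a ≤ 1 → 0 ≤ W a)
    (he : NoiseGood H L e)
    (hkeep : ∀ x c s, Tracked r m e x c s → s.Keep β L → |s.noise| ≤ Real.sqrt (L * s.pulls) →
      s.loss ≤ θ * s.pulls + W (m c)) {x : ℕ} (hx : x ≤ H) :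
    (blockRun β L ρ m e x).regret ≤
      (θ + r) * x + ∑ k ∈ Finset.range (blockRun β L ρ m e x).count, (1 + W (m k)) := by
  rcases x with _ | x
  · simp [blockRun]
  have hr : 0 ≤ r := (hρ 0).1.trans (hρ 0).2
  -- Completed arms have paid their share; the loss of the current arm is kept apart, since it can
  -- still be compared with its last successful test.
  suffices h : ∃ c, Tracked r m e (x + 1) c (blockRun β L ρ m e (x + 1)) ∧
      (blockRun β L ρ m e (x + 1)).regret - (blockRun β L ρ m e (x + 1)).loss ≤
        (θ + r) * ((x + 1 : ℕ) - (blockRun β L ρ m e (x + 1)).pulls)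
        + ∑ k ∈ Finset.range c, (1 + W (m k)) ∧
      (blockRun β L ρ m e (x + 1)).loss ≤ (θ + r) * (blockRun β L ρ m e (x + 1)).pulls
        + (1 + W (m c)) by
    obtain ⟨c, h1, h2, h3⟩ := h
    rw [h1.count, Finset.sum_range_succ]
    linarith
  have hnew : ∀ x, ¬ (blockRun β L ρ m e x).Keep β L → (blockRun β L ρ m e x).regret ≤
      (θ + r) * x + ∑ k ∈ Finset.range (blockRun β L ρ m e x).count, (1 + W (m k)) →
      ∃ c, Tracked r m e (x + 1) c (blockRun β L ρ m e (x + 1)) ∧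
      (blockRun β L ρ m e (x + 1)).regret - (blockRun β L ρ m e (x + 1)).loss ≤
        (θ + r) * ((x + 1 : ℕ) - (blockRun β L ρ m e (x + 1)).pulls)
        + ∑ k ∈ Finset.range c, (1 + W (m k)) ∧
      (blockRun β L ρ m e (x + 1)).loss ≤ (θ + r) * (blockRun β L ρ m e (x + 1)).pulls
        + (1 + W (m c)) := by
    intro x hk hreg
    refine ⟨_, Tracked.of_new hk (hρ x).1 (hρ x).2, ?_⟩
    rw [blockRun_succ, BlockState.next_of_not_keep hk]
    push_cast
    have := hW _ (hm (blockRun β L ρ m e x).count).1 (hm (blockRun β L ρ m e x).count).2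
    have := (hm (blockRun β L ρ m e x).count).1
    constructor <;> linarith
  induction x with
  | zero => exact hnew 0 (not_keep_blockRun_zero _ _ _ _ _) (by simp [blockRun])
  | succ x ih =>
    obtain ⟨c, h1, h2, h3⟩ := ih (by omega)
    by_cases hk : (blockRun β L ρ m e (x + 1)).Keep β L
    · refine ⟨c, h1.of_keep hk (hρ _).1 (hρ _).2, ?_⟩
      have h4 := hkeep _ _ _ h1 hk (h1.abs_noise_le he (by omega))
      rw [blockRun_succ β L ρ m e (x + 1), BlockState.next_of_keep hk]
      push_cast at *
      have h5 := h1.le_mean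
      have := (hm c).1
      constructor <;> linarith
    · apply hnew _ hk
      rw [h1.count, Finset.sum_range_succ]
      linarith

/-- Whatever the candidate rate and the rotting rates in `[0, 1]` are, a block cannot collect very
negative rewards, since arms with a poor total reward fail the test. -/
lemma blockRun_regret_le_crude {β L : ℝ} {ρ m e : ℕ → ℝ} {H : ℕ} (hβ : 0 ≤ β) (hβ1 : β ≤ 1)
    (hL : 0 ≤ L) (hρ : ∀ x, 0 ≤ ρ x ∧ ρ x ≤ 1) (hm : ∀ k, 0 ≤ m k ∧ m k ≤ 1)
    (he : NoiseGood H L e) {x : ℕ} (hx : x ≤ H) :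
    (blockRun β L ρ m e x).regret ≤ (4 + L) * x := by
  have h := blockRun_regret_le (β := β) (L := L) (θ := 2) (W := fun _ => L) hρ hm (by norm_num)
    (fun _ _ _ => hL) he (fun y c s hs hk hn => by
      rw [BlockState.keep_iff hL] at hk
      have hδ : β ^ (1 / 3 : ℝ) ≤ 1 := Real.rpow_le_one hβ hβ1 (by norm_num)
      have hsq : 2 * Real.sqrt (L * s.pulls) ≤ L + s.pulls := by
        have h1 := Real.sq_sqrt hL
        have h2 := Real.sq_sqrt (Nat.cast_nonneg (α := ℝ) s.pulls)
        rw [Real.sqrt_mul hL]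
        nlinarith [sq_nonneg (Real.sqrt L - Real.sqrt s.pulls)]
      have h1 := (abs_le.1 hn).2
      have h2 : (s.pulls : ℝ) * β ^ (1 / 3 : ℝ) ≤ s.pulls := by
        nlinarith [Nat.cast_nonneg (α := ℝ) s.pulls]
      have h3 : 0 ≤ β * (s.pulls * (s.pulls + 1) / 2 : ℝ) := by positivity
      linarith [hk.2]) hx
  have hc : ((blockRun β L ρ m e x).count : ℝ) ≤ x := by exact_mod_cast blockRun_count_le ..
  simp only [Finset.sum_const, Finset.card_range, nsmul_eq_mul] at h
  nlinarith

/-- A block whose candidate rate `β` bounds the rotting rates. An arm with gap `Δ = 1 - m k` costs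
`O(L / max Δ δ)`, with `δ = β^{1/3}`, beyond the share `O(δ)` of each step. -/
lemma blockRun_regret_le_sum {β L : ℝ} {ρ m e : ℕ → ℝ} {H : ℕ} (hβ : 0 < β)
    (hL : 0 ≤ L) (hρ : ∀ x, 0 ≤ ρ x ∧ ρ x ≤ β) (hm : ∀ k, 0 ≤ m k ∧ m k ≤ 1)
    (he : NoiseGood H L e) {x : ℕ} (hx : x ≤ H) :
    (blockRun β L ρ m e x).regret ≤ (2 * β ^ (1 / 3 : ℝ) + β) * x +
      ∑ k ∈ Finset.range (blockRun β L ρ m e x).count,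
        (1 + 16 * L / max (1 - m k) (β ^ (1 / 3 : ℝ))) := by
  have hδ : 0 < β ^ (1 / 3 : ℝ) := Real.rpow_pos_of_pos hβ _
  set δ := β ^ (1 / 3 : ℝ) with hδd
  refine blockRun_regret_le (β := β) (L := L) (θ := 2 * δ) (W := fun a => 16 * L / max (1 - a) δ)
    hρ hm (by positivity) (fun a _ _ => by positivity) he (fun y c s hs hk hn => ?_) hx
  rw [BlockState.keep_iff hL, ← hδd] at hk
  have hn0 : (0 : ℝ) < s.pulls := by exact_mod_cast hs.pulls_pos
  have h1 := (abs_le.1 hn).2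
  have h3 : 0 ≤ β * (s.pulls * (s.pulls + 1) / 2 : ℝ) := by positivity
  have h4 : s.loss ≤ s.pulls * δ + 2 * Real.sqrt (L * s.pulls) := by linarith [hk.2]
  have h5 := hs.le_loss
  have am : ∀ z : ℝ, 0 < z → 2 * Real.sqrt (L * s.pulls) ≤ s.pulls * z + L / z := by
    intro z hz
    have e1 : L * s.pulls = (s.pulls * z) * (L / z) := by field_simp
    rw [e1, Real.sqrt_mul (by positivity)]
    have e2 := Real.sq_sqrt (show 0 ≤ s.pulls * z by positivity)
    have e3 := Real.sq_sqrt (show 0 ≤ L / z by positivity)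
    nlinarith [sq_nonneg (Real.sqrt (s.pulls * z) - Real.sqrt (L / z))]
  -- An arm of large gap passes only while `n Δ ≲ √(L n)`; below `2 δ` the loss `n δ` is tolerated.
  rcases le_or_gt (1 - m c) (2 * δ) with hΔ | hΔ
  · have e1 := am δ hδ
    have e2 : L / δ ≤ 16 * L / max (1 - m c) δ := by
      rw [div_le_div_iff₀ hδ (by positivity)]
      have : max (1 - m c) δ ≤ 2 * δ := max_le hΔ (by linarith)
      nlinarith
    linarith
  · have hΔ0 : 0 < 1 - m c := by linarith
    rw [max_eq_left (by linarith : δ ≤ 1 - m c)]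
    have e1 := am ((1 - m c) / 4) (by positivity)
    have e2 : L / ((1 - m c) / 4) = 4 * (L / (1 - m c)) := by field_simp
    rw [e2] at e1
    have e3 : (s.pulls : ℝ) * (2 * δ) ≤ s.pulls * (1 - m c) := by gcongr
    have e4 : 16 * L / (1 - m c) = 16 * (L / (1 - m c)) := by ring
    have e5 : 0 ≤ L / (1 - m c) := by positivity
    rw [e4]
    have e6 : 0 < s.pulls * δ := by positivity
    linarith

/-- With a candidate rate `β` that bounds the rotting rates, an arm of gap at most `δ / 2`,
`δ = β^{1/3}`, survives while `β n ≤ δ / 2`; so a block has room for few of them. -/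
lemma card_good_mul_le {β L : ℝ} {ρ m e : ℕ → ℝ} {H : ℕ} (hβ : 0 < β)
    (hL : 0 ≤ L) (hρ : ∀ x, 0 ≤ ρ x ∧ ρ x ≤ β)
    (he : NoiseGood H L e) {x : ℕ} (hx : x ≤ H) :
    (∑ k ∈ Finset.range (blockRun β L ρ m e x).count,
      if 1 - β ^ (1 / 3 : ℝ) / 2 ≤ m k then (1 : ℝ) else 0) * β ^ (1 / 3 : ℝ) ≤
        2 * β * x + β ^ (1 / 3 : ℝ) := by
  have hδ : 0 < β ^ (1 / 3 : ℝ) := Real.rpow_pos_of_pos hβ _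
  set δ := β ^ (1 / 3 : ℝ) with hδd
  rcases x with _ | x
  · simp [blockRun, hδ.le]
  suffices h : ∃ c, Tracked β m e (x + 1) c (blockRun β L ρ m e (x + 1)) ∧
      (∑ k ∈ Finset.range c, if 1 - δ / 2 ≤ m k then (1 : ℝ) else 0) * δ ≤
        2 * β * ((x + 1 : ℕ) - (blockRun β L ρ m e (x + 1)).pulls) by
    obtain ⟨c, h1, h2⟩ := h
    rw [h1.count, Finset.sum_range_succ, add_mul]
    have : (if 1 - δ / 2 ≤ m c then (1 : ℝ) else 0) * δ ≤ δ := by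
      split_ifs
      · rw [one_mul]
      · rw [zero_mul]; exact hδ.le
    have : 0 ≤ β * (blockRun β L ρ m e (x + 1)).pulls := by positivity
    linarith
  induction x with
  | zero =>
    refine ⟨_, Tracked.of_new (not_keep_blockRun_zero _ _ _ _ _) (hρ 0).1 (hρ 0).2, ?_⟩
    rw [blockRun_succ, BlockState.next_of_not_keep (not_keep_blockRun_zero _ _ _ _ _)]
    simp [blockRun]
  | succ x ih =>
    obtain ⟨c, h1, h2⟩ := ih (by omega)
    by_cases hk : (blockRun β L ρ m e (x + 1)).Keep β L
    · refine ⟨c, h1.of_keep hk (hρ _).1 (hρ _).2, h2.trans ?_⟩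
      rw [blockRun_succ β L ρ m e (x + 1), BlockState.next_of_keep hk]
      push_cast
      apply le_of_eq
      ring
    · refine ⟨_, Tracked.of_new hk (hρ _).1 (hρ _).2, ?_⟩
      rw [blockRun_succ β L ρ m e (x + 1), BlockState.next_of_not_keep hk, h1.count,
        Finset.sum_range_succ, add_mul]
      push_cast at *
      suffices h : (if 1 - δ / 2 ≤ m c then (1 : ℝ) else 0) * δ ≤
          2 * β * (blockRun β L ρ m e (x + 1)).pulls by linarith
      split_ifs with hg
      · rw [one_mul]
        -- A discarded good arm has `β n ≥ δ / 2`: otherwise rotting and noise cannot fail the test.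
        by_contra! hlt
        apply hk
        rw [BlockState.keep_iff hL, ← hδd]
        have hn := h1.abs_noise_le he (by omega)
        have hp : (1 : ℝ) ≤ (blockRun β L ρ m e (x + 1)).pulls := by exact_mod_cast h1.pulls_pos
        refine ⟨by have := h1.pulls_pos; omega, ?_⟩
        have h3 := (abs_le.1 hn).1
        have h4 := h1.loss_le
        set n : ℝ := ((blockRun β L ρ m e (x + 1)).pulls : ℝ)
        nlinarith
      · rw [zero_mul]; positivity

/-! ### The policy, block by block -/

/-- Number of time steps of block `i`; from here on blocks are numbered from `0`. -/
noncomputable def blockLen (T i : ℕ) : ℕ := min (blockLength T) (T - i * blockLength T)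

/-- The constant `10 log H` of the confidence radius. -/
noncomputable def confConst (T : ℕ) : ℝ := 10 * Real.log (blockLength T : ℝ)

/-- A sequence that is indexed by time, restarted at the first step of block `i`. -/
noncomputable def blockShift (T i : ℕ) (f : ℕ → ℝ) : ℕ → ℝ :=
  fun x => f (i * blockLength T + 1 + x)

/-- The scale by which the master divides the total reward of a block. -/
noncomputable def gainScale (C : ℝ) (T : ℕ) : ℝ :=
  2 * C * (blockLength T : ℝ) * Real.log (T : ℝ)
    + 4 * Real.sqrt ((blockLength T : ℝ) * Real.log (T : ℝ))

/-- The end of block `i` with candidate exponent `j`, for new arms with initial means `m` and noise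
`e`, both counted from the start of the block. -/
noncomputable def blockEnd (T : ℕ) (ρ : ℕ → ℝ) (i j : ℕ) (m e : ℕ → ℝ) : BlockState :=
  blockRun (rate j) (confConst T) (blockShift T i ρ) m e (blockLen T i)

/-- The gain that the master credits to candidate exponent `j` at the end of block `i`. -/
noncomputable def blockGain (C : ℝ) (T : ℕ) (ρ : ℕ → ℝ) (i j : ℕ) (m e : ℕ → ℝ) : ℝ :=
  1 / 2 + (blockLen T i - (blockEnd T ρ i j m e).regret + ∑ x ∈ Finset.range (blockLen T i), e x) /
    gainScale C T

/-- The number of arms that have been selected before block `i`, and the weights of the master at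
the start of block `i`; `m` are the initial means of the arms in the order of their selection. -/
noncomputable def masterState (C : ℝ) (T : ℕ) (ρ m e u : ℕ → ℝ) : ℕ → ℕ × (ℕ → ℝ)
  | 0 => (0, fun _ => 1)
  | i + 1 =>
    let s := masterState C T ρ m e u i
    let j := draw T (selectProb T s.2) (u (i + 1))
    (s.1 + (blockEnd T ρ i j (fun k => m (s.1 + k)) (blockShift T i e)).count,
      Function.update s.2 j (s.2 j *
        Real.exp (mixing T / ((numCandidates T : ℝ) * selectProb T s.2 j) *
          blockGain C T ρ i j (fun k => m (s.1 + k)) (blockShift T i e))))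

/-- The candidate exponent that is drawn for block `i`. -/
noncomputable def choice (C : ℝ) (T : ℕ) (ρ m e u : ℕ → ℝ) (i : ℕ) : ℕ :=
  draw T (selectProb T (masterState C T ρ m e u i).2) (u (i + 1))

/-- The initial means of the arms that are new in block `i`, in the order of their selection. -/
noncomputable def freshMeans (C : ℝ) (T : ℕ) (ρ m e u : ℕ → ℝ) (i : ℕ) : ℕ → ℝ :=
  fun k => m ((masterState C T ρ m e u i).1 + k)

lemma blockLength_pos {T : ℕ} (hT : 1 ≤ T) : 0 < blockLength T := by
  unfold blockLength
  rw [Nat.ceil_pos, Real.sqrt_pos]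
  exact_mod_cast hT

lemma lt_of_lt_numBlocks {T i : ℕ} (hT : 1 ≤ T) (hi : i < numBlocks T) :
    i * blockLength T < T := by
  unfold numBlocks at hi
  rw [Nat.lt_ceil, lt_div_iff₀ (by exact_mod_cast blockLength_pos hT)] at hi
  exact_mod_cast hi

lemma le_numBlocks_mul {T : ℕ} (hT : 1 ≤ T) : T ≤ numBlocks T * blockLength T := by
  have h := Nat.le_ceil ((T : ℝ) / (blockLength T : ℝ))
  rw [div_le_iff₀ (by exact_mod_cast blockLength_pos hT)] at h
  exact_mod_cast h

lemma blockLen_pos {T i : ℕ} (hT : 1 ≤ T) (hi : i < numBlocks T) : 0 < blockLen T i := by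
  have := lt_of_lt_numBlocks hT hi
  have := blockLength_pos hT
  unfold blockLen
  omega

lemma blockLen_le (T i : ℕ) : blockLen T i ≤ blockLength T := min_le_left _ _

lemma pullCount_congr {𝒜 : Type*} {arm arm' : ℕ → 𝒜} {first t : ℕ}
    (h : ∀ s, first ≤ s → s < t → arm s = arm' s) (a : 𝒜) :
    pullCount arm first t a = pullCount arm' first t a := by
  classical
  unfold pullCount
  refine congrArg _ (Finset.filter_congr fun s hs => ?_)
  rw [Finset.mem_Ico] at hs
  rw [h s hs.1 hs.2]

open Classical in
lemma pullCount_succ {𝒜 : Type*} (arm : ℕ → 𝒜) {first t : ℕ} (h : first ≤ t) (a : 𝒜) :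
    pullCount arm first (t + 1) a = pullCount arm first t a + if arm t = a then 1 else 0 := by
  simp only [pullCount, Finset.card_filter]
  rw [Finset.sum_Ico_succ_top h]

lemma meanReward_congr {𝒜 : Type*} (m : 𝒜 → ℝ) (ρ : ℕ → ℝ) {arm arm' : ℕ → 𝒜} {t : ℕ}
    (h : ∀ s, 1 ≤ s → s < t → arm s = arm' s) (a : 𝒜) :
    meanReward m ρ arm t a = meanReward m ρ arm' t a := by
  unfold meanReward
  congr 1
  apply Finset.sum_congr rfl
  intro s hs
  rw [Finset.mem_Ico] at hs
  rw [h s hs.1 hs.2]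

lemma pulls_blockRun_eq_zero_iff (β L : ℝ) (ρ m e : ℕ → ℝ) (x : ℕ) :
    (blockRun β L ρ m e x).pulls = 0 ↔ x = 0 := by
  rcases x with _ | x
  · simp [blockRun]
  · rw [blockRun_succ]
    by_cases h : (blockRun β L ρ m e x).Keep β L
    · rw [BlockState.next_of_keep h]; simp
    · rw [BlockState.next_of_not_keep h]; simp

section Simulation

variable {𝒜 : Type*} (C : ℝ) (T : ℕ) (abar : ℕ → 𝒜) (m : 𝒜 → ℝ) (ρ e u : ℕ → ℝ)

lemma run_arm {s t : ℕ} (h : s ≤ t) :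
    (run C T abar m ρ e u t).arm s = pulledArm C T abar m ρ e u s := by
  induction t, h using Nat.le_induction with
  | base => rfl
  | succ t h ih =>
    rw [← ih]
    simp only [run, step]
    rw [Function.update_of_ne (by omega)]

lemma run_reward {s t : ℕ} (h : s ≤ t) :
    (run C T abar m ρ e u t).reward s = (run C T abar m ρ e u s).reward s := by
  induction t, h using Nat.le_induction with
  | base => rfl
  | succ t h ih =>
    rw [← ih]
    simp only [run, step]
    rw [Function.update_of_ne (by omega)]

open Classical in
/-- The memory of the policy after `x` steps of block `i` agrees with the state of the block and
with the state of the master. At the end of the block (`x = blockLen T i`) the weights are those of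
the next block. -/
structure Simulates (i x : ℕ) (s : BlockState) : Prop where
  selected : (run C T abar m ρ e u (i * blockLength T + x)).selected =
    (masterState C T ρ (m ∘ abar) e u i).1 + s.count
  arms : ∀ t, 1 ≤ t → t ≤ i * blockLength T + x →
    ∃ k < (run C T abar m ρ e u (i * blockLength T + x)).selected,
      pulledArm C T abar m ρ e u t = abar k
  exponent : x ≠ 0 → (run C T abar m ρ e u (i * blockLength T + x)).exponent =
    choice C T ρ (m ∘ abar) e u i
  weight : (run C T abar m ρ e u (i * blockLength T + x)).weight =
    (masterState C T ρ (m ∘ abar) e u (if x = blockLen T i then i + 1 else i)).2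
  pulls : x ≠ 0 → pullCount (pulledArm C T abar m ρ e u) (i * blockLength T + 1)
    (i * blockLength T + x + 1) (pulledArm C T abar m ρ e u (i * blockLength T + x)) = s.pulls
  estimate : x ≠ 0 → ∀ β : ℝ, (∑ t ∈ Finset.Ico (i * blockLength T + 1) (i * blockLength T + x + 1),
    if pulledArm C T abar m ρ e u t = pulledArm C T abar m ρ e u (i * blockLength T + x) then
      (run C T abar m ρ e u t).reward t + β * (pullCount (pulledArm C T abar m ρ e u)
        (i * blockLength T + 1) t (pulledArm C T abar m ρ e u (i * blockLength T + x)) : ℝ)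
      else 0) = (s.pulls - s.loss + s.noise) + β * (s.pulls * (s.pulls - 1) / 2)
  mean : x ≠ 0 → m (pulledArm C T abar m ρ e u (i * blockLength T + x)) -
    ∑ t ∈ Finset.Ico 1 (i * blockLength T + x + 1),
      (if pulledArm C T abar m ρ e u t = pulledArm C T abar m ρ e u (i * blockLength T + x)
        then ρ t else 0) = s.mean
  reward : ∑ t ∈ Finset.Ico (i * blockLength T + 1) (i * blockLength T + x + 1),
    (run C T abar m ρ e u t).reward t =
      x - s.regret + ∑ y ∈ Finset.range x, blockShift T i e y
  regret : ∑ t ∈ Finset.Ico (i * blockLength T + 1) (i * blockLength T + x + 1),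
    (1 - meanReward m ρ (pulledArm C T abar m ρ e u) t (pulledArm C T abar m ρ e u t)) = s.regret

variable {C T abar m ρ e u}

lemma step_weight (observe : (ℕ → 𝒜) → 𝒜 → ℝ) (t : ℕ) (M : Memory 𝒜) :
    (step C T abar u observe t M).weight =
      if t = blockLast T t then
        Function.update M.weight (currentExponent T u M t) (M.weight (currentExponent T u M t) *
          Real.exp (mixing T / ((numCandidates T : ℝ) *
            selectProb T M.weight (currentExponent T u M t)) *
            (1 / 2 + (∑ s ∈ Finset.Icc (blockFirst T t) t,
              (step C T abar u observe t M).reward s) / gainScale C T)))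
      else M.weight := rfl

lemma blockIndex_add {i x : ℕ} (hx : x < blockLength T) :
    blockIndex T (i * blockLength T + x + 1) = i + 1 := by
  unfold blockIndex
  rw [Nat.add_sub_cancel, Nat.add_comm (i * _), Nat.add_mul_div_right _ _ (by omega),
    Nat.div_eq_of_lt hx, Nat.zero_add]

lemma blockFirst_add {i x : ℕ} (hx : x < blockLength T) :
    blockFirst T (i * blockLength T + x + 1) = i * blockLength T + 1 := by
  rw [blockFirst, blockIndex_add hx, Nat.add_sub_cancel]

lemma blockLast_add {i x : ℕ} (hx : x < blockLength T) (hi : i * blockLength T ≤ T) :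
    blockLast T (i * blockLength T + x + 1) = i * blockLength T + blockLen T i := by
  rw [blockLast, blockIndex_add hx, blockLen, Nat.succ_mul]
  omega

/-- The policy and the block apply the same test: the rotting that the estimator adds for the
pulls before each observation sums up to `β n (n - 1) / 2`. -/
lemma keeps_iff {i x : ℕ} {s : BlockState}
    (hs : Simulates C T abar m ρ e u i x s) (hx : x < blockLength T) (h0 : s.pulls = 0 ↔ x = 0)
    (j : ℕ) :
    Keeps T (run C T abar m ρ e u (i * blockLength T + x)) (i * blockLength T + x + 1) (rate j) ↔
      s.Keep (rate j) (confConst T) := by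
  classical
  unfold Keeps BlockState.Keep
  rw [blockFirst_add hx, Nat.add_sub_cancel]
  have hiff : i * blockLength T + x + 1 ≠ i * blockLength T + 1 ↔ s.pulls ≠ 0 := by
    rw [Ne, Ne, h0]; omega
  rw [hiff]
  refine and_congr_right fun hp => ?_
  have hx0 : x ≠ 0 := fun h => hp (h0.2 h)
  have hcount : ∀ t ≤ i * blockLength T + x + 1, ∀ a,
      pullCount (run C T abar m ρ e u (i * blockLength T + x)).arm (i * blockLength T + 1) t a =
      pullCount (pulledArm C T abar m ρ e u) (i * blockLength T + 1) t a := fun t ht a =>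
    pullCount_congr (fun s _ h2 => run_arm _ _ _ _ _ _ _ (by omega)) a
  unfold ucb initialMeanEst
  rw [blockFirst_add hx, hcount _ le_rfl, run_arm C T abar m ρ e u le_rfl, hs.pulls hx0,
    ← hs.estimate hx0, confConst]
  have hsum : (∑ t ∈ Finset.Ico (i * blockLength T + 1) (i * blockLength T + x + 1),
      if (run C T abar m ρ e u (i * blockLength T + x)).arm t =
        pulledArm C T abar m ρ e u (i * blockLength T + x) then
      (run C T abar m ρ e u (i * blockLength T + x)).reward t + rate j *
        (pullCount (run C T abar m ρ e u (i * blockLength T + x)).arm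
        (i * blockLength T + 1) t (pulledArm C T abar m ρ e u (i * blockLength T + x)) : ℝ)
      else 0) = ∑ t ∈ Finset.Ico (i * blockLength T + 1) (i * blockLength T + x + 1),
      if pulledArm C T abar m ρ e u t = pulledArm C T abar m ρ e u (i * blockLength T + x) then
      (run C T abar m ρ e u t).reward t + rate j * (pullCount (pulledArm C T abar m ρ e u)
        (i * blockLength T + 1) t (pulledArm C T abar m ρ e u (i * blockLength T + x)) : ℝ)
      else 0 := by
    refine Finset.sum_congr rfl fun t ht => ?_
    rw [Finset.mem_Ico] at ht
    rw [hcount t ht.2.le, run_arm C T abar m ρ e u (by omega : t ≤ i * blockLength T + x),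
      run_reward C T abar m ρ e u (by omega : t ≤ i * blockLength T + x)]
  rw [← hsum]

lemma currentExponent_eq {i x : ℕ} {s : BlockState}
    (hs : Simulates C T abar m ρ e u i x s) (hx : x < blockLen T i) :
    currentExponent T u (run C T abar m ρ e u (i * blockLength T + x)) (i * blockLength T + x + 1) =
      choice C T ρ (m ∘ abar) e u i := by
  have hx' := hx.trans_le (blockLen_le T i)
  unfold currentExponent
  rw [blockFirst_add hx', blockIndex_add hx']
  split_ifs with h
  · rw [choice, hs.weight, if_neg hx.ne]
  · exact hs.exponent (by omega)

lemma Simulates.next (habar : Function.Injective abar) {i x : ℕ}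
    (hi : i * blockLength T ≤ T) (hx : x < blockLen T i)
    (hs : Simulates C T abar m ρ e u i x
      (blockRun (rate (choice C T ρ (m ∘ abar) e u i)) (confConst T) (blockShift T i ρ)
        (freshMeans C T ρ (m ∘ abar) e u i) (blockShift T i e) x)) :
    Simulates C T abar m ρ e u i (x + 1)
      (blockRun (rate (choice C T ρ (m ∘ abar) e u i)) (confConst T) (blockShift T i ρ)
        (freshMeans C T ρ (m ∘ abar) e u i) (blockShift T i e) (x + 1)) := by
  classical
  have hx' := hx.trans_le (blockLen_le T i)
  set j := choice C T ρ (m ∘ abar) e u i with hj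
  have hk := keeps_iff hs hx' (pulls_blockRun_eq_zero_iff ..) j
  have hcur := currentExponent_eq hs hx
  rw [← hj] at hcur
  have hrun : run C T abar m ρ e u (i * blockLength T + (x + 1)) =
      step C T abar u (fun arm a => meanReward m ρ arm (i * blockLength T + x + 1) a +
        e (i * blockLength T + x + 1)) (i * blockLength T + x + 1)
        (run C T abar m ρ e u (i * blockLength T + x)) := rfl
  have hpulls0 := pulls_blockRun_eq_zero_iff (rate j) (confConst T) (blockShift T i ρ)
        (freshMeans C T ρ (m ∘ abar) e u i) (blockShift T i e) x
  set st := blockRun (rate j) (confConst T) (blockShift T i ρ)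
        (freshMeans C T ρ (m ∘ abar) e u i) (blockShift T i e) x with hst
  have hst' : blockRun (rate j) (confConst T) (blockShift T i ρ)
        (freshMeans C T ρ (m ∘ abar) e u i) (blockShift T i e) (x + 1) = st.next (rate j)
        (confConst T) (ρ (i * blockLength T + x + 1)) (m (abar ((run C T abar m ρ e u
          (i * blockLength T + x)).selected))) (e (i * blockLength T + x + 1)) := by
    rw [blockRun_succ, ← hst, hs.selected, freshMeans, blockShift, blockShift]
    simp only [Function.comp, Nat.add_right_comm _ 1 x]
  have hsum : ∀ f : ℕ → ℝ,
      ∑ t ∈ Finset.Ico (i * blockLength T + 1) (i * blockLength T + (x + 1) + 1), f t =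
      ∑ t ∈ Finset.Ico (i * blockLength T + 1) (i * blockLength T + x + 1), f t
        + f (i * blockLength T + x + 1) := fun f =>
    Finset.sum_Ico_succ_top (by omega) f
  have hsum1 : ∀ f : ℕ → ℝ, ∑ t ∈ Finset.Ico 1 (i * blockLength T + (x + 1) + 1),
      f t = ∑ t ∈ Finset.Ico 1 (i * blockLength T + x + 1), f t
        + f (i * blockLength T + x + 1) := fun f =>
    Finset.sum_Ico_succ_top (by omega) f
  have hcnt : ∀ a, pullCount (pulledArm C T abar m ρ e u) (i * blockLength T + 1)
    (i * blockLength T + (x + 1) + 1) a = pullCount (pulledArm C T abar m ρ e u)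
      (i * blockLength T + 1) (i * blockLength T + x + 1) a
      + if pulledArm C T abar m ρ e u (i * blockLength T + x + 1) = a then 1 else 0 := fun a =>
    pullCount_succ _ (by omega) a
  -- the arm, the reward and the mean reward of the new step
  have harm : pulledArm C T abar m ρ e u (i * blockLength T + x + 1) =
      if st.Keep (rate j) (confConst T) then pulledArm C T abar m ρ e u (i * blockLength T + x)
      else abar (run C T abar m ρ e u (i * blockLength T + x)).selected := by
    rw [← run_arm C T abar m ρ e u (le_refl (i * blockLength T + x + 1))]
    change (run C T abar m ρ e u (i * blockLength T + (x + 1))).arm _ = _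
    rw [hrun]
    simp only [step, Function.update_self, hcur, hk, Nat.add_sub_cancel]
    rw [run_arm C T abar m ρ e u le_rfl]
  have hsel : (run C T abar m ρ e u (i * blockLength T + (x + 1))).selected =
      if st.Keep (rate j) (confConst T) then (run C T abar m ρ e u (i * blockLength T + x)).selected
      else (run C T abar m ρ e u (i * blockLength T + x)).selected + 1 := by
    rw [hrun]
    simp only [step, hcur, hk]
  have hmean : meanReward m ρ (pulledArm C T abar m ρ e u) (i * blockLength T + x + 1)
      (pulledArm C T abar m ρ e u (i * blockLength T + x + 1)) =
      if st.Keep (rate j) (confConst T) then st.mean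
      else m (abar (run C T abar m ρ e u (i * blockLength T + x)).selected) := by
    rw [harm]
    split_ifs with h
    · exact hs.mean fun h0 => h.1 (hpulls0.2 h0)
    · unfold meanReward
      rw [Finset.sum_eq_zero, sub_zero]
      intro t ht
      rw [Finset.mem_Ico] at ht
      obtain ⟨k, hk1, hk2⟩ := hs.arms t ht.1 (by omega)
      rw [if_neg]
      rw [hk2]
      exact fun h => hk1.ne (habar h)
  have hrew : (run C T abar m ρ e u (i * blockLength T + x + 1)).reward
      (i * blockLength T + x + 1) =
      (if st.Keep (rate j) (confConst T) then st.mean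
      else m (abar (run C T abar m ρ e u (i * blockLength T + x)).selected))
        + e (i * blockLength T + x + 1) := by
    change (run C T abar m ρ e u (i * blockLength T + (x + 1))).reward _ = _
    rw [← hmean, harm, hrun]
    simp only [step, Function.update_self, hcur, hk, Nat.add_sub_cancel]
    rw [run_arm C T abar m ρ e u le_rfl]
    congr 1
    exact meanReward_congr m ρ (fun s _ h2 => run_arm _ _ _ _ _ _ _ (by omega)) _
  have hreward : ∑ t ∈ Finset.Ico (i * blockLength T + 1) (i * blockLength T + (x + 1) + 1),
      (run C T abar m ρ e u t).reward t = (x + 1 : ℕ) - (st.next (rate j)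
        (confConst T) (ρ (i * blockLength T + x + 1)) (m (abar ((run C T abar m ρ e u
          (i * blockLength T + x)).selected))) (e (i * blockLength T + x + 1))).regret
        + ∑ y ∈ Finset.range (x + 1), blockShift T i e y := by
    rw [hsum, hs.reward, hrew, Finset.sum_range_succ]
    simp only [blockShift, Nat.add_right_comm _ 1 x]
    by_cases h : st.Keep (rate j) (confConst T)
    · rw [if_pos h, BlockState.next_of_keep h]; push_cast; ring
    · rw [if_neg h, BlockState.next_of_not_keep h]; push_cast; ring
  rw [hst']
  refine ⟨?_, ?_, ?_, ?_, ?_, ?_, ?_, hreward, ?_⟩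
  · rw [hsel, hs.selected]
    by_cases h : st.Keep (rate j) (confConst T)
    · rw [if_pos h, BlockState.next_of_keep h]
    · rw [if_neg h, BlockState.next_of_not_keep h, Nat.add_assoc]
  · intro t h1 h2
    rcases Nat.lt_or_ge (i * blockLength T + x) t with h3 | h3
    · obtain rfl : t = i * blockLength T + x + 1 := by omega
      rw [hsel, harm]
      split_ifs with h
      · have hx0 : x ≠ 0 := fun h0 => h.1 (hpulls0.2 h0)
        exact hs.arms _ (by omega) le_rfl
      · exact ⟨_, Nat.lt_succ_self _, rfl⟩
    · obtain ⟨k, hk1, hk2⟩ := hs.arms t h1 h3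
      refine ⟨k, ?_, hk2⟩
      rw [hsel]
      split_ifs <;> omega
  · intro _
    rw [hrun]
    exact hcur
  · rw [hrun, step_weight, ← hrun, hcur, blockLast_add hx' hi, blockFirst_add hx', hs.weight,
      if_neg hx.ne]
    by_cases hl : x + 1 = blockLen T i
    · have hR : ∑ s ∈ Finset.Icc (i * blockLength T + 1) (i * blockLength T + x + 1),
          (run C T abar m ρ e u (i * blockLength T + (x + 1))).reward s =
          ∑ t ∈ Finset.Ico (i * blockLength T + 1) (i * blockLength T + (x + 1) + 1),
            (run C T abar m ρ e u t).reward t := by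
        rw [← Finset.Ico_add_one_right_eq_Icc]
        refine Finset.sum_congr rfl fun t ht => ?_
        rw [Finset.mem_Ico] at ht
        exact run_reward _ _ _ _ _ _ _ (by omega)
      rw [if_pos (by omega), if_pos hl, hR, hreward, ← hst', hl]
      rfl
    · rw [if_neg (by omega), if_neg hl]
  · intro _
    rw [hcnt, ← Nat.add_assoc, if_pos rfl, harm]
    by_cases h : st.Keep (rate j) (confConst T)
    · have hx0 : x ≠ 0 := fun h0 => h.1 (hpulls0.2 h0)
      rw [if_pos h, BlockState.next_of_keep h, hs.pulls hx0]
    · rw [if_neg h, BlockState.next_of_not_keep h]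
      simp only [pullCount, Nat.add_eq_right, Finset.card_eq_zero]
      rw [Finset.filter_eq_empty_iff]
      intro t ht
      rw [Finset.mem_Ico] at ht
      obtain ⟨k, hk1, hk2⟩ := hs.arms t (by omega) (by omega)
      rw [hk2]
      exact fun h => hk1.ne (habar h)
  · intro _ β
    rw [hsum, ← Nat.add_assoc, if_pos rfl, hrew, harm]
    by_cases h : st.Keep (rate j) (confConst T)
    · have hx0 : x ≠ 0 := fun h0 => h.1 (hpulls0.2 h0)
      simp only [if_pos h]
      rw [BlockState.next_of_keep h, hs.pulls hx0, hs.estimate hx0]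
      push_cast
      ring
    · simp only [if_neg h]
      have hz : ∀ t ∈ Finset.Ico (i * blockLength T + 1) (i * blockLength T + x + 1),
          pulledArm C T abar m ρ e u t ≠
            abar (run C T abar m ρ e u (i * blockLength T + x)).selected := by
        intro t ht
        rw [Finset.mem_Ico] at ht
        obtain ⟨k, hk1, hk2⟩ := hs.arms t (by omega) (by omega)
        rw [hk2]
        exact fun h => hk1.ne (habar h)
      rw [BlockState.next_of_not_keep h, Finset.sum_eq_zero fun t ht => if_neg (hz t ht)]
      have : pullCount (pulledArm C T abar m ρ e u) (i * blockLength T + 1)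
          (i * blockLength T + x + 1)
          (abar (run C T abar m ρ e u (i * blockLength T + x)).selected) = 0 := by
        simp only [pullCount, Finset.card_eq_zero]
        rw [Finset.filter_eq_empty_iff]
        exact fun t ht => hz t ht
      rw [this]
      push_cast
      ring
  · intro _
    rw [hsum1, ← Nat.add_assoc, if_pos rfl, harm]
    by_cases h : st.Keep (rate j) (confConst T)
    · have hx0 : x ≠ 0 := fun h0 => h.1 (hpulls0.2 h0)
      simp only [if_pos h]
      rw [BlockState.next_of_keep h, ← hs.mean hx0]
      ring
    · simp only [if_neg h]
      rw [BlockState.next_of_not_keep h, Finset.sum_eq_zero]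
      · ring
      · intro t ht
        rw [Finset.mem_Ico] at ht
        obtain ⟨k, hk1, hk2⟩ := hs.arms t (by omega) (by omega)
        rw [if_neg]
        rw [hk2]
        exact fun h => hk1.ne (habar h)
  · rw [hsum, hs.regret, hmean]
    by_cases h : st.Keep (rate j) (confConst T)
    · rw [if_pos h, BlockState.next_of_keep h]
    · rw [if_neg h, BlockState.next_of_not_keep h]

lemma simulates_block (habar : Function.Injective abar) {i : ℕ} (hi : i * blockLength T ≤ T)
    (h0 : Simulates C T abar m ρ e u i 0 ⟨0, 0, 0, 0, 0, 0⟩) {x : ℕ} (hx : x ≤ blockLen T i) :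
    Simulates C T abar m ρ e u i x
      (blockRun (rate (choice C T ρ (m ∘ abar) e u i)) (confConst T) (blockShift T i ρ)
        (freshMeans C T ρ (m ∘ abar) e u i) (blockShift T i e) x) := by
  induction x with
  | zero => exact h0
  | succ x ih => exact (ih (by omega)).next habar hi (by omega)

lemma simulates_zero (habar : Function.Injective abar) (hT : 1 ≤ T) {i : ℕ}
    (hi : i < numBlocks T) : Simulates C T abar m ρ e u i 0 ⟨0, 0, 0, 0, 0, 0⟩ := by
  induction i with
  | zero =>
    constructor <;> try simp [run, masterState]
    · intros; omega
    · split_ifs <;> have := blockLen_pos hT hi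
      · omega
      · simp [masterState]
  | succ i ih =>
    have hi' := lt_of_lt_numBlocks hT hi
    have hlen : blockLen T i = blockLength T := by
      unfold blockLen
      rw [Nat.succ_mul] at hi'
      omega
    have h := simulates_block habar (by rw [Nat.succ_mul] at hi'; omega) (ih (by omega)) le_rfl
    have ht : i * blockLength T + blockLen T i = (i + 1) * blockLength T + 0 := by
      rw [hlen]; ring
    constructor
    · rw [← ht, h.selected]; rfl
    · rw [← ht]; exact h.arms
    · exact fun h => absurd rfl h
    · rw [← ht, h.weight, if_pos rfl, if_neg (blockLen_pos hT hi).ne]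
    · exact fun h => absurd rfl h
    · exact fun h => absurd rfl h
    · exact fun h => absurd rfl h
    · simp
    · simp

variable (C ρ e u m) in
/-- The regret is the sum of the regrets of the blocks. -/
theorem regret_eq_sum (habar : Function.Injective abar) (hT : 1 ≤ T) :
    regret C T abar m ρ e u = ∑ i ∈ Finset.range (numBlocks T),
      (blockEnd T ρ i (choice C T ρ (m ∘ abar) e u i) (freshMeans C T ρ (m ∘ abar) e u i)
        (blockShift T i e)).regret := by
  have key : ∀ n ≤ numBlocks T, ∑ t ∈ Finset.Ico 1 (min (n * blockLength T) T + 1),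
      (1 - meanReward m ρ (pulledArm C T abar m ρ e u) t (pulledArm C T abar m ρ e u t)) =
      ∑ i ∈ Finset.range n, (blockEnd T ρ i (choice C T ρ (m ∘ abar) e u i)
        (freshMeans C T ρ (m ∘ abar) e u i) (blockShift T i e)).regret := by
    intro n hn
    induction n with
    | zero => simp
    | succ i ih =>
      have hi := (lt_of_lt_numBlocks hT hn).le
      rw [Finset.sum_range_succ, ← ih (by omega)]
      have h := (simulates_block (m := m) (C := C) (ρ := ρ) (e := e) (u := u) habar hi
        (simulates_zero habar hT hn) le_rfl).regret
      have h1 : min ((i + 1) * blockLength T) T = i * blockLength T + blockLen T i := by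
        rw [blockLen, Nat.succ_mul]
        omega
      rw [blockEnd, ← h, h1, min_eq_left hi]
      exact (Finset.sum_Ico_consecutive _ (by omega) (by omega)).symm
  rw [← key _ le_rfl, min_eq_right (le_numBlocks_mul hT), Finset.Ico_add_one_right_eq_Icc]
  rfl

end Simulation

/-! ### Measurability -/

section Measurability

variable {Ω : Type*} [MeasurableSpace Ω]

lemma measurable_natIndexed {γ : Type*} [MeasurableSpace γ] {f : ℕ → Ω → γ}
    (hf : ∀ n, Measurable (f n)) {N : Ω → ℕ} (hN : Measurable N) :
    Measurable fun ω => f (N ω) ω :=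
  (measurable_from_prod_countable_right (f := fun p : ℕ × Ω => f p.1 p.2) hf).comp
    (hN.prodMk measurable_id)

instance : MeasurableSpace BlockState :=
  MeasurableSpace.comap (fun s => (s.count, s.pulls, s.mean, s.loss, s.noise, s.regret))
    inferInstance

lemma measurable_blockState_iff {f : Ω → BlockState} : Measurable f ↔
    Measurable (fun ω => (f ω).count) ∧ Measurable (fun ω => (f ω).pulls) ∧
    Measurable (fun ω => (f ω).mean) ∧ Measurable (fun ω => (f ω).loss) ∧
    Measurable (fun ω => (f ω).noise) ∧ Measurable (fun ω => (f ω).regret) := by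
  rw [measurable_comap_iff]
  exact ⟨fun h => ⟨h.fst, h.snd.fst, h.snd.snd.fst, h.snd.snd.snd.fst, h.snd.snd.snd.snd.fst,
    h.snd.snd.snd.snd.snd⟩, fun ⟨h1, h2, h3, h4, h5, h6⟩ =>
    h1.prodMk (h2.prodMk (h3.prodMk (h4.prodMk (h5.prodMk h6))))⟩

lemma measurable_next (β L ρ : ℝ) {s : Ω → BlockState} {a e : Ω → ℝ} (hs : Measurable s)
    (ha : Measurable a) (he : Measurable e) :
    Measurable fun ω => (s ω).next β L ρ (a ω) (e ω) := by
  obtain ⟨h1, h2, h3, h4, h5, h6⟩ := measurable_blockState_iff.1 hs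
  have h2' : Measurable fun ω => ((s ω).pulls : ℝ) := measurable_from_nat.comp h2
  have hK : MeasurableSet {ω | (s ω).Keep β L} := by
    refine MeasurableSet.inter (h2 (measurableSet_singleton 0).compl) ?_
    change MeasurableSet {ω | 1 - β ^ (1 / 3 : ℝ) ≤ (((s ω).pulls - (s ω).loss + (s ω).noise) +
      β * ((s ω).pulls * ((s ω).pulls - 1) / 2)) / (s ω).pulls - β * (s ω).pulls +
      Real.sqrt (L / (s ω).pulls)}
    exact measurableSet_le measurable_const (by fun_prop)
  refine Measurable.ite hK ?_ ?_
  · refine measurable_blockState_iff.2 ⟨h1, ?_, ?_, ?_, ?_, ?_⟩ <;> fun_prop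
  · refine measurable_blockState_iff.2 ⟨?_, ?_, ?_, ?_, ?_, ?_⟩ <;> fun_prop

lemma measurable_blockRun (β L : ℝ) (ρ : ℕ → ℝ) {m e : Ω → ℕ → ℝ} (hm : Measurable m)
    (he : Measurable e) (x : ℕ) : Measurable fun ω => blockRun β L ρ (m ω) (e ω) x := by
  induction x with
  | zero => exact measurable_const
  | succ x ih =>
    refine measurable_next _ _ _ ih ?_ (he.eval)
    exact measurable_natIndexed (f := fun n ω => m ω n) (fun n => hm.eval)
      (measurable_blockState_iff.1 ih).1

lemma measurable_draw (T : ℕ) {p : Ω → ℕ → ℝ} {u : Ω → ℝ} (hp : Measurable p)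
    (hu : Measurable u) : Measurable fun ω => draw T (p ω) (u ω) := by
  have hS : ∀ j, MeasurableSet {ω | j ∈ {j | j ∈ exponents T ∧
      u ω ≤ ∑ l ∈ (exponents T).filter (fun l => l ≤ j), p ω l}} := fun j =>
    (MeasurableSet.const _).inter (measurableSet_le hu
      (Finset.measurable_sum _ fun l _ => hp.eval))
  refine measurable_to_countable' fun j => ?_
  have : (fun ω => draw T (p ω) (u ω)) ⁻¹' {j} =
      ({ω | j ∈ {j | j ∈ exponents T ∧
        u ω ≤ ∑ l ∈ (exponents T).filter (fun l => l ≤ j), p ω l}} ∩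
        ⋂ l ∈ Finset.range j, {ω | l ∈ {j | j ∈ exponents T ∧
        u ω ≤ ∑ l ∈ (exponents T).filter (fun l => l ≤ j), p ω l}}ᶜ) ∪
      ({_ω | j = 0} ∩ ⋂ l, {ω | l ∈ {j | j ∈ exponents T ∧
        u ω ≤ ∑ l ∈ (exponents T).filter (fun l => l ≤ j), p ω l}}ᶜ) := by
    ext ω
    simp only [Set.mem_preimage, Set.mem_singleton_iff, Set.mem_union, Set.mem_inter_iff,
      Set.mem_iInter, Set.mem_compl_iff, Finset.mem_range, draw]
    set S : Set ℕ := {j | j ∈ exponents T ∧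
        u ω ≤ ∑ l ∈ (exponents T).filter (fun l => l ≤ j), p ω l} with hSdef
    change _ ↔ (j ∈ S ∧ ∀ i < j, i ∉ S) ∨ (j = 0 ∧ ∀ i, i ∉ S)
    constructor
    · rintro rfl
      rcases S.eq_empty_or_nonempty with h | h
      · right; rw [h]; simp
      · left; exact ⟨Nat.sInf_mem h, fun i hi => Nat.notMem_of_lt_sInf hi⟩
    · rintro (⟨h1, h2⟩ | ⟨rfl, h2⟩)
      · refine le_antisymm (Nat.sInf_le h1) ?_
        by_contra! h
        exact h2 _ h (Nat.sInf_mem ⟨j, h1⟩)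
      · rw [Set.eq_empty_of_forall_notMem h2, Nat.sInf_empty]
  rw [this]
  refine ((hS j).inter (Finset.measurableSet_biInter _ fun l _ => (hS l).compl)).union
    ((MeasurableSet.const _).inter (MeasurableSet.iInter fun l => (hS l).compl))

lemma measurable_selectProb (T : ℕ) {w : Ω → ℕ → ℝ} (hw : Measurable w) :
    Measurable fun ω => selectProb T (w ω) := by
  refine measurable_pi_iff.2 fun j => ?_
  unfold selectProb
  fun_prop

lemma measurable_blockShift (T i : ℕ) {e : Ω → ℕ → ℝ} (he : Measurable e) :
    Measurable fun ω => blockShift T i (e ω) :=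
  measurable_pi_iff.2 fun _ => he.eval

variable (C : ℝ) (T : ℕ) (ρ : ℕ → ℝ)

lemma measurable_blockEnd (i : ℕ) {j : Ω → ℕ} {m e : Ω → ℕ → ℝ} (hj : Measurable j)
    (hm : Measurable m) (he : Measurable e) :
    Measurable fun ω => blockEnd T ρ i (j ω) (m ω) (e ω) :=
  measurable_natIndexed (fun _ => measurable_blockRun _ _ _ hm he _) hj

lemma measurable_blockEnd_regret (i : ℕ) {j : Ω → ℕ} {m e : Ω → ℕ → ℝ} (hj : Measurable j)
    (hm : Measurable m) (he : Measurable e) :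
    Measurable fun ω => (blockEnd T ρ i (j ω) (m ω) (e ω)).regret :=
  (measurable_blockState_iff.1 (measurable_blockEnd T ρ i hj hm he)).2.2.2.2.2

lemma measurable_blockEnd_count (i : ℕ) {j : Ω → ℕ} {m e : Ω → ℕ → ℝ} (hj : Measurable j)
    (hm : Measurable m) (he : Measurable e) :
    Measurable fun ω => (blockEnd T ρ i (j ω) (m ω) (e ω)).count :=
  (measurable_blockState_iff.1 (measurable_blockEnd T ρ i hj hm he)).1

lemma measurable_blockGain (i : ℕ) {j : Ω → ℕ} {m e : Ω → ℕ → ℝ} (hj : Measurable j)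
    (hm : Measurable m) (he : Measurable e) :
    Measurable fun ω => blockGain C T ρ i (j ω) (m ω) (e ω) := by
  have := measurable_blockEnd_regret T ρ i hj hm he
  unfold blockGain
  fun_prop

variable {m e u : Ω → ℕ → ℝ}

lemma measurable_masterState (hm : Measurable m) (he : Measurable e) (hu : Measurable u) (i : ℕ) :
    Measurable fun ω => masterState C T ρ (m ω) (e ω) (u ω) i := by
  induction i with
  | zero => exact measurable_const
  | succ i ih =>
    have hj : Measurable fun ω => draw T (selectProb T (masterState C T ρ (m ω) (e ω) (u ω) i).2)
        (u ω (i + 1)) := measurable_draw T (measurable_selectProb T ih.snd) hu.eval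
    have hf : Measurable fun ω => (fun k => m ω ((masterState C T ρ (m ω) (e ω) (u ω) i).1 + k)) :=
      measurable_pi_iff.2 fun k => measurable_natIndexed (f := fun n ω => m ω (n + k))
        (fun n => hm.eval) ih.fst
    have hs := measurable_blockShift T i he
    refine Measurable.prodMk (ih.fst.add (measurable_blockEnd_count T ρ i hj hf hs)) ?_
    refine measurable_pi_iff.2 fun l => ?_
    simp only [Function.update_apply]
    have hw : Measurable fun ω => (masterState C T ρ (m ω) (e ω) (u ω) i).2 (draw T (selectProb T
        (masterState C T ρ (m ω) (e ω) (u ω) i).2) (u ω (i + 1))) :=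
      measurable_natIndexed (f := fun n ω => (masterState C T ρ (m ω) (e ω) (u ω) i).2 n)
        (fun _ => ih.snd.eval) hj
    have hp : Measurable fun ω => selectProb T (masterState C T ρ (m ω) (e ω) (u ω) i).2
        (draw T (selectProb T (masterState C T ρ (m ω) (e ω) (u ω) i).2) (u ω (i + 1))) :=
      measurable_natIndexed
        (f := fun n ω => selectProb T (masterState C T ρ (m ω) (e ω) (u ω) i).2 n)
        (fun n => (measurable_selectProb T ih.snd).eval) hj
    have hg := measurable_blockGain C T ρ i hj hf hs
    refine Measurable.ite (measurableSet_eq_fun measurable_const hj) ?_ ih.snd.eval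
    exact hw.mul
      (Real.measurable_exp.comp ((measurable_const.div (measurable_const.mul hp)).mul hg))

lemma measurable_choice (hm : Measurable m) (he : Measurable e) (hu : Measurable u) (i : ℕ) :
    Measurable fun ω => choice C T ρ (m ω) (e ω) (u ω) i :=
  measurable_draw T (measurable_selectProb T (measurable_masterState C T ρ hm he hu i).snd) hu.eval

lemma measurable_freshMeans (hm : Measurable m) (he : Measurable e) (hu : Measurable u) (i : ℕ) :
    Measurable fun ω => freshMeans C T ρ (m ω) (e ω) (u ω) i :=
  measurable_pi_iff.2 fun k => measurable_natIndexed (f := fun n ω => m ω (n + k))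
    (fun _ => hm.eval) (measurable_masterState C T ρ hm he hu i).fst

lemma measurableSet_noiseGood (H : ℕ) (L : ℝ) (he : Measurable e) :
    MeasurableSet {ω | NoiseGood H L (e ω)} := by
  have : {ω | NoiseGood H L (e ω)} = ⋂ a, ⋂ b, {ω | a ≤ b → b ≤ H →
      |∑ y ∈ Finset.Ico a b, e ω y| ≤ Real.sqrt (L * ((b - a : ℕ) : ℝ))} := by
    ext; simp [NoiseGood]
  rw [this]
  refine MeasurableSet.iInter fun a => MeasurableSet.iInter fun b => ?_
  by_cases h1 : a ≤ b
  · by_cases h2 : b ≤ H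
    · simp only [h1, h2, true_imp_iff]
      exact measurableSet_le ((Finset.measurable_sum _ fun y _ => he.eval).abs) measurable_const
    · simp [h2]
  · simp [h1]

end Measurability

/-! ### What the state of the master depends on -/

lemma masterState_fst_le (C : ℝ) (T : ℕ) (ρ m e u : ℕ → ℝ) (i : ℕ) :
    (masterState C T ρ m e u i).1 ≤ i * blockLength T := by
  induction i with
  | zero => simp [masterState]
  | succ i ih =>
    rw [masterState, Nat.succ_mul]
    exact Nat.add_le_add ih ((blockRun_count_le ..).trans (blockLen_le T i))

/-- The state of the master before block `i` depends only on the means of the arms selected so far,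
on the noise of the earlier blocks, and on the earlier draws. -/
lemma masterState_congr {C : ℝ} {T : ℕ} {ρ m m' e e' u u' : ℕ → ℝ} {i : ℕ}
    (hm : ∀ k < (masterState C T ρ m e u i).1, m k = m' k)
    (he : ∀ t ≤ i * blockLength T, e t = e' t) (hu : ∀ l ≤ i, u l = u' l) :
    masterState C T ρ m' e' u' i = masterState C T ρ m e u i := by
  induction i with
  | zero => rfl
  | succ i ih =>
    rw [masterState] at hm
    have h1 := ih (fun k hk => hm k (hk.trans_le (Nat.le_add_right _ _)))
      (fun t ht => he t (by rw [Nat.succ_mul]; omega)) (fun l hl => hu l (by omega))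
    rw [masterState, masterState, h1, ← hu (i + 1) le_rfl]
    set s := masterState C T ρ m e u i
    set j := draw T (selectProb T s.2) (u (i + 1))
    have h2 : blockEnd T ρ i j (fun k => m' (s.1 + k)) (blockShift T i e') =
        blockEnd T ρ i j (fun k => m (s.1 + k)) (blockShift T i e) := by
      refine blockRun_congr le_rfl (fun k hk => hm _ (Nat.add_lt_add_left hk _)) fun y hy => ?_
      have := hy.trans_le (blockLen_le T i)
      exact he _ (by rw [Nat.succ_mul]; omega)
    have h3 : ∑ x ∈ Finset.range (blockLen T i), blockShift T i e' x =
        ∑ x ∈ Finset.range (blockLen T i), blockShift T i e x := by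
      refine Finset.sum_congr rfl fun y hy => ?_
      have := (Finset.mem_range.1 hy).trans_le (blockLen_le T i)
      exact (he _ (by rw [Nat.succ_mul]; omega)).symm
    rw [h2, blockGain, h2, h3, ← blockGain]

/-! ### Drawing a candidate -/

lemma mixing_pos {T : ℕ} (hB : 2 ≤ numCandidates T) (hT : 1 ≤ T) : 0 < mixing T := by
  have hn : 0 < numBlocks T := by
    by_contra! h
    have := le_numBlocks_mul hT
    rw [Nat.le_zero.1 h] at this
    omega
  have h1 : 0 < Real.log (numCandidates T : ℝ) := Real.log_pos (by exact_mod_cast hB)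
  have h2 : 0 < Real.exp 1 - 1 := by linarith [Real.add_one_lt_exp (one_ne_zero)]
  have h3 : (0 : ℝ) < numCandidates T := by exact_mod_cast (by omega : 0 < numCandidates T)
  have h4 : (0 : ℝ) < numBlocks T := by exact_mod_cast hn
  exact lt_min one_pos (Real.sqrt_pos.2 (by positivity))

lemma mixing_le_one (T : ℕ) : mixing T ≤ 1 := min_le_left _ _

lemma le_selectProb {T : ℕ} {w : ℕ → ℝ} (hw : ∀ j, 0 < w j) (j : ℕ) :
    mixing T / numCandidates T ≤ selectProb T w j := by
  unfold selectProb
  have h1 : 0 ≤ w j / ∑ l ∈ exponents T, w l :=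
    div_nonneg (hw j).le (Finset.sum_nonneg fun l _ => (hw l).le)
  have := mul_nonneg (sub_nonneg.2 (mixing_le_one T)) h1
  rw [div_eq_mul_one_div]
  linarith

lemma sum_selectProb {T : ℕ} {w : ℕ → ℝ} (hw : ∀ j, 0 < w j) (hB : 1 ≤ numCandidates T) :
    ∑ j ∈ exponents T, selectProb T w j = 1 := by
  unfold selectProb
  have hne : (exponents T).Nonempty := Finset.card_pos.1 hB
  have hW : 0 < ∑ l ∈ exponents T, w l := Finset.sum_pos (fun l _ => hw l) hne
  rw [Finset.sum_add_distrib, ← Finset.mul_sum, ← Finset.sum_div, div_self hW.ne',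
    Finset.sum_const, ← numCandidates, nsmul_eq_mul]
  have : (numCandidates T : ℝ) ≠ 0 := by positivity
  field_simp
  ring

lemma masterState_weight_pos (C : ℝ) (T : ℕ) (ρ m e u : ℕ → ℝ) (i j : ℕ) :
    0 < (masterState C T ρ m e u i).2 j := by
  induction i generalizing j with
  | zero => simp [masterState]
  | succ i ih =>
    simp only [masterState, Function.update_apply]
    split_ifs
    · exact mul_pos (ih _) (Real.exp_pos _)
    · exact ih j

lemma draw_mem {T : ℕ} {p : ℕ → ℝ} (hp : ∑ l ∈ exponents T, p l = 1)
    {u : ℝ} (hu : u ≤ 1) : draw T p u ∈ exponents T := by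
  have hne : (exponents T).Nonempty := by
    by_contra! h
    rw [h] at hp
    simp at hp
  refine (Nat.sInf_mem (s := {j | j ∈ exponents T ∧
    u ≤ ∑ l ∈ (exponents T).filter (fun l => l ≤ j), p l}) ?_).1
  refine ⟨(exponents T).max' hne, Finset.max'_mem _ _, ?_⟩
  rw [Finset.filter_true_of_mem fun l hl => Finset.le_max' _ _ hl, hp]
  exact hu

lemma draw_eq_iff {T : ℕ} {p : ℕ → ℝ} (hp : ∀ l, 0 ≤ p l) {j : ℕ} (hj : j ∈ exponents T)
    {u : ℝ} (hu : 0 < u) : draw T p u = j ↔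
      ∑ l ∈ (exponents T).filter (fun l => l < j), p l < u ∧
        u ≤ ∑ l ∈ (exponents T).filter (fun l => l ≤ j), p l := by
  have h3 := (Finset.mem_Icc.1 hj)
  unfold draw
  set S : Set ℕ := {j | j ∈ exponents T ∧ u ≤ ∑ l ∈ (exponents T).filter (fun l => l ≤ j), p l}
    with hS
  constructor
  · intro h
    have hne : S.Nonempty := by
      by_contra! h'
      rw [h', Nat.sInf_empty] at h
      omega
    have hmem : j ∈ S := h ▸ Nat.sInf_mem hne
    refine ⟨?_, hmem.2⟩
    by_contra! hle
    rcases h3.1.eq_or_lt with rfl | hlt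
    · rw [Finset.filter_false_of_mem, Finset.sum_empty] at hle
      · linarith
      · intro l hl
        have := (Finset.mem_Icc.1 hl).1
        omega
    · have hmem' : j - 1 ∈ S := by
        refine ⟨Finset.mem_Icc.2 ⟨by omega, by omega⟩, hle.trans_eq ?_⟩
        refine Finset.sum_congr (Finset.filter_congr fun l _ => ?_) fun _ _ => rfl
        omega
      have := Nat.sInf_le hmem'
      omega
  · rintro ⟨h1, h2⟩
    have hmem : j ∈ S := ⟨hj, h2⟩
    refine le_antisymm (Nat.sInf_le hmem) ?_
    by_contra! hlt
    have h4 := (Nat.sInf_mem ⟨j, hmem⟩ : sInf S ∈ S).2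
    have h5 : ∑ l ∈ (exponents T).filter (fun l => l ≤ sInf S), p l ≤
        ∑ l ∈ (exponents T).filter (fun l => l < j), p l := by
      refine Finset.sum_le_sum_of_subset_of_nonneg ?_ fun l _ _ => hp l
      intro l hl
      rw [Finset.mem_filter] at hl ⊢
      exact ⟨hl.1, by omega⟩
    linarith

/-- Inversion of the distribution function draws exponent `j` with probability `p j`. -/
lemma volume_draw_eq {T : ℕ} {p : ℕ → ℝ} (hp : ∀ l, 0 ≤ p l) (hp1 : ∑ l ∈ exponents T, p l = 1)
    {j : ℕ} (hj : j ∈ exponents T) :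
    (volume.restrict (Set.Icc (0 : ℝ) 1)).real {u | draw T p u = j} = p j := by
  set a := ∑ l ∈ (exponents T).filter (fun l => l < j), p l with ha
  have hb : ∑ l ∈ (exponents T).filter (fun l => l ≤ j), p l = a + p j := by
    have : (exponents T).filter (fun l => l ≤ j) =
        insert j ((exponents T).filter (fun l => l < j)) := by
      ext l
      simp only [Finset.mem_filter, Finset.mem_insert]
      constructor
      · rintro ⟨h1, h2⟩
        rcases h2.eq_or_lt with h | h
        · exact Or.inl h
        · exact Or.inr ⟨h1, h⟩
      · rintro (rfl | ⟨h1, h2⟩)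
        · exact ⟨hj, le_rfl⟩
        · exact ⟨h1, h2.le⟩
    rw [this, Finset.sum_insert (by simp), ha]
    ring
  have ha0 : 0 ≤ a := Finset.sum_nonneg fun l _ => hp l
  have hb1 : a + p j ≤ 1 := by
    rw [← hb, ← hp1]
    exact Finset.sum_le_sum_of_subset_of_nonneg (Finset.filter_subset _ _) fun l _ _ => hp l
  -- `Set.Ioc` instead of `Set.Icc`: at `u = 0` the smallest exponent is drawn.
  have hset : {u | draw T p u = j} ∩ Set.Ioc 0 1 = Set.Ioc a (a + p j) := by
    ext u
    simp only [Set.mem_inter_iff, Set.mem_ofPred_eq, Set.mem_Ioc]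
    constructor
    · rintro ⟨h1, h2, _⟩
      rwa [draw_eq_iff hp hj h2, hb] at h1
    · rintro ⟨h1, h2⟩
      have h0 : 0 < u := by linarith
      refine ⟨?_, h0, by linarith⟩
      rw [draw_eq_iff hp hj h0, hb]
      exact ⟨h1, h2⟩
  have hmeas : Measurable fun u : ℝ => draw T p u :=
    measurable_draw T measurable_const measurable_id
  have hset' : (fun u : ℝ => draw T p u) ⁻¹' {j} ∩ Set.Ioc 0 1 = Set.Ioc a (a + p j) := hset
  change ((volume.restrict (Set.Icc (0 : ℝ) 1)) ((fun u : ℝ => draw T p u) ⁻¹' {j})).toReal = p j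
  rw [← Measure.restrict_congr_set (Ioc_ae_eq_Icc (μ := volume) (a := (0 : ℝ)) (b := 1)),
    Measure.restrict_apply (hmeas (measurableSet_singleton j)), hset', Real.volume_Ioc,
    add_sub_cancel_left, ENNReal.toReal_ofReal (hp j)]

/-! ### Independence -/

section Independence

/-- The information that is carried by the input variables with index in `S`: initial means, noise
terms, and auxiliary uniform variables. -/
@[reducible] def info {Ω : Type*} (m η U : ℕ → Ω → ℝ) (S : Set (ℕ ⊕ ℕ ⊕ ℕ)) : MeasurableSpace Ω :=
  ⨆ x ∈ S, MeasurableSpace.comap (Sum.elim m (Sum.elim η U) x) inferInstance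

lemma measurable_info {Ω : Type*} {m η U : ℕ → Ω → ℝ} {S : Set (ℕ ⊕ ℕ ⊕ ℕ)} {x : ℕ ⊕ ℕ ⊕ ℕ}
    (hx : x ∈ S) : Measurable[info m η U S] (Sum.elim m (Sum.elim η U) x) := by
  rw [measurable_iff_comap_le]
  exact le_iSup₂_of_le x hx le_rfl

lemma measurable_info_pi {Ω : Type*} {m η U : ℕ → Ω → ℝ} {S : Set (ℕ ⊕ ℕ ⊕ ℕ)} {f : ℕ → Ω → ℝ}
    (h : ∀ k, Measurable[info m η U S] (f k)) : Measurable[info m η U S] fun ω k => f k ω :=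
  @measurable_pi_lambda _ _ _ (info m η U S) _ _ h

variable {Ω : Type*} [MeasurableSpace Ω] {P : Measure Ω}
  {m η U : ℕ → Ω → ℝ}

/-- Only the arms of the sequence `abar` matter. -/
lemma RandomInput.comp_injective {𝒜 : Type*} {μ₁ : 𝒜 → Ω → ℝ} (h : RandomInput P μ₁ η U)
    {abar : ℕ → 𝒜} (habar : Function.Injective abar) :
    RandomInput P (fun k => μ₁ (abar k)) η U where
  measurable_mean k := h.measurable_mean _
  measurable_noise := h.measurable_noise
  measurable_unif := h.measurable_unif
  uniform_mean k := h.uniform_mean _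
  subgaussian_noise := h.subgaussian_noise
  uniform_unif := h.uniform_unif
  indep := by
    have := h.indep.precomp (g := Sum.map abar id) (habar.sumMap Function.injective_id)
    convert this using 1
    funext x
    rcases x with k | x <;> rfl

lemma map_eq_of_isUniform {X : Ω → ℝ} (h : pdf.IsUniform X (Set.Icc 0 1) P volume) :
    P.map X = volume.restrict (Set.Icc 0 1) := by
  have : P.map X = ProbabilityTheory.cond volume (Set.Icc 0 1) := h
  rw [this, ProbabilityTheory.cond]
  simp

lemma RandomInput.measurable (h : RandomInput P m η U) (x : ℕ ⊕ ℕ ⊕ ℕ) :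
    Measurable (Sum.elim m (Sum.elim η U) x) := by
  rcases x with k | k | k
  · exact h.measurable_mean k
  · exact h.measurable_noise k
  · exact h.measurable_unif k

lemma RandomInput.info_le (h : RandomInput P m η U) (S : Set (ℕ ⊕ ℕ ⊕ ℕ)) :
    info m η U S ≤ ‹MeasurableSpace Ω› :=
  iSup₂_le fun x _ => (h.measurable x).comap_le

lemma RandomInput.indepFun (h : RandomInput P m η U) {S S' : Set (ℕ ⊕ ℕ ⊕ ℕ)}
    (hS : Disjoint S S') {E F : Type*} [MeasurableSpace E] [MeasurableSpace F] {f : Ω → E}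
    {g : Ω → F} (hf : Measurable[info m η U S] f) (hg : Measurable[info m η U S'] g) :
    IndepFun f g P := by
  have h1 := indep_iSup_of_disjoint (fun x => (h.measurable x).comap_le) h.indep.iIndep hS
  rw [IndepFun_iff_Indep]
  exact indep_of_indep_of_le_left (indep_of_indep_of_le_right h1 hg.comap_le) hf.comap_le

lemma RandomInput.ae_mem (h : RandomInput P m η U) :
    ∀ᵐ ω ∂P, (∀ k, 0 ≤ m k ω ∧ m k ω ≤ 1) ∧ ∀ i, 0 ≤ U i ω ∧ U i ω ≤ 1 := by
  have key : ∀ X : Ω → ℝ, Measurable X → pdf.IsUniform X (Set.Icc 0 1) P volume →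
      ∀ᵐ ω ∂P, 0 ≤ X ω ∧ X ω ≤ 1 := by
    intro X hX hu
    have h1 : ∀ᵐ x ∂(P.map X), x ∈ Set.Icc (0 : ℝ) 1 := by
      rw [map_eq_of_isUniform hu]
      exact ae_restrict_mem measurableSet_Icc
    exact ae_of_ae_map hX.aemeasurable h1
  filter_upwards [ae_all_iff.2 fun k => key _ (h.measurable_mean k) (h.uniform_mean k),
    ae_all_iff.2 fun k => key _ (h.measurable_unif k) (h.uniform_unif k)] with ω h1 h2
  exact ⟨h1, h2⟩

variable [IsProbabilityMeasure P]

/-- Integrating out a uniform variable that is independent of the rest. -/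
lemma integral_indep_unif {E : Type*} [MeasurableSpace E] {W : Ω → E} {V : Ω → ℝ}
    (hW : Measurable W) (hV : Measurable V) (hWV : IndepFun W V P)
    (hU : P.map V = volume.restrict (Set.Icc 0 1)) {g : E × ℝ → ℝ} (hg : Measurable g)
    (hint : Integrable (fun ω => g (W ω, V ω)) P) :
    ∫ ω, g (W ω, V ω) ∂P = ∫ ω, (∫ v in Set.Icc (0 : ℝ) 1, g (W ω, v)) ∂P := by
  have hmap := (indepFun_iff_map_prod_eq_prod_map_map hW.aemeasurable hV.aemeasurable).1 hWV
  rw [hU] at hmap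
  have hint' : Integrable g ((P.map W).prod (volume.restrict (Set.Icc 0 1))) := by
    rw [← hmap]
    exact (integrable_map_measure hg.aestronglyMeasurable (hW.prodMk hV).aemeasurable).2 hint
  have : IsProbabilityMeasure (P.map W) := Measure.isProbabilityMeasure_map hW.aemeasurable
  rw [← integral_map (φ := fun ω => (W ω, V ω)) (f := g) (hW.prodMk hV).aemeasurable
    hg.aestronglyMeasurable, hmap, integral_prod _ hint',
    integral_map hW.aemeasurable hint'.integral_prod_left.aestronglyMeasurable]

/-- The fresh arms of a block are as good as the first arms, whatever the noise is. -/
lemma RandomInput.identDistrib_shift (h : RandomInput P m η U) (κ a : ℕ) :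
    IdentDistrib (fun ω => ((fun k => m (κ + k) ω), fun k => η (a + k) ω))
      (fun ω => ((fun k => m k ω), fun k => η (a + k) ω)) P P := by
  have hm : ∀ κ, Measurable fun ω => (fun k => m (κ + k) ω) := fun κ =>
    measurable_pi_iff.2 fun k => h.measurable_mean _
  have he : Measurable fun ω => (fun k => η (a + k) ω) :=
    measurable_pi_iff.2 fun k => h.measurable_noise _
  have hind : ∀ κ, IndepFun (fun ω => (fun k => m (κ + k) ω)) (fun ω => (fun k => η (a + k) ω)) P :=
    fun κ => by
      refine h.indepFun (S := Set.range Sum.inl) (S' := Set.range Sum.inr)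
        Set.isCompl_range_inl_range_inr.disjoint ?_ ?_
      · exact measurable_info_pi fun k => measurable_info (x := Sum.inl (κ + k)) ⟨_, rfl⟩
      · exact measurable_info_pi fun k => measurable_info (x := Sum.inr (Sum.inl (a + k))) ⟨_, rfl⟩
  have hlaw : ∀ κ, P.map (fun ω => (fun k => m (κ + k) ω)) =
      Measure.infinitePi fun _ : ℕ => (volume.restrict (Set.Icc (0 : ℝ) 1)) := fun κ => by
    have h1 : iIndepFun (fun k ω => m (κ + k) ω) P :=
      h.indep.precomp (g := fun k => Sum.inl (κ + k)) fun a b hab => by simpa using hab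
    rw [(iIndepFun_iff_map_fun_eq_infinitePi_map fun k => h.measurable_mean _).1 h1]
    congr 1
    funext k
    exact map_eq_of_isUniform (h.uniform_mean _)
  refine ⟨((hm κ).prodMk he).aemeasurable, ?_, ?_⟩
  · exact ((measurable_pi_iff.2 fun k => h.measurable_mean _).prodMk he).aemeasurable
  · rw [(indepFun_iff_map_prod_eq_prod_map_map (hm κ).aemeasurable he.aemeasurable).1 (hind κ),
      hlaw κ]
    have h0 :=
      (indepFun_iff_map_prod_eq_prod_map_map (hm 0).aemeasurable he.aemeasurable).1 (hind 0)
    rw [hlaw 0] at h0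
    simp only [Nat.zero_add] at h0
    rw [h0]

end Independence

/-! ### The noise of the blocks -/

lemma NoiseGood.congr {H : ℕ} {L : ℝ} {e e' : ℕ → ℝ} (h : ∀ y < H, e y = e' y) :
    NoiseGood H L e ↔ NoiseGood H L e' := by
  unfold NoiseGood
  refine forall₄_congr fun a b _ hb => ?_
  rw [Finset.sum_congr rfl fun y hy => h y ((Finset.mem_Ico.1 hy).2.trans_le hb)]

/-- The noise of block `i` is tame. -/
def BlockNoiseGood (T i : ℕ) (e : ℕ → ℝ) : Prop :=
  NoiseGood (blockLength T) (confConst T) (blockShift T i e)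

open Classical in
/-- The indicator of tame noise in all blocks before block `i`. -/
noncomputable def prefixGood (T i : ℕ) (e : ℕ → ℝ) : ℝ :=
  if ∀ l < i, BlockNoiseGood T l e then 1 else 0

lemma prefixGood_nonneg (T i : ℕ) (e : ℕ → ℝ) : 0 ≤ prefixGood T i e := by
  unfold prefixGood; split_ifs <;> norm_num

lemma prefixGood_le_one (T i : ℕ) (e : ℕ → ℝ) : prefixGood T i e ≤ 1 := by
  unfold prefixGood; split_ifs <;> norm_num

open Classical in
lemma prefixGood_succ (T i : ℕ) (e : ℕ → ℝ) : prefixGood T (i + 1) e =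
    prefixGood T i e * if BlockNoiseGood T i e then 1 else 0 := by
  unfold prefixGood
  by_cases h1 : BlockNoiseGood T i e
  · rw [if_pos h1, mul_one]
    congr 1
    rw [eq_iff_iff]
    refine ⟨fun h l hl => h l (by omega), fun h l hl => ?_⟩
    rcases (Nat.lt_succ_iff.1 hl).eq_or_lt with rfl | h2
    · exact h1
    · exact h l h2
  · rw [if_neg h1, if_neg fun h => h1 (h i (Nat.lt_succ_self i)), mul_zero]

lemma prefixGood_congr {T i : ℕ} {e e' : ℕ → ℝ} (h : ∀ t ≤ i * blockLength T, e t = e' t) :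
    prefixGood T i e = prefixGood T i e' := by
  unfold prefixGood
  congr 1
  rw [eq_iff_iff]
  refine forall₂_congr fun l hl => NoiseGood.congr fun y hy => h _ ?_
  have : (l + 1) * blockLength T ≤ i * blockLength T := Nat.mul_le_mul_right _ hl
  rw [Nat.succ_mul] at this
  omega

section

variable {Ω : Type*} [MeasurableSpace Ω]

lemma measurableSet_blockNoiseGood (T i : ℕ) {e : Ω → ℕ → ℝ} (he : Measurable e) :
    MeasurableSet {ω | BlockNoiseGood T i (e ω)} :=
  measurableSet_noiseGood _ _ (measurable_blockShift T i he)

lemma measurable_prefixGood (T i : ℕ) {e : Ω → ℕ → ℝ} (he : Measurable e) :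
    Measurable fun ω => prefixGood T i (e ω) := by
  refine Measurable.ite ?_ measurable_const measurable_const
  have : {ω | ∀ l < i, BlockNoiseGood T l (e ω)} =
      ⋂ l ∈ Finset.range i, {ω | BlockNoiseGood T l (e ω)} := by ext; simp
  rw [this]
  exact Finset.measurableSet_biInter _ fun l _ => measurableSet_blockNoiseGood T l he

variable {P : Measure Ω} {m η U : ℕ → Ω → ℝ}

lemma RandomInput.measurable_means (h : RandomInput P m η U) : Measurable fun ω => (m · ω) :=
  measurable_pi_iff.2 h.measurable_mean

lemma RandomInput.measurable_noises (h : RandomInput P m η U) : Measurable fun ω => (η · ω) :=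
  measurable_pi_iff.2 h.measurable_noise

lemma RandomInput.measurable_unifs (h : RandomInput P m η U) : Measurable fun ω => (U · ω) :=
  measurable_pi_iff.2 h.measurable_unif

variable [IsProbabilityMeasure P]

/-- The sub-Gaussian tail bound, with a union bound over the intervals of a block. -/
lemma RandomInput.prob_not_blockNoiseGood_le (h : RandomInput P m η U) {T : ℕ} (hT : 1 ≤ T)
    (i : ℕ) : P.real {ω | ¬ BlockNoiseGood T i (η · ω)} ≤ 8 / (blockLength T : ℝ) ^ 3 := by
  have hH := blockLength_pos hT
  set H := blockLength T with hHd
  have hH1 : (1 : ℝ) ≤ H := by exact_mod_cast hH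
  have hL : 0 ≤ confConst T := mul_nonneg (by norm_num) (Real.log_nonneg hH1)
  have hind : iIndepFun (fun t => η (i * H + 1 + t)) P :=
    h.indep.precomp (g := fun t => Sum.inr (Sum.inl (i * H + 1 + t)))
      fun a b hab => by simpa using hab
  -- The variance proxy of a sum of `n` terms is `n`, so the radius `√(10 n log H)` gives `H⁻⁵`.
  have htail : ∀ a b, a < b → P.real {ω | Real.sqrt (confConst T * ((b - a : ℕ) : ℝ)) ≤
      |∑ y ∈ Finset.Ico a b, η (i * H + 1 + y) ω|} ≤ 2 / (H : ℝ) ^ 5 := by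
    intro a b hab
    have hn : (0 : ℝ) < ((b - a : ℕ) : ℝ) := by exact_mod_cast Nat.sub_pos_of_lt hab
    have hsub : HasSubgaussianMGF (fun ω => ∑ y ∈ Finset.Ico a b, η (i * H + 1 + y) ω)
        (∑ y ∈ Finset.Ico a b, 1) P :=
      HasSubgaussianMGF.sum_of_iIndepFun hind fun t _ => h.subgaussian_noise _
    have hexp : Real.exp (-Real.sqrt (confConst T * ((b - a : ℕ) : ℝ)) ^ 2 /
        (2 * ((∑ y ∈ Finset.Ico a b, 1 : NNReal) : ℝ))) = 1 / (H : ℝ) ^ 5 := by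
      rw [Real.sq_sqrt (by positivity)]
      have : ((∑ y ∈ Finset.Ico a b, 1 : NNReal) : ℝ) = ((b - a : ℕ) : ℝ) := by
        rw [Finset.sum_const, Nat.card_Ico, nsmul_eq_mul, mul_one, NNReal.coe_natCast]
      rw [this, confConst]
      have e1 : -(10 * Real.log (H : ℝ) * ((b - a : ℕ) : ℝ)) / (2 * ((b - a : ℕ) : ℝ)) =
          -(5 * Real.log (H : ℝ)) := by field_simp; ring
      rw [e1, Real.exp_neg, one_div]
      congr 1
      rw [← Real.rpow_natCast, Real.rpow_def_of_pos (by linarith)]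
      congr 1
      push_cast
      ring
    have h1 := hsub.measure_ge_le (Real.sqrt_nonneg (confConst T * ((b - a : ℕ) : ℝ)))
    have h2 := hsub.neg.measure_ge_le (Real.sqrt_nonneg (confConst T * ((b - a : ℕ) : ℝ)))
    rw [hexp] at h1 h2
    refine (measureReal_mono (s₂ := {ω | Real.sqrt (confConst T * ((b - a : ℕ) : ℝ)) ≤
      ∑ y ∈ Finset.Ico a b, η (i * H + 1 + y) ω} ∪
      {ω | Real.sqrt (confConst T * ((b - a : ℕ) : ℝ)) ≤
        (-fun ω => ∑ y ∈ Finset.Ico a b, η (i * H + 1 + y) ω) ω}) ?_).trans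
      ((measureReal_union_le _ _).trans ?_)
    · intro ω hω
      simp only [Set.mem_ofPred_eq] at hω
      exact (le_abs.1 hω).imp id id
    · calc _ ≤ 1 / (H : ℝ) ^ 5 + 1 / (H : ℝ) ^ 5 := add_le_add h1 h2
        _ = _ := by ring
  -- Fewer than `(H + 1)²` intervals.
  set I := ((Finset.range (H + 1)) ×ˢ (Finset.range (H + 1))).filter fun p => p.1 < p.2 with hI
  have hsubset : {ω | ¬ BlockNoiseGood T i (η · ω)} ⊆ ⋃ p ∈ I,
      {ω | Real.sqrt (confConst T * ((p.2 - p.1 : ℕ) : ℝ)) ≤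
        |∑ y ∈ Finset.Ico p.1 p.2, η (i * H + 1 + y) ω|} := by
    intro ω hω
    simp only [Set.mem_ofPred_eq, BlockNoiseGood, NoiseGood, not_forall, not_le] at hω
    obtain ⟨a, b, hab, hb, hlt⟩ := hω
    have hne : a ≠ b := by
      rintro rfl
      simp at hlt
    rw [Set.mem_iUnion₂]
    refine ⟨(a, b), ?_, hlt.le⟩
    rw [hI, Finset.mem_filter, Finset.mem_product, Finset.mem_range, Finset.mem_range]
    exact ⟨⟨by simp only; omega, by simp only; omega⟩, by simp only; omega⟩
  have hcard : (I.card : ℝ) ≤ (H + 1) ^ 2 := by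
    have := Finset.card_filter_le ((Finset.range (H + 1)) ×ˢ (Finset.range (H + 1)))
      fun p => p.1 < p.2
    rw [Finset.card_product, Finset.card_range] at this
    rw [sq]
    exact_mod_cast this
  calc P.real {ω | ¬ BlockNoiseGood T i (η · ω)}
      ≤ ∑ p ∈ I, P.real {ω | Real.sqrt (confConst T * ((p.2 - p.1 : ℕ) : ℝ)) ≤
        |∑ y ∈ Finset.Ico p.1 p.2, η (i * H + 1 + y) ω|} :=
        (measureReal_mono hsubset (measure_ne_top _ _)).trans (measureReal_biUnion_finset_le _ _)
    _ ≤ ∑ p ∈ I, 2 / (H : ℝ) ^ 5 :=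
        Finset.sum_le_sum fun p hp => htail _ _ (Finset.mem_filter.1 hp).2
    _ = I.card * (2 / (H : ℝ) ^ 5) := by rw [Finset.sum_const, nsmul_eq_mul]
    _ ≤ (4 * H ^ 2) * (2 / (H : ℝ) ^ 5) := by
        gcongr
        refine hcard.trans ?_
        nlinarith
    _ = 8 / (H : ℝ) ^ 3 := by field_simp; norm_num

/-! ### A block is independent of the past -/

/-- The input variables that are relevant for the first `i` blocks and for the draw in block `i`, if
`κ` arms have been selected before. -/
def pastSet (T i κ : ℕ) : Set (ℕ ⊕ ℕ ⊕ ℕ) :=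
  {x | Sum.elim (fun k => k < κ) (Sum.elim (fun t => t ≤ i * blockLength T) fun l => l ≤ i + 1) x}

end

/-- The mixing with the uniform distribution bounds the importance weights. -/
lemma abs_draw_weight_le {T : ℕ} (hB : 2 ≤ numCandidates T) (hT : 1 ≤ T) {w : ℕ → ℝ}
    (hw : ∀ j, 0 < w j) (j l : ℕ) :
    |if l = j then 1 / selectProb T w j else 0| ≤ numCandidates T / mixing T := by
  have hα := mixing_pos hB hT
  have hBp : (0 : ℝ) < numCandidates T := by exact_mod_cast (by omega : 0 < numCandidates T)
  have hp := le_selectProb (T := T) hw j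
  have hp0 : 0 < selectProb T w j := lt_of_lt_of_le (by positivity) hp
  split_ifs
  · rw [abs_of_pos (by positivity), ← one_div_div (mixing T)]
    exact one_div_le_one_div_of_le (by positivity) hp
  · rw [abs_zero]; positivity

/-- Weights of the past are, on the event that `κ` arms have been selected, determined by the
variables in `pastSet T i κ`. -/
lemma measurable_info_past {Ω : Type*} (C : ℝ) (T : ℕ) (ρ : ℕ → ℝ) (m η U : ℕ → Ω → ℝ) (i κ : ℕ)
    {G : (ℕ → ℝ) × ℝ → ℝ} (hG : Measurable G) :
    Measurable[info m η U (pastSet T i κ)] fun ω =>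
      if (masterState C T ρ (m · ω) (η · ω) (U · ω) i).1 = κ then
        prefixGood T i (η · ω) * G ((masterState C T ρ (m · ω) (η · ω) (U · ω) i).2, U (i + 1) ω)
      else 0 := by
  -- Irrelevant input variables are replaced by `0`; this does not change the state of the master
  -- when it has selected `κ` arms.
  set m' : ℕ → Ω → ℝ := fun k ω => if k < κ then m k ω else 0 with hm'
  set η' : ℕ → Ω → ℝ := fun t ω => if t ≤ i * blockLength T then η t ω else 0 with hη'
  set U' : ℕ → Ω → ℝ := fun l ω => if l ≤ i + 1 then U l ω else 0 with hU'
  have h1 : Measurable[info m η U (pastSet T i κ)] fun ω => (m' · ω) := by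
    refine measurable_info_pi fun k => ?_
    by_cases hk : k < κ
    · simp only [hm', hk, if_true]
      exact measurable_info (x := Sum.inl k) hk
    · simp only [hm', hk, if_false]
      exact measurable_const
  have h2 : Measurable[info m η U (pastSet T i κ)] fun ω => (η' · ω) := by
    refine measurable_info_pi fun k => ?_
    by_cases hk : k ≤ i * blockLength T
    · simp only [hη', hk, if_true]
      exact measurable_info (x := Sum.inr (Sum.inl k)) hk
    · simp only [hη', hk, if_false]
      exact measurable_const
  have h3 : Measurable[info m η U (pastSet T i κ)] fun ω => (U' · ω) := by
    refine measurable_info_pi fun k => ?_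
    by_cases hk : k ≤ i + 1
    · simp only [hU', hk, if_true]
      exact measurable_info (x := Sum.inr (Sum.inr k)) hk
    · simp only [hU', hk, if_false]
      exact measurable_const
  have heq : (fun ω => if (masterState C T ρ (m · ω) (η · ω) (U · ω) i).1 = κ then
      prefixGood T i (η · ω) * G ((masterState C T ρ (m · ω) (η · ω) (U · ω) i).2, U (i + 1) ω)
      else 0) = fun ω => if (masterState C T ρ (m' · ω) (η' · ω) (U' · ω) i).1 = κ then
      prefixGood T i (η' · ω) * G ((masterState C T ρ (m' · ω) (η' · ω) (U' · ω) i).2,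
        U' (i + 1) ω) else 0 := by
    funext ω
    have a2 : ∀ t ≤ i * blockLength T, η t ω = η' t ω := fun t ht => by simp [hη', ht]
    have a3 : ∀ l ≤ i, U l ω = U' l ω := fun l hl => by
      simp only [hU']; rw [if_pos (by omega)]
    have a4 : U (i + 1) ω = U' (i + 1) ω := by simp [hU']
    have a1 : ∀ k < κ, m k ω = m' k ω := fun k hk => by simp [hm', hk]
    rw [prefixGood_congr a2, a4]
    by_cases hc : (masterState C T ρ (m · ω) (η · ω) (U · ω) i).1 = κ
    · rw [masterState_congr (m := (m · ω)) (by rwa [hc]) a2 a3]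
    · by_cases hc' : (masterState C T ρ (m' · ω) (η' · ω) (U' · ω) i).1 = κ
      · exfalso
        apply hc
        rw [← hc']
        congr 1
        refine masterState_congr (m := (m' · ω)) ?_ (fun t ht => (a2 t ht).symm)
          (fun l hl => (a3 l hl).symm)
        rw [hc']
        exact fun k hk => (a1 k hk).symm
      · rw [if_neg hc, if_neg hc']
  rw [heq]
  have hs := @measurable_masterState Ω (info m η U (pastSet T i κ)) C T ρ _ _ _ h1 h2 h3 i
  have hu : Measurable[info m η U (pastSet T i κ)] (U' (i + 1)) := by
    have e : U' (i + 1) = U (i + 1) := by funext ω; simp [hU']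
    rw [e]
    exact measurable_info (x := Sum.inr (Sum.inr (i + 1))) (le_refl (i + 1))
  have hd := @measurable_prefixGood Ω (info m η U (pastSet T i κ)) T i _ h2
  exact Measurable.ite (hs.fst (measurableSet_singleton κ))
    (hd.mul (hG.comp (hs.snd.prodMk hu))) measurable_const

section

variable {Ω : Type*} [MeasurableSpace Ω] {P : Measure Ω} [IsProbabilityMeasure P]
  {m η U : ℕ → Ω → ℝ} {C : ℝ} {T : ℕ} {ρ : ℕ → ℝ}

/-- What happens in block `i` is independent of the past, and distributed as if no arm had been
selected before. -/
theorem RandomInput.integral_mul_fresh (h : RandomInput P m η U) (i : ℕ) {G : (ℕ → ℝ) × ℝ → ℝ}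
    (hG : Measurable G) {c : ℝ}
    (hc : ∀ ω, |G ((masterState C T ρ (m · ω) (η · ω) (U · ω) i).2, U (i + 1) ω)| ≤ c)
    {f : (ℕ → ℝ) × (ℕ → ℝ) → ℝ} (hf : Measurable f)
    (hfi : Integrable (fun ω => f ((m · ω), blockShift T i (η · ω))) P) :
    Integrable (fun ω => prefixGood T i (η · ω) *
      G ((masterState C T ρ (m · ω) (η · ω) (U · ω) i).2, U (i + 1) ω) *
      f (freshMeans C T ρ (m · ω) (η · ω) (U · ω) i, blockShift T i (η · ω))) P ∧
    ∫ ω, prefixGood T i (η · ω) *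
      G ((masterState C T ρ (m · ω) (η · ω) (U · ω) i).2, U (i + 1) ω) *
      f (freshMeans C T ρ (m · ω) (η · ω) (U · ω) i, blockShift T i (η · ω)) ∂P =
    (∫ ω, prefixGood T i (η · ω) *
      G ((masterState C T ρ (m · ω) (η · ω) (U · ω) i).2, U (i + 1) ω) ∂P) *
    ∫ ω, f ((m · ω), blockShift T i (η · ω)) ∂P := by
  -- Decompose by the number `κ` of arms that have been selected before: for fixed `κ`, past and
  -- block are functions of disjoint sets of input variables.
  set N := i * blockLength T with hN
  set Y : Ω → ℝ := fun ω => prefixGood T i (η · ω) *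
      G ((masterState C T ρ (m · ω) (η · ω) (U · ω) i).2, U (i + 1) ω) with hY
  set Z : ℕ → Ω → ℝ := fun κ ω =>
    if (masterState C T ρ (m · ω) (η · ω) (U · ω) i).1 = κ then Y ω else 0 with hZ
  set F : ℕ → Ω → ℝ := fun κ ω => f ((fun k => m (κ + k) ω), blockShift T i (η · ω)) with hF
  have hZinfo : ∀ κ, Measurable[info m η U (pastSet T i κ)] (Z κ) := fun κ =>
    measurable_info_past C T ρ m η U i κ hG
  have hZm : ∀ κ, Measurable (Z κ) := fun κ => (hZinfo κ).mono (h.info_le _) le_rfl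
  have hZb : ∀ κ ω, ‖Z κ ω‖ ≤ c := fun κ ω => by
    have h0 : |Y ω| ≤ c := by
      rw [hY, abs_mul, abs_of_nonneg (prefixGood_nonneg _ _ _)]
      refine (mul_le_of_le_one_left (abs_nonneg _) (prefixGood_le_one _ _ _)).trans (hc ω)
    rw [Real.norm_eq_abs, hZ]
    simp only
    split_ifs
    · exact h0
    · rw [abs_zero]; exact (abs_nonneg _).trans h0
  have hZi : ∀ κ, Integrable (Z κ) P := fun κ =>
    Integrable.of_bound (hZm κ).aestronglyMeasurable c (Eventually.of_forall (hZb κ))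
  have hid : ∀ κ, IdentDistrib (F κ) (fun ω => f ((m · ω), blockShift T i (η · ω))) P P :=
    fun κ => (h.identDistrib_shift κ (N + 1)).comp hf
  have hFi : ∀ κ, Integrable (F κ) P := fun κ => (hid κ).integrable_iff.2 hfi
  have hFm : ∀ κ, Measurable (F κ) := fun κ => hf.comp
    ((measurable_pi_iff.2 fun k => h.measurable_mean _).prodMk
      (measurable_blockShift T i h.measurable_noises))
  have hindep : ∀ κ, IndepFun (Z κ) (F κ) P := fun κ => by
    refine h.indepFun (S' := (pastSet T i κ)ᶜ) disjoint_compl_right (hZinfo κ) ?_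
    refine hf.comp (Measurable.prodMk ?_ ?_)
    · refine measurable_info_pi fun k => measurable_info (x := Sum.inl (κ + k)) ?_
      simp [pastSet]
    · refine measurable_info_pi fun k => measurable_info (x := Sum.inr (Sum.inl (N + 1 + k))) ?_
      simp [pastSet, hN]
      omega
  have hdecomp : ∀ (g : ℕ → ℝ) (ω : Ω), ∑ κ ∈ Finset.range (N + 1), Z κ ω * g κ =
      Y ω * g (masterState C T ρ (m · ω) (η · ω) (U · ω) i).1 := fun g ω => by
    rw [Finset.sum_eq_single (masterState C T ρ (m · ω) (η · ω) (U · ω) i).1]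
    · simp [hZ]
    · intro κ _ hκ
      simp [hZ, hκ.symm]
    · intro hmem
      rw [Finset.mem_range, not_lt] at hmem
      have := masterState_fst_le C T ρ (m · ω) (η · ω) (U · ω) i
      omega
  have e1 : (fun ω => Y ω * f (freshMeans C T ρ (m · ω) (η · ω) (U · ω) i,
      blockShift T i (η · ω))) = fun ω => ∑ κ ∈ Finset.range (N + 1), Z κ ω * F κ ω := by
    funext ω
    rw [hdecomp (fun κ => F κ ω) ω]
    rfl
  have e2 : Y = fun ω => ∑ κ ∈ Finset.range (N + 1), Z κ ω := by
    funext ω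
    have := hdecomp (fun _ => 1) ω
    simp only [mul_one] at this
    exact this.symm
  have hint : ∀ κ, Integrable (fun ω => Z κ ω * F κ ω) P := fun κ =>
    (hFi κ).bdd_mul (hZm κ).aestronglyMeasurable (Eventually.of_forall (hZb κ))
  constructor
  · rw [e1]
    exact integrable_finsetSum _ fun κ _ => hint κ
  · rw [e1, integral_finsetSum _ fun κ _ => hint κ, e2, integral_finsetSum _ fun κ _ => hZi κ,
      Finset.sum_mul]
    refine Finset.sum_congr rfl fun κ _ => ?_
    rw [(hindep κ).integral_fun_mul_eq_mul_integral (hZm κ).aestronglyMeasurable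
      (hFm κ).aestronglyMeasurable, (hid κ).integral_eq]

/-- The importance weights of the master are unbiased. -/
theorem RandomInput.integral_draw (h : RandomInput P m η U) (hT : 1 ≤ T)
    (hB : 2 ≤ numCandidates T) (i : ℕ) {j : ℕ} (hj : j ∈ exponents T) :
    ∫ ω, prefixGood T i (η · ω) * (if choice C T ρ (m · ω) (η · ω) (U · ω) i = j then
      1 / selectProb T (masterState C T ρ (m · ω) (η · ω) (U · ω) i).2 j else 0) ∂P =
    ∫ ω, prefixGood T i (η · ω) ∂P := by
  set W : Ω → (ℕ → ℝ) × ℝ := fun ω =>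
    ((masterState C T ρ (m · ω) (η · ω) (U · ω) i).2, prefixGood T i (η · ω)) with hW
  have hWm : Measurable W := (measurable_masterState C T ρ h.measurable_means h.measurable_noises
    h.measurable_unifs i).snd.prodMk (measurable_prefixGood T i h.measurable_noises)
  set g : ((ℕ → ℝ) × ℝ) × ℝ → ℝ := fun q => q.1.2 *
    (if draw T (selectProb T q.1.1) q.2 = j then 1 / selectProb T q.1.1 j else 0) with hg
  have hgm : Measurable g := by
    refine (measurable_snd.comp measurable_fst).mul (Measurable.ite ?_ ?_ measurable_const)
    · exact measurable_draw T (measurable_selectProb T (measurable_fst.comp measurable_fst))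
        measurable_snd (measurableSet_singleton j)
    · exact measurable_const.div
        (measurable_selectProb T (measurable_fst.comp measurable_fst)).eval
  have hbd : ∀ ω, ‖g (W ω, U (i + 1) ω)‖ ≤ numCandidates T / mixing T := fun ω => by
    rw [Real.norm_eq_abs, hg, abs_mul]
    simp only [hW]
    rw [abs_of_nonneg (prefixGood_nonneg _ _ _)]
    exact (mul_le_of_le_one_left (abs_nonneg _) (prefixGood_le_one _ _ _)).trans
      (abs_draw_weight_le hB hT (masterState_weight_pos C T ρ _ _ _ i) j _)
  have hint : Integrable (fun ω => g (W ω, U (i + 1) ω)) P :=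
    Integrable.of_bound (hgm.comp (hWm.prodMk (h.measurable_unif _))).aestronglyMeasurable _
      (Eventually.of_forall hbd)
  -- The state before block `i` uses only the variables `U l` with `l ≤ i`.
  have hindep : IndepFun W (U (i + 1)) P := by
    set S : Set (ℕ ⊕ ℕ ⊕ ℕ) := {Sum.inr (Sum.inr (i + 1))}ᶜ with hS
    refine h.indepFun (S := S) (S' := {Sum.inr (Sum.inr (i + 1))}) disjoint_compl_left ?_
      (measurable_info (x := Sum.inr (Sum.inr (i + 1))) rfl)
    set U' : ℕ → Ω → ℝ := fun l ω => if l ≤ i then U l ω else 0 with hU'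
    have h1 : Measurable[info m η U S] fun ω => (m · ω) :=
      measurable_info_pi fun k => measurable_info (x := Sum.inl k) (by simp [hS])
    have h2 : Measurable[info m η U S] fun ω => (η · ω) :=
      measurable_info_pi fun k => measurable_info (x := Sum.inr (Sum.inl k)) (by simp [hS])
    have h3 : Measurable[info m η U S] fun ω => (U' · ω) := by
      refine measurable_info_pi fun k => ?_
      by_cases hk : k ≤ i
      · simp only [hU', hk, if_true]
        exact measurable_info (x := Sum.inr (Sum.inr k)) (by simp [hS]; omega)
      · simp only [hU', hk, if_false]
        exact measurable_const
    have hWeq : W = fun ω => ((masterState C T ρ (m · ω) (η · ω) (U' · ω) i).2,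
        prefixGood T i (η · ω)) := by
      funext ω
      rw [masterState_congr (m := (m · ω)) (e := (η · ω)) (u := (U · ω)) (fun _ _ => rfl)
        (fun _ _ => rfl) (fun l hl => by simp [hU', hl])]
    rw [hWeq]
    exact (@measurable_masterState Ω (info m η U S) C T ρ _ _ _ h1 h2 h3 i).snd.prodMk
      (@measurable_prefixGood Ω (info m η U S) T i _ h2)
  have key := integral_indep_unif hWm (h.measurable_unif (i + 1)) hindep
    (map_eq_of_isUniform (h.uniform_unif _)) hgm hint
  refine key.trans (integral_congr_ae (Eventually.of_forall fun ω => ?_))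
  simp only [hg, hW]
  have hw := masterState_weight_pos C T ρ (m · ω) (η · ω) (U · ω) i
  set w := (masterState C T ρ (m · ω) (η · ω) (U · ω) i).2
  have hα := mixing_pos hB hT
  have hBp : (0 : ℝ) < numCandidates T := by exact_mod_cast (by omega : 0 < numCandidates T)
  have hp0 : ∀ l, 0 < selectProb T w l := fun l =>
    lt_of_lt_of_le (by positivity) (le_selectProb hw l)
  have hset : MeasurableSet {v : ℝ | draw T (selectProb T w) v = j} :=
    measurable_draw T measurable_const measurable_id (measurableSet_singleton j)
  have e1 : (fun v : ℝ => prefixGood T i (η · ω) *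
      (if draw T (selectProb T w) v = j then 1 / selectProb T w j else 0)) =
      fun v => (prefixGood T i (η · ω) * (1 / selectProb T w j)) *
        Set.indicator {v : ℝ | draw T (selectProb T w) v = j} (fun _ => (1 : ℝ)) v := by
    funext v
    by_cases hv : draw T (selectProb T w) v = j
    · rw [if_pos hv, Set.indicator_of_mem (by exact hv), mul_one]
    · rw [if_neg hv, Set.indicator_of_notMem (by exact hv), mul_zero, mul_zero]
  rw [e1, integral_const_mul, integral_indicator_const _ hset,
    volume_draw_eq (fun l => (hp0 l).le) (sum_selectProb hw (by omega)) hj, smul_eq_mul, mul_one,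
    mul_assoc, one_div_mul_cancel (hp0 j).ne', mul_one]

end

/-! ### The expected regret of a block with a suitable candidate -/

lemma blockRun_regret_mem {β L r : ℝ} {ρ m e : ℕ → ℝ} (hρ : ∀ x, 0 ≤ ρ x ∧ ρ x ≤ r)
    (hm : ∀ k, 0 ≤ m k ∧ m k ≤ 1) (x : ℕ) :
    0 ≤ (blockRun β L ρ m e x).regret ∧ (blockRun β L ρ m e x).regret ≤ x * (1 + r * x) := by
  have hr : 0 ≤ r := (hρ 0).1.trans (hρ 0).2
  induction x with
  | zero => simp [blockRun]
  | succ x ih =>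
    have hx : (0 : ℝ) ≤ x := Nat.cast_nonneg x
    have hrx : 0 ≤ r * x := by positivity
    suffices h : (blockRun β L ρ m e x).regret ≤ (blockRun β L ρ m e (x + 1)).regret ∧
        (blockRun β L ρ m e (x + 1)).regret ≤ (blockRun β L ρ m e x).regret + (1 + r * x) by
      refine ⟨ih.1.trans h.1, h.2.trans ?_⟩
      push_cast
      nlinarith [ih.2]
    rw [blockRun_succ]
    by_cases hk : (blockRun β L ρ m e x).Keep β L
    · rw [BlockState.next_of_keep hk]
      rcases x with _ | x
      · exact absurd hk (not_keep_blockRun_zero _ _ _ _ _)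
      obtain ⟨c, hc⟩ := exists_tracked β L m e hρ x
      have h1 := hc.le_mean
      have h2 := hc.mean_le
      have h3 : r * (blockRun β L ρ m e (x + 1)).pulls ≤ r * (x + 1 : ℕ) :=
        mul_le_mul_of_nonneg_left (by exact_mod_cast hc.pulls_le) hr
      have := hm c
      constructor <;> simp only <;> linarith
    · rw [BlockState.next_of_not_keep hk]
      have := hm (blockRun β L ρ m e x).count
      constructor <;> simp only <;> linarith

lemma rate_pos (j : ℕ) : 0 < rate j := by unfold rate; positivity

lemma rate_le_one (j : ℕ) : rate j ≤ 1 := by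
  unfold rate
  exact inv_le_one_of_one_le₀ (one_le_pow₀ (by norm_num))

lemma rate_rpow_third_pow (j : ℕ) : (rate j ^ (1 / 3 : ℝ)) ^ 3 = rate j := by
  rw [← Real.rpow_natCast, ← Real.rpow_mul (rate_pos j).le]; norm_num

lemma confConst_nonneg {T : ℕ} (hT : 1 ≤ T) : 0 ≤ confConst T :=
  mul_nonneg (by norm_num) (Real.log_nonneg (by exact_mod_cast blockLength_pos hT))

lemma blockShift_mem {T : ℕ} {ρ : ℕ → ℝ} {r : ℝ} (hρ : ∀ t, 1 ≤ t → 0 ≤ ρ t ∧ ρ t ≤ r) (i x : ℕ) :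
    0 ≤ blockShift T i ρ x ∧ blockShift T i ρ x ≤ r := hρ _ (by omega)

lemma blockEnd_count_le (T : ℕ) (ρ : ℕ → ℝ) (i j : ℕ) (m e : ℕ → ℝ) :
    (blockEnd T ρ i j m e).count ≤ blockLength T :=
  (blockRun_count_le ..).trans (blockLen_le T i)

/-- The regret of a block is at most quadratic in its length, whatever happens. -/
lemma blockEnd_regret_mem {T : ℕ} {ρ : ℕ → ℝ} (hρ : ∀ t, 1 ≤ t → 0 ≤ ρ t ∧ ρ t ≤ 1)
    {m : ℕ → ℝ} (hm : ∀ k, 0 ≤ m k ∧ m k ≤ 1) (i j : ℕ) (e : ℕ → ℝ) :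
    0 ≤ (blockEnd T ρ i j m e).regret ∧
      (blockEnd T ρ i j m e).regret ≤ blockLength T * (1 + blockLength T) := by
  have h := blockRun_regret_mem (β := rate j) (L := confConst T) (e := e)
    (blockShift_mem (T := T) hρ i) hm (blockLen T i)
  refine ⟨h.1, h.2.trans ?_⟩
  have : (blockLen T i : ℝ) ≤ blockLength T := by exact_mod_cast blockLen_le T i
  rw [one_mul]
  gcongr

/-- The mean of `1 / max (gap) δ` over the arms: logarithmic in `1 / δ` although the worst case is
`1 / δ`. -/
lemma integral_inv_max {δ : ℝ} (h0 : 0 < δ) (h1 : δ ≤ 1) :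
    ∫ a in Set.Icc (0 : ℝ) 1, 1 / max (1 - a) δ = 1 + Real.log (1 / δ) := by
  have hcont : Continuous fun a : ℝ => 1 / max a δ :=
    continuous_const.div (continuous_id.max continuous_const) fun a =>
      (h0.trans_le (le_max_right a δ)).ne'
  rw [integral_Icc_eq_integral_Ioc, ← intervalIntegral.integral_of_le zero_le_one,
    intervalIntegral.integral_comp_sub_left (fun a => 1 / max a δ) 1, sub_self, sub_zero,
    ← intervalIntegral.integral_add_adjacent_intervals (b := δ) (hcont.intervalIntegrable _ _)
      (hcont.intervalIntegrable _ _)]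
  have e1 : ∫ a in (0 : ℝ)..δ, 1 / max a δ = ∫ _a in (0 : ℝ)..δ, 1 / δ := by
    refine intervalIntegral.integral_congr fun a ha => ?_
    rw [Set.uIcc_of_le h0.le] at ha
    simp only [max_eq_right ha.2]
  have e2 : ∫ a in δ..1, 1 / max a δ = ∫ a in δ..1, 1 / a := by
    refine intervalIntegral.integral_congr fun a ha => ?_
    rw [Set.uIcc_of_le h1] at ha
    simp only [max_eq_left ha.1]
  rw [e1, e2, intervalIntegral.integral_const, integral_one_div_of_pos h0 one_pos, sub_zero,
    smul_eq_mul, mul_one_div_cancel h0.ne']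

lemma integral_good {δ : ℝ} (h0 : 0 < δ) (h1 : δ ≤ 1) :
    ∫ a in Set.Icc (0 : ℝ) 1, (if 1 - δ / 2 ≤ a then (1 : ℝ) else 0) = δ / 2 := by
  have e : (fun a : ℝ => if 1 - δ / 2 ≤ a then (1 : ℝ) else 0) =
      Set.indicator (Set.Ici (1 - δ / 2)) fun _ => (1 : ℝ) := by
    funext a
    simp [Set.indicator_apply]
  have hs : Set.Icc (0 : ℝ) 1 ∩ Set.Ici (1 - δ / 2) = Set.Icc (1 - δ / 2) 1 := by
    ext a
    simp only [Set.mem_inter_iff, Set.mem_Icc, Set.mem_Ici]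
    constructor
    · rintro ⟨⟨_, h⟩, h'⟩; exact ⟨h', h⟩
    · rintro ⟨h, h'⟩; exact ⟨⟨by linarith, h'⟩, h⟩
  rw [e, setIntegral_indicator measurableSet_Ici, hs, setIntegral_const, Measure.real,
    Real.volume_Icc, ENNReal.toReal_ofReal (by linarith), smul_eq_mul]
  ring

section

variable {Ω : Type*} [MeasurableSpace Ω] {P : Measure Ω} [IsProbabilityMeasure P]
  {m η U : ℕ → Ω → ℝ}

/-- Wald's identity for the arms of a block: whether the `k`-th arm is selected does not depend on
its initial mean. -/
theorem RandomInput.integral_sum_arms (h : RandomInput P m η U) (T : ℕ) (ρ : ℕ → ℝ) (i j : ℕ)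
    {f : ℝ → ℝ} (hf : Measurable f) {c : ℝ} (hc : ∀ a, |f a| ≤ c) :
    Integrable (fun ω => ∑ k ∈ Finset.range
      (blockEnd T ρ i j (m · ω) (blockShift T i (η · ω))).count, f (m k ω)) P ∧
    ∫ ω, ∑ k ∈ Finset.range
      (blockEnd T ρ i j (m · ω) (blockShift T i (η · ω))).count, f (m k ω) ∂P =
      (∫ ω, ((blockEnd T ρ i j (m · ω) (blockShift T i (η · ω))).count : ℝ) ∂P) *
        ∫ a in Set.Icc (0 : ℝ) 1, f a := by
  set A : Ω → ℕ := fun ω => (blockEnd T ρ i j (m · ω) (blockShift T i (η · ω))).count with hA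
  set I : ℕ → Ω → ℝ := fun k ω => if k < A ω then 1 else 0 with hI
  have hAH : ∀ ω, A ω ≤ blockLength T := fun ω => blockEnd_count_le ..
  -- `k < A` says that the first `k` arms do not suffice, which only depends on their means.
  have hIinfo : ∀ k, Measurable[info m η U {Sum.inl k}ᶜ] (I k) := by
    intro k
    set m' : ℕ → Ω → ℝ := fun l ω => if l < k then m l ω else 0 with hm'
    have h1 : Measurable[info m η U {Sum.inl k}ᶜ] fun ω => (m' · ω) := by
      refine measurable_info_pi fun l => ?_
      by_cases hl : l < k
      · simp only [hm', hl, if_true]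
        exact measurable_info (x := Sum.inl l) (by simp; omega)
      · simp only [hm', hl, if_false]
        exact measurable_const
    have h2 : Measurable[info m η U {Sum.inl k}ᶜ] fun ω => (η · ω) :=
      measurable_info_pi fun l => measurable_info (x := Sum.inr (Sum.inl l)) (by simp)
    have heq : I k = fun ω => if k < (blockEnd T ρ i j (m' · ω) (blockShift T i (η · ω))).count
        then 1 else 0 := by
      funext ω
      have a1 : ∀ l < k, m l ω = m' l ω := fun l hl => by simp [hm', hl]
      simp only [hI, hA]
      congr 1
      rw [eq_iff_iff, ← not_le, ← not_le, not_iff_not]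
      constructor
      · intro hle
        rw [blockEnd, blockRun_congr hle a1 fun _ _ => rfl]
        exact hle
      · intro hle
        rw [blockEnd, blockRun_congr hle (fun l hl => (a1 l hl).symm) fun _ _ => rfl]
        exact hle
    rw [heq]
    refine Measurable.ite ?_ measurable_const measurable_const
    exact measurableSet_lt measurable_const
      (@measurable_blockEnd_count Ω (info m η U {Sum.inl k}ᶜ) T ρ i _ _ _ measurable_const h1
        (@measurable_blockShift Ω (info m η U {Sum.inl k}ᶜ) T i _ h2))
  have hIm : ∀ k, Measurable (I k) := fun k => (hIinfo k).mono (h.info_le _) le_rfl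
  have hIb : ∀ k ω, ‖I k ω‖ ≤ 1 := fun k ω => by
    simp only [hI]; split_ifs <;> simp
  have hIi : ∀ k, Integrable (I k) P := fun k =>
    Integrable.of_bound (hIm k).aestronglyMeasurable 1 (Eventually.of_forall (hIb k))
  have hfm : ∀ k, Measurable fun ω => f (m k ω) := fun k => hf.comp (h.measurable_mean k)
  have hfi : ∀ k, Integrable (fun ω => f (m k ω)) P := fun k =>
    Integrable.of_bound (hfm k).aestronglyMeasurable c (Eventually.of_forall fun ω => hc _)
  have hint : ∀ k, Integrable (fun ω => I k ω * f (m k ω)) P := fun k =>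
    (hfi k).bdd_mul (hIm k).aestronglyMeasurable (Eventually.of_forall (hIb k))
  have hdecomp : ∀ (g : ℕ → ℝ) (ω : Ω), ∑ k ∈ Finset.range (A ω), g k =
      ∑ k ∈ Finset.range (blockLength T), I k ω * g k := by
    intro g ω
    simp only [hI, ite_mul, one_mul, zero_mul]
    rw [← Finset.sum_filter]
    refine Finset.sum_congr ?_ fun _ _ => rfl
    ext k
    have := hAH ω
    simp only [Finset.mem_range, Finset.mem_filter]
    omega
  have e1 : (fun ω => ∑ k ∈ Finset.range (A ω), f (m k ω)) =
      fun ω => ∑ k ∈ Finset.range (blockLength T), I k ω * f (m k ω) := by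
    funext ω; exact hdecomp _ ω
  have e2 : (fun ω => (A ω : ℝ)) = fun ω => ∑ k ∈ Finset.range (blockLength T), I k ω := by
    funext ω
    have := hdecomp (fun _ => 1) ω
    simpa using this
  change Integrable (fun ω => ∑ k ∈ Finset.range (A ω), f (m k ω)) P ∧
    ∫ ω, (fun ω => ∑ k ∈ Finset.range (A ω), f (m k ω)) ω ∂P =
      (∫ ω, (fun ω => (A ω : ℝ)) ω ∂P) * _
  rw [e1, e2]
  refine ⟨integrable_finsetSum _ fun k _ => hint k, ?_⟩
  rw [integral_finsetSum _ fun k _ => hint k, integral_finsetSum _ fun k _ => hIi k,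
    Finset.sum_mul]
  refine Finset.sum_congr rfl fun k _ => ?_
  have hind : IndepFun (I k) (fun ω => f (m k ω)) P :=
    h.indepFun (S := {Sum.inl k}ᶜ) (S' := {Sum.inl k}) disjoint_compl_left (hIinfo k)
      (hf.comp (measurable_info (x := Sum.inl k) rfl))
  rw [hind.integral_fun_mul_eq_mul_integral (hIm k).aestronglyMeasurable
    (hfm k).aestronglyMeasurable, ← map_eq_of_isUniform (h.uniform_mean k),
    integral_map (h.measurable_mean k).aemeasurable hf.aestronglyMeasurable]

/-- If the candidate rate `β` bounds the rotting rates, then few arms are selected in a block: one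
in `2 / δ` arms is good, and good arms are long-lived. -/
theorem RandomInput.integral_count_le (h : RandomInput P m η U) {T : ℕ} (hT : 1 ≤ T) {ρ : ℕ → ℝ}
    {j : ℕ} (hρ : ∀ t, 1 ≤ t → 0 ≤ ρ t ∧ ρ t ≤ rate j) (i : ℕ)
    (hδ : 1 ≤ 2 * blockLength T * (rate j ^ (1 / 3 : ℝ)) ^ 2) :
    ∫ ω, ((blockEnd T ρ i j (m · ω) (blockShift T i (η · ω))).count : ℝ) ∂P ≤
      40 * blockLength T * rate j ^ (1 / 3 : ℝ) := by
  have hβ := rate_pos j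
  have hd0 : 0 < rate j ^ (1 / 3 : ℝ) := Real.rpow_pos_of_pos hβ _
  have hd1 : rate j ^ (1 / 3 : ℝ) ≤ 1 := Real.rpow_le_one hβ.le (rate_le_one j) (by norm_num)
  have hcube := rate_rpow_third_pow j
  have hH : (1 : ℝ) ≤ blockLength T := by exact_mod_cast blockLength_pos hT
  set δ := rate j ^ (1 / 3 : ℝ) with hδd
  set H : ℝ := (blockLength T : ℝ) with hHd
  set EA := ∫ ω, ((blockEnd T ρ i j (m · ω) (blockShift T i (η · ω))).count : ℝ) ∂P with hEA
  obtain ⟨hGi, hG⟩ := h.integral_sum_arms T ρ i j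
    (f := fun a => if 1 - δ / 2 ≤ a then (1 : ℝ) else 0)
    (Measurable.ite measurableSet_Ici measurable_const measurable_const) (c := 1)
    (fun a => by split_ifs <;> simp)
  rw [integral_good hd0 hd1, ← hEA] at hG
  have hbad := h.prob_not_blockNoiseGood_le hT i
  have hbm : MeasurableSet {ω | ¬ BlockNoiseGood T i (η · ω)} :=
    (measurableSet_blockNoiseGood T i h.measurable_noises).compl
  have hle : (∫ ω, ∑ k ∈ Finset.range (blockEnd T ρ i j (m · ω) (blockShift T i (η · ω))).count,
      (if 1 - δ / 2 ≤ m k ω then (1 : ℝ) else 0) ∂P) * δ ≤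
      ∫ ω, ((2 * rate j * H + δ) +
        Set.indicator {ω | ¬ BlockNoiseGood T i (η · ω)} (fun _ => H * δ) ω) ∂P := by
    rw [← integral_mul_const]
    refine integral_mono (hGi.mul_const _)
      ((integrable_const _).add ((integrable_const _).indicator hbm)) fun ω => ?_
    by_cases hg : BlockNoiseGood T i (η · ω)
    · have := card_good_mul_le (L := confConst T) (m := (m · ω)) hβ (confConst_nonneg hT)
        (blockShift_mem (T := T) hρ i) hg (blockLen_le T i)
      rw [Set.indicator_of_notMem (by simpa using hg), add_zero]
      refine this.trans ?_
      rw [← hδd]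
      have : (blockLen T i : ℝ) ≤ H := Nat.cast_le.2 (blockLen_le T i)
      gcongr
    · rw [Set.indicator_of_mem (by exact hg)]
      have h1 : ∑ k ∈ Finset.range (blockEnd T ρ i j (m · ω) (blockShift T i (η · ω))).count,
          (if 1 - δ / 2 ≤ m k ω then (1 : ℝ) else 0) ≤ H := by
        refine (Finset.sum_le_sum (g := fun _ => (1 : ℝ)) fun k _ => ?_).trans ?_
        · split_ifs <;> norm_num
        · simp only [Finset.sum_const, Finset.card_range, nsmul_eq_mul, mul_one]
          exact Nat.cast_le.2 (blockEnd_count_le ..)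
      have h2 := mul_le_mul_of_nonneg_right h1 hd0.le
      have h3 : 0 ≤ 2 * rate j * H + δ := by positivity
      simp only at h2 ⊢
      linarith
  rw [hG, integral_add (integrable_const _) ((integrable_const _).indicator hbm),
    integral_indicator_const _ hbm] at hle
  simp only [integral_const, probReal_univ, smul_eq_mul, one_mul] at hle
  -- On large noise all `H` steps may select good arms, but that is rare.
  have h8 : P.real {ω | ¬ BlockNoiseGood T i (η · ω)} * (H * δ) ≤ 8 * δ := by
    calc _ ≤ 8 / H ^ 3 * (H * δ) := by gcongr
      _ = 8 * δ / H ^ 2 := by field_simp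
      _ ≤ 8 * δ := div_le_self (by positivity) (one_le_pow₀ hH)
  -- `hle` reads `EA * (δ / 2) * δ ≤ 2 H δ³ + O(δ)`, and `δ ≤ 2 H δ³` by `hδ`.
  have h9 : EA * δ ^ 2 ≤ (40 * H * δ) * δ ^ 2 := by
    rw [← hcube] at hle
    have h10 : δ ≤ 2 * H * δ ^ 3 := by nlinarith
    nlinarith
  exact le_of_mul_le_mul_right h9 (by positivity)

lemma RandomInput.integrable_good_regret (h : RandomInput P m η U) {T : ℕ} {ρ : ℕ → ℝ}
    (hρ : ∀ t, 1 ≤ t → 0 ≤ ρ t ∧ ρ t ≤ 1) (i j : ℕ) :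
    Integrable (fun ω => Set.indicator {ω | BlockNoiseGood T i (η · ω)}
      (fun ω => (blockEnd T ρ i j (m · ω) (blockShift T i (η · ω))).regret) ω) P := by
  refine Integrable.indicator ?_ (measurableSet_blockNoiseGood T i h.measurable_noises)
  refine Integrable.of_bound (measurable_blockEnd_regret T ρ i measurable_const h.measurable_means
    (measurable_blockShift T i h.measurable_noises)).aestronglyMeasurable
    (blockLength T * (1 + blockLength T)) ?_
  filter_upwards [h.ae_mem] with ω hω
  have := blockEnd_regret_mem (T := T) hρ hω.1 i j (blockShift T i (η · ω))
  rw [Real.norm_eq_abs, abs_of_nonneg this.1]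
  exact this.2

/-- The expected regret of a block whose candidate rate `β` bounds the rotting rates, and is not too
small for the length of the block. -/
theorem RandomInput.integral_good_regret_le (h : RandomInput P m η U) {T : ℕ} (hT : 1 ≤ T)
    {ρ : ℕ → ℝ} {j : ℕ} (hρ : ∀ t, 1 ≤ t → 0 ≤ ρ t ∧ ρ t ≤ rate j) (i : ℕ)
    (hδ : 1 ≤ 2 * blockLength T * (rate j ^ (1 / 3 : ℝ)) ^ 2) :
    ∫ ω, Set.indicator {ω | BlockNoiseGood T i (η · ω)}
      (fun ω => (blockEnd T ρ i j (m · ω) (blockShift T i (η · ω))).regret) ω ∂P ≤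
      blockLength T * rate j ^ (1 / 3 : ℝ) *
        (43 + 640 * confConst T * (1 + Real.log (1 / rate j ^ (1 / 3 : ℝ)))) := by
  have hβ := rate_pos j
  have hL := confConst_nonneg hT
  have hd0 : 0 < rate j ^ (1 / 3 : ℝ) := Real.rpow_pos_of_pos hβ _
  have hd1 : rate j ^ (1 / 3 : ℝ) ≤ 1 := Real.rpow_le_one hβ.le (rate_le_one j) (by norm_num)
  have hcube := rate_rpow_third_pow j
  have hcount := h.integral_count_le hT hρ i hδ
  have hH : (1 : ℝ) ≤ blockLength T := by exact_mod_cast blockLength_pos hT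
  set δ := rate j ^ (1 / 3 : ℝ) with hδd
  set H : ℝ := (blockLength T : ℝ) with hHd
  set L := confConst T with hLd
  have hmaxm : Measurable fun a : ℝ => 16 * L / max (1 - a) δ := by fun_prop
  have hmaxb : ∀ a : ℝ, 0 ≤ 16 * L / max (1 - a) δ ∧ 16 * L / max (1 - a) δ ≤ 16 * L / δ :=
    fun a => ⟨by positivity, by gcongr; exact le_max_right _ _⟩
  obtain ⟨hWi, hW⟩ := h.integral_sum_arms T ρ i j
    (f := fun a => 1 + 16 * L / max (1 - a) δ) (measurable_const.add hmaxm) (c := 1 + 16 * L / δ)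
    (fun a => by
      rw [abs_of_nonneg (by linarith [(hmaxb a).1])]
      linarith [(hmaxb a).2])
  have hmaxi : IntegrableOn (fun a : ℝ => 16 * L / max (1 - a) δ) (Set.Icc 0 1) :=
    Integrable.of_bound hmaxm.aestronglyMeasurable (16 * L / δ) (Eventually.of_forall fun a => by
      rw [Real.norm_eq_abs, abs_of_nonneg (hmaxb a).1]; exact (hmaxb a).2)
  have hint : ∫ a in Set.Icc (0 : ℝ) 1, (1 + 16 * L / max (1 - a) δ) =
      1 + 16 * L * (1 + Real.log (1 / δ)) := by
    rw [integral_add (integrable_const _) hmaxi, ← integral_inv_max hd0 hd1, ← integral_const_mul]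
    congr 1
    · simp
    · congr 1; funext a; ring
  rw [hint] at hW
  have hle : ∫ ω, Set.indicator {ω | BlockNoiseGood T i (η · ω)}
      (fun ω => (blockEnd T ρ i j (m · ω) (blockShift T i (η · ω))).regret) ω ∂P ≤
      ∫ ω, ((2 * δ + rate j) * H + ∑ k ∈ Finset.range
        (blockEnd T ρ i j (m · ω) (blockShift T i (η · ω))).count,
        (1 + 16 * L / max (1 - m k ω) δ)) ∂P := by
    refine integral_mono_ae (h.integrable_good_regret (fun t ht =>
      ⟨(hρ t ht).1, (hρ t ht).2.trans (rate_le_one j)⟩) i j)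
      ((integrable_const _).add hWi) ?_
    filter_upwards [h.ae_mem] with ω hω
    have h0 : 0 ≤ ∑ k ∈ Finset.range (blockEnd T ρ i j (m · ω) (blockShift T i (η · ω))).count,
        (1 + 16 * L / max (1 - m k ω) δ) :=
      Finset.sum_nonneg fun k _ => by linarith [(hmaxb (m k ω)).1]
    by_cases hg : BlockNoiseGood T i (η · ω)
    · rw [Set.indicator_of_mem (by exact hg)]
      refine (blockRun_regret_le_sum (L := L) hβ hL (blockShift_mem (T := T) hρ i) hω.1 hg
        (blockLen_le T i)).trans ?_
      rw [← hδd]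
      have : (blockLen T i : ℝ) ≤ H := Nat.cast_le.2 (blockLen_le T i)
      refine add_le_add ?_ le_rfl
      gcongr
    · rw [Set.indicator_of_notMem (by exact hg)]
      positivity
  rw [integral_add (integrable_const _) hWi, hW] at hle
  simp only [integral_const, probReal_univ, smul_eq_mul, one_mul] at hle
  refine hle.trans ?_
  have hlog : 0 ≤ Real.log (1 / δ) := Real.log_nonneg (by rw [le_div_iff₀ hd0]; linarith)
  have hβδ : rate j ≤ δ := by
    rw [← hcube]; nlinarith [mul_pos hd0 hd0]
  calc _ ≤ (2 * δ + δ) * H + (40 * H * δ) * (1 + 16 * L * (1 + Real.log (1 / δ))) := by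
        gcongr
    _ = _ := by ring

end

/-! ### The master -/

lemma gainScale_pos {C : ℝ} {T : ℕ} (hC : 0 < C) (hT : 2 ≤ T) : 0 < gainScale C T := by
  have hH : (0 : ℝ) < blockLength T := by exact_mod_cast blockLength_pos (by omega : 1 ≤ T)
  have hL : 0 < Real.log (T : ℝ) := Real.log_pos (by exact_mod_cast hT)
  unfold gainScale
  positivity

/-- The sum of the weights of the master at the start of block `i`. -/
noncomputable def totalWeight (C : ℝ) (T : ℕ) (ρ m e u : ℕ → ℝ) (i : ℕ) : ℝ :=
  ∑ j ∈ exponents T, (masterState C T ρ m e u i).2 j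

section Pathwise

variable (C : ℝ) {T : ℕ} (ρ m e u : ℕ → ℝ)

/-- The probability with which exponent `j` is drawn for block `i`. -/
noncomputable def drawProb (C : ℝ) (T : ℕ) (ρ m e u : ℕ → ℝ) (i j : ℕ) : ℝ :=
  selectProb T (masterState C T ρ m e u i).2 j

/-- The gain of block `i` in the run of the policy. -/
noncomputable def realGain (C : ℝ) (T : ℕ) (ρ m e u : ℕ → ℝ) (i : ℕ) : ℝ :=
  blockGain C T ρ i (choice C T ρ m e u i) (freshMeans C T ρ m e u i) (blockShift T i e)

lemma masterState_succ_snd (i : ℕ) : (masterState C T ρ m e u (i + 1)).2 =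
    Function.update (masterState C T ρ m e u i).2 (choice C T ρ m e u i)
      ((masterState C T ρ m e u i).2 (choice C T ρ m e u i) *
        Real.exp (mixing T / (numCandidates T * drawProb C T ρ m e u i (choice C T ρ m e u i)) *
          realGain C T ρ m e u i)) := rfl

variable {C ρ m e u}

lemma drawProb_pos (hB : 2 ≤ numCandidates T) (hT : 1 ≤ T) (i j : ℕ) :
    0 < drawProb C T ρ m e u i j := by
  have hα := mixing_pos hB hT
  have hBp : (0 : ℝ) < numCandidates T := by exact_mod_cast (by omega : 0 < numCandidates T)
  exact lt_of_lt_of_le (by positivity) (le_selectProb (masterState_weight_pos C T ρ m e u i) j)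

lemma totalWeight_pos (hB : 2 ≤ numCandidates T) (i : ℕ) : 0 < totalWeight C T ρ m e u i :=
  Finset.sum_pos (fun j _ => masterState_weight_pos C T ρ m e u i j)
    (Finset.card_pos.1 (by unfold numCandidates at hB; omega))

/-- One step of the potential argument for exponential weights. -/
lemma log_totalWeight_succ_le (hB : 2 ≤ numCandidates T) (hT : 1 ≤ T) {i : ℕ}
    (hJ : choice C T ρ m e u i ∈ exponents T) (hg0 : 0 ≤ realGain C T ρ m e u i)
    (hg1 : realGain C T ρ m e u i ≤ 1) :
    (1 - mixing T) * (Real.log (totalWeight C T ρ m e u (i + 1)) -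
      Real.log (totalWeight C T ρ m e u i)) ≤
      mixing T / numCandidates T * realGain C T ρ m e u i + (mixing T / numCandidates T) ^ 2 *
        (1 / drawProb C T ρ m e u i (choice C T ρ m e u i)) := by
  have hα := mixing_pos hB hT
  have hα1 := mixing_le_one T
  have hBp : (0 : ℝ) < numCandidates T := by exact_mod_cast (by omega : 0 < numCandidates T)
  have hW := totalWeight_pos (C := C) (ρ := ρ) (m := m) (e := e) (u := u) hB i
  have hW' := totalWeight_pos (C := C) (ρ := ρ) (m := m) (e := e) (u := u) hB (i + 1)
  have hsucc := masterState_succ_snd C (T := T) ρ m e u i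
  have hp := drawProb_pos (C := C) (ρ := ρ) (m := m) (e := e) (u := u) hB hT i
    (choice C T ρ m e u i)
  have hpα := le_selectProb (T := T) (masterState_weight_pos C T ρ m e u i) (choice C T ρ m e u i)
  change _ ≤ drawProb C T ρ m e u i (choice C T ρ m e u i) at hpα
  have hpw : (1 - mixing T) * ((masterState C T ρ m e u i).2 (choice C T ρ m e u i) /
      totalWeight C T ρ m e u i) ≤ drawProb C T ρ m e u i (choice C T ρ m e u i) := by
    unfold drawProb selectProb
    have : 0 ≤ mixing T * (1 / (numCandidates T : ℝ)) := by positivity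
    unfold totalWeight
    linarith
  set J := choice C T ρ m e u i
  set g := realGain C T ρ m e u i
  set p := drawProb C T ρ m e u i J
  set a := mixing T / (numCandidates T : ℝ) with ha
  have ha0 : 0 < a := by positivity
  set y := mixing T / (numCandidates T * p) * g with hy
  have hya : y = a * g / p := by rw [hy, ha]; field_simp
  have hy0 : 0 ≤ y := by rw [hya]; positivity
  -- The exponent is at most `1` since `α / B ≤ p` and the gain is at most `1`.
  have hy1 : y ≤ 1 := by
    rw [hya, div_le_one hp]
    nlinarith
  have hWeq : totalWeight C T ρ m e u (i + 1) = totalWeight C T ρ m e u i +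
      (masterState C T ρ m e u i).2 J * (Real.exp y - 1) := by
    unfold totalWeight
    rw [hsucc, Finset.sum_update_of_mem hJ, ← Finset.add_sum_erase _ _ hJ,
      Finset.sdiff_singleton_eq_erase]
    ring
  have hexp : Real.exp y - 1 ≤ y + y ^ 2 := by
    have := (abs_le.1 (Real.abs_exp_sub_one_sub_id_le (x := y)
      (by rw [abs_of_nonneg hy0]; exact hy1))).2
    linarith
  have hlog : Real.log (totalWeight C T ρ m e u (i + 1)) - Real.log (totalWeight C T ρ m e u i) ≤
      (masterState C T ρ m e u i).2 J / totalWeight C T ρ m e u i * (y + y ^ 2) := by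
    rw [← Real.log_div hW'.ne' hW.ne']
    refine (Real.log_le_sub_one_of_pos (div_pos hW' hW)).trans ?_
    have : totalWeight C T ρ m e u (i + 1) / totalWeight C T ρ m e u i - 1 =
        (masterState C T ρ m e u i).2 J / totalWeight C T ρ m e u i * (Real.exp y - 1) := by
      rw [hWeq]; field_simp; ring
    rw [this]
    have := masterState_weight_pos C T ρ m e u i J
    gcongr
  calc _ ≤ (1 - mixing T) * ((masterState C T ρ m e u i).2 J / totalWeight C T ρ m e u i *
        (y + y ^ 2)) := mul_le_mul_of_nonneg_left hlog (by linarith)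
    _ = ((1 - mixing T) * ((masterState C T ρ m e u i).2 J / totalWeight C T ρ m e u i)) *
        (y + y ^ 2) := by ring
    _ ≤ p * (y + y ^ 2) := by gcongr
    _ = a * g + a ^ 2 * (g ^ 2 / p) := by rw [hya]; field_simp
    _ ≤ a * g + a ^ 2 * (1 / p) := by
        gcongr
        exact pow_le_one₀ hg0 hg1

/-- The logarithm of the weight of exponent `j` is its total estimated gain. -/
lemma log_weight_eq (j n : ℕ) : Real.log ((masterState C T ρ m e u n).2 j) =
    ∑ i ∈ Finset.range n, mixing T / numCandidates T *
      ((if choice C T ρ m e u i = j then 1 / drawProb C T ρ m e u i j else 0) *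
        realGain C T ρ m e u i) := by
  induction n with
  | zero => simp [masterState]
  | succ n ih =>
    rw [Finset.sum_range_succ, ← ih, masterState_succ_snd]
    by_cases h : choice C T ρ m e u n = j
    · rw [h, Function.update_self, if_pos rfl, Real.log_mul
        (masterState_weight_pos C T ρ m e u n j).ne' (Real.exp_pos _).ne', Real.log_exp]
      congr 1
      ring
    · rw [Function.update_of_ne (Ne.symm h), if_neg h]
      ring

/-- The regret bound for exponential weights, up to the first block with large noise. -/
theorem exponential_weights (hB : 2 ≤ numCandidates T) (hT : 1 ≤ T) {j : ℕ}
    (hj : j ∈ exponents T) (hJ : ∀ i, choice C T ρ m e u i ∈ exponents T) {n : ℕ}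
    (hg : ∀ i < n, BlockNoiseGood T i e →
      0 ≤ realGain C T ρ m e u i ∧ realGain C T ρ m e u i ≤ 1) :
    (1 - mixing T) * (∑ i ∈ Finset.range n, prefixGood T (i + 1) e *
      ((if choice C T ρ m e u i = j then 1 / drawProb C T ρ m e u i j else 0) *
        realGain C T ρ m e u i) -
      numCandidates T / mixing T * Real.log (numCandidates T)) ≤
    ∑ i ∈ Finset.range n, (prefixGood T (i + 1) e * realGain C T ρ m e u i +
      mixing T / numCandidates T * (prefixGood T (i + 1) e *
        (1 / drawProb C T ρ m e u i (choice C T ρ m e u i)))) := by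
  have hα := mixing_pos hB hT
  have hα1 := mixing_le_one T
  have hB1 : (1 : ℝ) ≤ numCandidates T := by exact_mod_cast (by omega : 1 ≤ numCandidates T)
  have hBp : (0 : ℝ) < numCandidates T := by linarith
  induction n with
  | zero =>
    simp only [Finset.range_zero, Finset.sum_empty, zero_sub, mul_neg, Left.neg_nonpos_iff]
    have := Real.log_nonneg hB1
    have : 0 ≤ 1 - mixing T := by linarith
    positivity
  | succ n ih =>
    -- Either all blocks are tame, and the potential argument applies, or the last summand vanishes.
    by_cases hall : ∀ l < n + 1, BlockNoiseGood T l e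
    · have hone : ∀ i ∈ Finset.range (n + 1), prefixGood T (i + 1) e = 1 := fun i hi =>
        if_pos fun l hl => hall l (by rw [Finset.mem_range] at hi; omega)
      have hup : (1 - mixing T) * (Real.log (totalWeight C T ρ m e u (n + 1)) -
          Real.log (totalWeight C T ρ m e u 0)) ≤ ∑ i ∈ Finset.range (n + 1),
          (mixing T / numCandidates T * realGain C T ρ m e u i + (mixing T / numCandidates T) ^ 2 *
          (1 / drawProb C T ρ m e u i (choice C T ρ m e u i))) := by
        rw [← Finset.sum_range_sub (fun i => Real.log (totalWeight C T ρ m e u i)), Finset.mul_sum]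
        refine Finset.sum_le_sum fun i hi => ?_
        have hi' := Finset.mem_range.1 hi
        have := hg i hi' (hall i hi')
        exact log_totalWeight_succ_le hB hT (hJ i) this.1 this.2
      have h0 : Real.log (totalWeight C T ρ m e u 0) = Real.log (numCandidates T) := by
        simp [totalWeight, masterState, numCandidates]
      have hlow : Real.log ((masterState C T ρ m e u (n + 1)).2 j) ≤
          Real.log (totalWeight C T ρ m e u (n + 1)) :=
        Real.log_le_log (masterState_weight_pos C T ρ m e u (n + 1) j)
          (Finset.single_le_sum (f := (masterState C T ρ m e u (n + 1)).2)
            (fun l _ => (masterState_weight_pos C T ρ m e u (n + 1) l).le) hj)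
      rw [log_weight_eq, ← Finset.mul_sum] at hlow
      have e1 : ∑ i ∈ Finset.range (n + 1), prefixGood T (i + 1) e *
          ((if choice C T ρ m e u i = j then 1 / drawProb C T ρ m e u i j else 0) *
            realGain C T ρ m e u i) = ∑ i ∈ Finset.range (n + 1),
          ((if choice C T ρ m e u i = j then 1 / drawProb C T ρ m e u i j else 0) *
            realGain C T ρ m e u i) :=
        Finset.sum_congr rfl fun i hi => by rw [hone i hi, one_mul]
      have e2 : ∑ i ∈ Finset.range (n + 1), (prefixGood T (i + 1) e * realGain C T ρ m e u i +
          mixing T / numCandidates T * (prefixGood T (i + 1) e *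
          (1 / drawProb C T ρ m e u i (choice C T ρ m e u i)))) = ∑ i ∈ Finset.range (n + 1),
          (realGain C T ρ m e u i + mixing T / numCandidates T *
            (1 / drawProb C T ρ m e u i (choice C T ρ m e u i))) :=
        Finset.sum_congr rfl fun i hi => by rw [hone i hi, one_mul, one_mul]
      have e3 : ∑ i ∈ Finset.range (n + 1),
          (mixing T / numCandidates T * realGain C T ρ m e u i + (mixing T / numCandidates T) ^ 2 *
          (1 / drawProb C T ρ m e u i (choice C T ρ m e u i))) = mixing T / numCandidates T *
          ∑ i ∈ Finset.range (n + 1), (realGain C T ρ m e u i + mixing T / numCandidates T *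
            (1 / drawProb C T ρ m e u i (choice C T ρ m e u i))) := by
        rw [Finset.mul_sum]
        exact Finset.sum_congr rfl fun i _ => by ring
      rw [e1, e2]
      rw [e3, h0] at hup
      set S := ∑ i ∈ Finset.range (n + 1),
          ((if choice C T ρ m e u i = j then 1 / drawProb C T ρ m e u i j else 0) *
            realGain C T ρ m e u i)
      set R := ∑ i ∈ Finset.range (n + 1), (realGain C T ρ m e u i + mixing T / numCandidates T *
            (1 / drawProb C T ρ m e u i (choice C T ρ m e u i)))
      have h3 := mul_le_mul_of_nonneg_left (sub_le_sub_right hlow (Real.log (numCandidates T)))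
        (by linarith : 0 ≤ 1 - mixing T)
      have h4 := h3.trans hup
      have h5 : (1 - mixing T) * (mixing T / numCandidates T * S - Real.log (numCandidates T)) =
          mixing T / numCandidates T * ((1 - mixing T) *
            (S - numCandidates T / mixing T * Real.log (numCandidates T))) := by
        field_simp
      rw [h5] at h4
      exact le_of_mul_le_mul_left h4 (by positivity)
    · have hz : prefixGood T (n + 1) e = 0 := if_neg hall
      rw [Finset.sum_range_succ, Finset.sum_range_succ, hz]
      simp only [zero_mul, add_zero, mul_zero]
      exact ih fun i hi => hg i (by omega)

end Pathwise

/-- On tame noise the master sees gains in `[0, 1]`: this is what the scale of the gains is for. -/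
lemma blockGain_mem {C : ℝ} (hC : 25 ≤ C) {T : ℕ} (hT : 3 ≤ T)
    (hlog : Real.log (blockLength T) ≤ Real.log T) {ρ : ℕ → ℝ}
    (hρ : ∀ t, 1 ≤ t → 0 ≤ ρ t ∧ ρ t ≤ 1) {m e : ℕ → ℝ} (hm : ∀ k, 0 ≤ m k ∧ m k ≤ 1) (i j : ℕ)
    (he : NoiseGood (blockLength T) (confConst T) e) :
    0 ≤ blockGain C T ρ i j m e ∧ blockGain C T ρ i j m e ≤ 1 := by
  have hD := gainScale_pos (by linarith : 0 < C) (by omega : 2 ≤ T)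
  have hL := confConst_nonneg (by omega : 1 ≤ T)
  have hR0 := (blockEnd_regret_mem (T := T) hρ hm i j e).1
  have hR1 : (blockEnd T ρ i j m e).regret ≤ _ :=
    blockRun_regret_le_crude (rate_pos j).le (rate_le_one j) hL
    (blockShift_mem (T := T) hρ i) hm he (blockLen_le T i)
  have hN := he 0 (blockLen T i) (Nat.zero_le _) (blockLen_le T i)
  rw [← Finset.range_eq_Ico, Nat.sub_zero] at hN
  have hT1 : 1 ≤ Real.log (T : ℝ) := by
    rw [Real.le_log_iff_exp_le (by positivity)]
    have : (3 : ℝ) ≤ T := by exact_mod_cast hT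
    linarith [Real.exp_one_lt_d9]
  have hH : (1 : ℝ) ≤ blockLength T := by exact_mod_cast blockLength_pos (by omega : 1 ≤ T)
  have hl : (blockLen T i : ℝ) ≤ blockLength T := Nat.cast_le.2 (blockLen_le T i)
  have hl0 : (0 : ℝ) ≤ blockLen T i := Nat.cast_nonneg _
  have hLT : confConst T ≤ 10 * Real.log T := by unfold confConst; linarith
  have hDle : 2 * (25 * (blockLength T * Real.log T)) ≤ gainScale C T := by
    have h0 : 0 ≤ (blockLength T : ℝ) * Real.log T := by positivity
    have := Real.sqrt_nonneg ((blockLength T : ℝ) * Real.log T)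
    unfold gainScale
    nlinarith [mul_le_mul_of_nonneg_right hC h0]
  set ℓ : ℝ := (blockLen T i : ℝ)
  set H : ℝ := (blockLength T : ℝ)
  set L := confConst T
  set D := gainScale C T
  set R := (blockEnd T ρ i j m e).regret
  set N := ∑ x ∈ Finset.range (blockLen T i), e x
  have hHT : H ≤ H * Real.log T := by nlinarith
  have hLH : L * H ≤ 10 * (H * Real.log T) := by nlinarith
  have hsq : Real.sqrt (L * ℓ) ≤ L + H := by
    have h1 := Real.sq_sqrt hL
    have h2 := Real.sq_sqrt hl0
    rw [Real.sqrt_mul hL]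
    nlinarith [sq_nonneg (Real.sqrt L - Real.sqrt ℓ)]
  have hLL : L ≤ L * H := by nlinarith
  have hN' := abs_le.1 (hN.trans hsq)
  have hRH : (4 + L) * ℓ ≤ (4 + L) * H := by gcongr
  have hx1 : -(1 / 2) ≤ (ℓ - R + N) / D := by
    rw [le_div_iff₀ hD]
    nlinarith
  have hx2 : (ℓ - R + N) / D ≤ 1 / 2 := by
    rw [div_le_iff₀ hD]
    nlinarith
  unfold blockGain
  constructor <;> linarith

/-! ### The expected regret of the master -/

/-- The regret of block `i` in the run of the policy. -/
noncomputable def realRegret (C : ℝ) (T : ℕ) (ρ m e u : ℕ → ℝ) (i : ℕ) : ℝ :=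
  (blockEnd T ρ i (choice C T ρ m e u i) (freshMeans C T ρ m e u i) (blockShift T i e)).regret

lemma le_blockLength_sq (T : ℕ) : (T : ℝ) ≤ (blockLength T : ℝ) ^ 2 := by
  have h : Real.sqrt T ≤ blockLength T := Nat.le_ceil _
  calc (T : ℝ) = Real.sqrt T ^ 2 := (Real.sq_sqrt (Nat.cast_nonneg T)).symm
    _ ≤ _ := by gcongr

lemma numBlocks_le {T : ℕ} (hT : 1 ≤ T) : numBlocks T ≤ blockLength T := by
  unfold numBlocks
  rw [Nat.ceil_le, div_le_iff₀ (by exact_mod_cast blockLength_pos hT), ← sq]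
  exact le_blockLength_sq T

section

variable {Ω : Type*} [MeasurableSpace Ω] {P : Measure Ω}
  {m η U : ℕ → Ω → ℝ} {C : ℝ} {T : ℕ} {ρ : ℕ → ℝ}

lemma RandomInput.measurable_realRegret (h : RandomInput P m η U) (i : ℕ) :
    Measurable fun ω => realRegret C T ρ (m · ω) (η · ω) (U · ω) i :=
  measurable_blockEnd_regret T ρ i
    (measurable_choice C T ρ h.measurable_means h.measurable_noises h.measurable_unifs i)
    (measurable_freshMeans C T ρ h.measurable_means h.measurable_noises h.measurable_unifs i)
    (measurable_blockShift T i h.measurable_noises)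

lemma RandomInput.measurable_drawProb (h : RandomInput P m η U) (i : ℕ) :
    Measurable fun ω => drawProb C T ρ (m · ω) (η · ω) (U · ω) i :=
  measurable_selectProb T (measurable_masterState C T ρ h.measurable_means h.measurable_noises
    h.measurable_unifs i).snd

lemma RandomInput.ae_realRegret_mem (h : RandomInput P m η U)
    (hρ : ∀ t, 1 ≤ t → 0 ≤ ρ t ∧ ρ t ≤ 1) (i : ℕ) :
    ∀ᵐ ω ∂P, 0 ≤ realRegret C T ρ (m · ω) (η · ω) (U · ω) i ∧
      realRegret C T ρ (m · ω) (η · ω) (U · ω) i ≤ blockLength T * (1 + blockLength T) := by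
  filter_upwards [h.ae_mem] with ω hω
  exact blockEnd_regret_mem hρ (fun k => hω.1 _) _ _ _

lemma RandomInput.integrable_prefixGood_mul (h : RandomInput P m η U) (i : ℕ) {f : Ω → ℝ}
    (hf : Integrable f P) : Integrable (fun ω => prefixGood T i (η · ω) * f ω) P :=
  hf.bdd_mul (measurable_prefixGood T i h.measurable_noises).aestronglyMeasurable
    (c := 1) (Eventually.of_forall fun ω => by
      rw [Real.norm_eq_abs, abs_of_nonneg (prefixGood_nonneg _ _ _)]
      exact prefixGood_le_one _ _ _)

lemma RandomInput.ae_choice_mem (h : RandomInput P m η U) (hB : 1 ≤ numCandidates T) :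
    ∀ᵐ ω ∂P, ∀ i, choice C T ρ (m · ω) (η · ω) (U · ω) i ∈ exponents T := by
  filter_upwards [h.ae_mem] with ω hω i
  exact draw_mem (sum_selectProb (masterState_weight_pos _ _ _ _ _ _ _) hB) (hω.2 _).2

variable [IsProbabilityMeasure P]

lemma RandomInput.integrable_realRegret (h : RandomInput P m η U)
    (hρ : ∀ t, 1 ≤ t → 0 ≤ ρ t ∧ ρ t ≤ 1) (i : ℕ) :
    Integrable (fun ω => realRegret C T ρ (m · ω) (η · ω) (U · ω) i) P := by
  refine Integrable.of_bound (h.measurable_realRegret i).aestronglyMeasurable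
    (blockLength T * (1 + blockLength T)) ?_
  filter_upwards [h.ae_realRegret_mem hρ i] with ω hω
  rw [Real.norm_eq_abs, abs_of_nonneg hω.1]
  exact hω.2

lemma RandomInput.integrable_prefixGood (h : RandomInput P m η U) (i : ℕ) :
    Integrable (fun ω => prefixGood T i (η · ω)) P :=
  Integrable.of_bound (measurable_prefixGood T i h.measurable_noises).aestronglyMeasurable 1
    (Eventually.of_forall fun ω => by
      rw [Real.norm_eq_abs, abs_of_nonneg (prefixGood_nonneg _ _ _)]
      exact prefixGood_le_one _ _ _)

lemma RandomInput.integral_prefixGood_mem (h : RandomInput P m η U) (i : ℕ) :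
    0 ≤ ∫ ω, prefixGood T i (η · ω) ∂P ∧ ∫ ω, prefixGood T i (η · ω) ∂P ≤ 1 := by
  refine ⟨integral_nonneg fun ω => prefixGood_nonneg _ _ _, ?_⟩
  calc _ ≤ ∫ _ω, (1 : ℝ) ∂P := integral_mono (h.integrable_prefixGood i) (integrable_const _)
        fun ω => prefixGood_le_one _ _ _
    _ = 1 := by simp

/-- A noise event of probability `O(1 / H²)` may be neglected. -/
lemma RandomInput.integral_one_sub_prefixGood_le (h : RandomInput P m η U) (hT : 1 ≤ T) {n : ℕ}
    (hn : n ≤ blockLength T) :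
    ∫ ω, (1 - prefixGood T n (η · ω)) ∂P ≤ 8 / (blockLength T : ℝ) ^ 2 := by
  have hH : (1 : ℝ) ≤ blockLength T := by exact_mod_cast blockLength_pos hT
  have hbm : ∀ l, MeasurableSet {ω | ¬ BlockNoiseGood T l (η · ω)} := fun l =>
    (measurableSet_blockNoiseGood T l h.measurable_noises).compl
  have hi : ∀ l, Integrable (Set.indicator {ω | ¬ BlockNoiseGood T l (η · ω)}
      fun _ => (1 : ℝ)) P := fun l => (integrable_const _).indicator (hbm l)
  calc ∫ ω, (1 - prefixGood T n (η · ω)) ∂P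
      ≤ ∫ ω, ∑ l ∈ Finset.range n, Set.indicator {ω | ¬ BlockNoiseGood T l (η · ω)}
          (fun _ => (1 : ℝ)) ω ∂P := by
        refine integral_mono ((integrable_const _).sub (h.integrable_prefixGood n))
          (integrable_finsetSum _ fun l _ => hi l) fun ω => ?_
        have hnn : ∀ l ∈ Finset.range n, (0 : ℝ) ≤
            Set.indicator {ω | ¬ BlockNoiseGood T l (η · ω)} (fun _ => (1 : ℝ)) ω := fun l _ =>
          Set.indicator_nonneg (fun _ _ => zero_le_one) ω
        by_cases hg : ∀ l < n, BlockNoiseGood T l (η · ω)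
        · simp only [prefixGood, if_pos hg, sub_self]
          exact Finset.sum_nonneg hnn
        · simp only [prefixGood, if_neg hg, sub_zero]
          push Not at hg
          obtain ⟨l, hl, hb⟩ := hg
          refine le_trans ?_ (Finset.single_le_sum hnn (Finset.mem_range.2 hl))
          rw [Set.indicator_of_mem (by exact hb)]
    _ = ∑ l ∈ Finset.range n, P.real {ω | ¬ BlockNoiseGood T l (η · ω)} := by
        rw [integral_finsetSum _ fun l _ => hi l]
        refine Finset.sum_congr rfl fun l _ => ?_
        rw [integral_indicator_const _ (hbm l), smul_eq_mul, mul_one]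
    _ ≤ ∑ _l ∈ Finset.range n, 8 / (blockLength T : ℝ) ^ 3 :=
        Finset.sum_le_sum fun l _ => h.prob_not_blockNoiseGood_le hT l
    _ = n * (8 / (blockLength T : ℝ) ^ 3) := by simp
    _ ≤ blockLength T * (8 / (blockLength T : ℝ) ^ 3) := by gcongr
    _ = _ := by field_simp

/-- The gain of candidate `j` in a block on tame noise. -/
noncomputable def tameGain (C : ℝ) (T : ℕ) (ρ : ℕ → ℝ) (i j : ℕ) : (ℕ → ℝ) × (ℕ → ℝ) → ℝ :=
  Set.indicator {q | NoiseGood (blockLength T) (confConst T) q.2}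
    fun q => blockGain C T ρ i j q.1 q.2

/-- The part of the gain of a block that does not depend on the candidate, on tame noise. -/
noncomputable def tameBase (C : ℝ) (T : ℕ) (i : ℕ) : (ℕ → ℝ) × (ℕ → ℝ) → ℝ :=
  Set.indicator {q | NoiseGood (blockLength T) (confConst T) q.2}
    fun q => 1 / 2 + (blockLen T i + ∑ x ∈ Finset.range (blockLen T i), q.2 x) / gainScale C T

lemma measurable_tameGain (i j : ℕ) : Measurable (tameGain C T ρ i j) :=
  (measurable_blockGain C T ρ i measurable_const measurable_fst measurable_snd).indicator
    (measurableSet_noiseGood _ _ measurable_snd)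

lemma measurable_tameBase (i : ℕ) : Measurable (tameBase C T i) := by
  refine Measurable.indicator ?_ (measurableSet_noiseGood _ _ measurable_snd)
  have : ∀ x, Measurable fun q : (ℕ → ℝ) × (ℕ → ℝ) => q.2 x := fun x => measurable_snd.eval
  fun_prop

lemma abs_tameBase_le (hC : 0 < C) (hT : 2 ≤ T) (i : ℕ) (q : (ℕ → ℝ) × (ℕ → ℝ)) :
    |tameBase C T i q| ≤ 1 / 2 +
      (blockLen T i + Real.sqrt (confConst T * blockLen T i)) / gainScale C T := by
  have hD := gainScale_pos hC hT
  unfold tameBase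
  by_cases hg : NoiseGood (blockLength T) (confConst T) q.2
  · rw [Set.indicator_of_mem (by exact hg)]
    have hN := hg 0 (blockLen T i) (Nat.zero_le _) (blockLen_le T i)
    rw [← Finset.range_eq_Ico, Nat.sub_zero] at hN
    refine (abs_add_le _ _).trans ?_
    rw [abs_of_pos (by norm_num : (0 : ℝ) < 1 / 2), abs_div, abs_of_pos hD]
    gcongr
    refine (abs_add_le _ _).trans ?_
    rw [abs_of_nonneg (Nat.cast_nonneg _)]
    gcongr
  · rw [Set.indicator_of_notMem (by exact hg), abs_zero]
    positivity

lemma RandomInput.integrable_tameBase (h : RandomInput P m η U) (hC : 0 < C) (hT : 2 ≤ T) (i : ℕ) :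
    Integrable (fun ω => tameBase C T i ((m · ω), blockShift T i (η · ω))) P :=
  Integrable.of_bound ((measurable_tameBase i).comp (h.measurable_means.prodMk
    (measurable_blockShift T i h.measurable_noises))).aestronglyMeasurable _
    (Eventually.of_forall fun _ => abs_tameBase_le hC hT i _)

lemma tameGain_eq (i j : ℕ) (q : (ℕ → ℝ) × (ℕ → ℝ)) : tameGain C T ρ i j q = tameBase C T i q -
    Set.indicator {q | NoiseGood (blockLength T) (confConst T) q.2}
      (fun q => (blockEnd T ρ i j q.1 q.2).regret) q / gainScale C T := by
  unfold tameGain tameBase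
  by_cases hg : NoiseGood (blockLength T) (confConst T) q.2
  · rw [Set.indicator_of_mem (by exact hg), Set.indicator_of_mem (by exact hg),
      Set.indicator_of_mem (by exact hg), blockGain]
    ring
  · rw [Set.indicator_of_notMem (by exact hg), Set.indicator_of_notMem (by exact hg),
      Set.indicator_of_notMem (by exact hg)]
    simp

/-- The expected regret of candidate `j` in block `i` on tame noise, for new arms that are chosen
from the beginning of the sequence. -/
noncomputable def tameRegret (P : Measure Ω) (m η : ℕ → Ω → ℝ) (T : ℕ) (ρ : ℕ → ℝ) (i j : ℕ) : ℝ :=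
  ∫ ω, Set.indicator {ω | BlockNoiseGood T i (η · ω)}
      (fun ω => (blockEnd T ρ i j (m · ω) (blockShift T i (η · ω))).regret) ω ∂P

lemma RandomInput.integral_tameGain (h : RandomInput P m η U) (hC : 0 < C) (hT : 2 ≤ T)
    (hρ : ∀ t, 1 ≤ t → 0 ≤ ρ t ∧ ρ t ≤ 1) (i j : ℕ) :
    Integrable (fun ω => tameGain C T ρ i j ((m · ω), blockShift T i (η · ω))) P ∧
    ∫ ω, tameGain C T ρ i j ((m · ω), blockShift T i (η · ω)) ∂P =
      ∫ ω, tameBase C T i ((m · ω), blockShift T i (η · ω)) ∂P -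
        tameRegret P m η T ρ i j / gainScale C T := by
  have e : (fun ω => tameGain C T ρ i j ((m · ω), blockShift T i (η · ω))) = fun ω =>
      tameBase C T i ((m · ω), blockShift T i (η · ω)) -
      Set.indicator {ω | BlockNoiseGood T i (η · ω)}
      (fun ω => (blockEnd T ρ i j (m · ω) (blockShift T i (η · ω))).regret) ω / gainScale C T := by
    funext ω
    rw [tameGain_eq]
    rfl
  have h1 := h.integrable_tameBase hC hT i
  have h2 := (h.integrable_good_regret (T := T) hρ i j).div_const (gainScale C T)
  rw [e]
  refine ⟨h1.sub h2, ?_⟩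
  rw [integral_sub h1 h2, integral_div, tameRegret]

/-- The estimated gain of candidate `j` in block `i` is unbiased. -/
lemma RandomInput.integral_estimated_gain (h : RandomInput P m η U) (hC : 0 < C) (hT : 2 ≤ T)
    (hB : 2 ≤ numCandidates T) (hρ : ∀ t, 1 ≤ t → 0 ≤ ρ t ∧ ρ t ≤ 1) (i : ℕ) {j : ℕ}
    (hj : j ∈ exponents T) :
    Integrable (fun ω => prefixGood T (i + 1) (η · ω) *
      ((if choice C T ρ (m · ω) (η · ω) (U · ω) i = j then
        1 / drawProb C T ρ (m · ω) (η · ω) (U · ω) i j else 0) *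
        realGain C T ρ (m · ω) (η · ω) (U · ω) i)) P ∧
    ∫ ω, prefixGood T (i + 1) (η · ω) *
      ((if choice C T ρ (m · ω) (η · ω) (U · ω) i = j then
        1 / drawProb C T ρ (m · ω) (η · ω) (U · ω) i j else 0) *
        realGain C T ρ (m · ω) (η · ω) (U · ω) i) ∂P =
    (∫ ω, prefixGood T i (η · ω) ∂P) *
      ∫ ω, tameGain C T ρ i j ((m · ω), blockShift T i (η · ω)) ∂P := by
  set G : (ℕ → ℝ) × ℝ → ℝ := fun q =>
    if draw T (selectProb T q.1) q.2 = j then 1 / selectProb T q.1 j else 0 with hG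
  have hGm : Measurable G := by
    refine Measurable.ite ?_ ?_ measurable_const
    · exact measurable_draw T (measurable_selectProb T measurable_fst) measurable_snd
        (measurableSet_singleton j)
    · exact measurable_const.div (measurable_selectProb T measurable_fst).eval
  obtain ⟨h1, h2⟩ := h.integral_mul_fresh (C := C) (T := T) (ρ := ρ) i hGm
    (c := numCandidates T / mixing T)
    (fun ω => abs_draw_weight_le hB (by omega) (masterState_weight_pos _ _ _ _ _ _ _) j _)
    (measurable_tameGain (C := C) (T := T) (ρ := ρ) i j) (h.integral_tameGain hC hT hρ i j).1
  have e : (fun ω => prefixGood T (i + 1) (η · ω) *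
      ((if choice C T ρ (m · ω) (η · ω) (U · ω) i = j then
        1 / drawProb C T ρ (m · ω) (η · ω) (U · ω) i j else 0) *
        realGain C T ρ (m · ω) (η · ω) (U · ω) i)) = fun ω => prefixGood T i (η · ω) *
      G ((masterState C T ρ (m · ω) (η · ω) (U · ω) i).2, U (i + 1) ω) *
      tameGain C T ρ i j (freshMeans C T ρ (m · ω) (η · ω) (U · ω) i,
        blockShift T i (η · ω)) := by
    funext ω
    have hGω : G ((masterState C T ρ (m · ω) (η · ω) (U · ω) i).2, U (i + 1) ω) =
        if choice C T ρ (m · ω) (η · ω) (U · ω) i = j then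
        1 / drawProb C T ρ (m · ω) (η · ω) (U · ω) i j else 0 := rfl
    rw [hGω, prefixGood_succ, tameGain]
    by_cases hc : choice C T ρ (m · ω) (η · ω) (U · ω) i = j
    · by_cases hg : BlockNoiseGood T i (η · ω)
      · rw [Set.indicator_of_mem (by exact hg), if_pos hg, mul_one, realGain, hc, mul_assoc]
      · rw [Set.indicator_of_notMem (by exact hg), if_neg hg]
        simp
    · rw [if_neg hc]; simp
  rw [e]
  refine ⟨h1, h2.trans ?_⟩
  congr 1
  exact h.integral_draw (by omega) hB i hj

/-- The expected gain of a block of the run, up to its regret on tame noise, is the same for every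
choice of candidates. -/
lemma RandomInput.integral_realGain (h : RandomInput P m η U) (hC : 0 < C) (hT : 2 ≤ T)
    (hρ : ∀ t, 1 ≤ t → 0 ≤ ρ t ∧ ρ t ≤ 1) (i : ℕ) :
    Integrable (fun ω => prefixGood T (i + 1) (η · ω) *
      realGain C T ρ (m · ω) (η · ω) (U · ω) i) P ∧
    ∫ ω, prefixGood T (i + 1) (η · ω) * realGain C T ρ (m · ω) (η · ω) (U · ω) i ∂P =
    (∫ ω, prefixGood T i (η · ω) ∂P) *
      ∫ ω, tameBase C T i ((m · ω), blockShift T i (η · ω)) ∂P -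
      (∫ ω, prefixGood T (i + 1) (η · ω) * realRegret C T ρ (m · ω) (η · ω) (U · ω) i ∂P) /
        gainScale C T := by
  obtain ⟨h1, h2⟩ := h.integral_mul_fresh (C := C) (T := T) (ρ := ρ) i (G := fun _ => 1)
    measurable_const (c := 1) (fun ω => by simp)
    (measurable_tameBase (C := C) (T := T) i) (h.integrable_tameBase hC hT i)
  have h3 := (h.integrable_prefixGood_mul (T := T) (i + 1)
    (h.integrable_realRegret (C := C) (T := T) hρ i)).div_const (gainScale C T)
  have e : (fun ω => prefixGood T (i + 1) (η · ω) * realGain C T ρ (m · ω) (η · ω) (U · ω) i) =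
      fun ω => prefixGood T i (η · ω) * 1 *
        tameBase C T i (freshMeans C T ρ (m · ω) (η · ω) (U · ω) i, blockShift T i (η · ω)) -
        prefixGood T (i + 1) (η · ω) * realRegret C T ρ (m · ω) (η · ω) (U · ω) i /
          gainScale C T := by
    funext ω
    rw [prefixGood_succ, tameBase]
    by_cases hg : BlockNoiseGood T i (η · ω)
    · rw [Set.indicator_of_mem (by exact hg), if_pos hg, realGain, blockGain, ← realRegret]
      ring
    · rw [Set.indicator_of_notMem (by exact hg), if_neg hg]
      simp
  rw [e]
  refine ⟨h1.sub h3, ?_⟩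
  rw [integral_sub h1 h3, h2, integral_div]
  simp only [mul_one]

/-- The expected inverse probability of the drawn candidate is the number of candidates: the second
moment that exponential weights pay for. -/
lemma RandomInput.integral_inv_drawProb_le (h : RandomInput P m η U) (hT : 1 ≤ T)
    (hB : 2 ≤ numCandidates T) (i : ℕ) :
    Integrable (fun ω => prefixGood T (i + 1) (η · ω) *
      (1 / drawProb C T ρ (m · ω) (η · ω) (U · ω) i
        (choice C T ρ (m · ω) (η · ω) (U · ω) i))) P ∧
    ∫ ω, prefixGood T (i + 1) (η · ω) *
      (1 / drawProb C T ρ (m · ω) (η · ω) (U · ω) i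
        (choice C T ρ (m · ω) (η · ω) (U · ω) i)) ∂P ≤ numCandidates T := by
  have hchm : Measurable fun ω => choice C T ρ (m · ω) (η · ω) (U · ω) i :=
    measurable_choice C T ρ h.measurable_means h.measurable_noises h.measurable_unifs i
  have hpm := h.measurable_drawProb (C := C) (T := T) (ρ := ρ) i
  have hbd : ∀ ω, ∀ j l, |if l = j then 1 / drawProb C T ρ (m · ω) (η · ω) (U · ω) i j else 0| ≤
      numCandidates T / mixing T := fun ω j l =>
    abs_draw_weight_le hB hT (masterState_weight_pos _ _ _ _ _ _ _) j l
  have hi1 : Integrable (fun ω => prefixGood T (i + 1) (η · ω) *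
      (1 / drawProb C T ρ (m · ω) (η · ω) (U · ω) i
        (choice C T ρ (m · ω) (η · ω) (U · ω) i))) P := by
    refine h.integrable_prefixGood_mul _ (Integrable.of_bound (measurable_const.div
      (measurable_natIndexed (f := fun n ω => drawProb C T ρ (m · ω) (η · ω) (U · ω) i n)
      (fun _ => hpm.eval) hchm)).aestronglyMeasurable (numCandidates T / mixing T)
      (Eventually.of_forall fun ω => ?_))
    have := hbd ω (choice C T ρ (m · ω) (η · ω) (U · ω) i) (choice C T ρ (m · ω) (η · ω) (U · ω) i)
    rwa [if_pos rfl] at this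
  have hi2 : ∀ j, Integrable (fun ω => prefixGood T i (η · ω) *
      (if choice C T ρ (m · ω) (η · ω) (U · ω) i = j then
        1 / drawProb C T ρ (m · ω) (η · ω) (U · ω) i j else 0)) P := fun j => by
    refine h.integrable_prefixGood_mul _ (Integrable.of_bound (Measurable.ite
      (hchm (measurableSet_singleton j)) (measurable_const.div hpm.eval)
      measurable_const).aestronglyMeasurable (numCandidates T / mixing T)
      (Eventually.of_forall fun ω => hbd ω j _))
  refine ⟨hi1, ?_⟩
  calc _ ≤ ∫ ω, ∑ j ∈ exponents T, prefixGood T i (η · ω) *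
        (if choice C T ρ (m · ω) (η · ω) (U · ω) i = j then
          1 / drawProb C T ρ (m · ω) (η · ω) (U · ω) i j else 0) ∂P := by
        refine integral_mono_ae hi1 (integrable_finsetSum _ fun j _ => hi2 j) ?_
        filter_upwards [h.ae_choice_mem (C := C) (T := T) (ρ := ρ) (by omega)] with ω hω
        rw [← Finset.mul_sum, Finset.sum_ite_eq, if_pos (hω i), prefixGood_succ, mul_assoc]
        have hp := drawProb_pos (C := C) (ρ := ρ) (m := (m · ω)) (e := (η · ω)) (u := (U · ω)) hB hT
          i (choice C T ρ (m · ω) (η · ω) (U · ω) i)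
        refine mul_le_mul_of_nonneg_left ?_ (prefixGood_nonneg _ _ _)
        refine mul_le_of_le_one_left (by positivity) ?_
        split_ifs <;> norm_num
    _ = ∑ _j ∈ exponents T, ∫ ω, prefixGood T i (η · ω) ∂P := by
        rw [integral_finsetSum _ fun j _ => hi2 j]
        exact Finset.sum_congr rfl fun j hj => h.integral_draw hT hB i hj
    _ ≤ ∑ _j ∈ exponents T, (1 : ℝ) :=
        Finset.sum_le_sum fun j _ => (h.integral_prefixGood_mem i).2
    _ = numCandidates T := by simp [numCandidates]

/-- Apart from the usual price of exponential weights, the policy is as good as the constant choice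
of any candidate. -/
theorem RandomInput.sum_integral_prefix_regret_le (h : RandomInput P m η U) (hC : 25 ≤ C)
    (hT : 3 ≤ T) (hB : 2 ≤ numCandidates T) (hlog : Real.log (blockLength T) ≤ Real.log T)
    (hρ : ∀ t, 1 ≤ t → 0 ≤ ρ t ∧ ρ t ≤ 1) {j : ℕ} (hj : j ∈ exponents T) (n : ℕ) :
    ∑ i ∈ Finset.range n, ∫ ω, prefixGood T (i + 1) (η · ω) *
      realRegret C T ρ (m · ω) (η · ω) (U · ω) i ∂P ≤
    ∑ i ∈ Finset.range n, tameRegret P m η T ρ i j + gainScale C T *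
      (2 * mixing T * n + numCandidates T / mixing T * Real.log (numCandidates T)) := by
  have hC0 : 0 < C := by linarith
  have hD := gainScale_pos hC0 (by omega : 2 ≤ T)
  have hα := mixing_pos hB (by omega : 1 ≤ T)
  have hα1 := mixing_le_one T
  have hB1 : (1 : ℝ) ≤ numCandidates T := by exact_mod_cast (by omega : 1 ≤ numCandidates T)
  have hest := fun i => h.integral_estimated_gain (C := C) hC0 (by omega : 2 ≤ T) hB hρ i hj
  have hgain := fun i => h.integral_realGain (C := C) hC0 (by omega : 2 ≤ T) hρ i
  have hinv := fun i => h.integral_inv_drawProb_le (C := C) (ρ := ρ) (by omega : 1 ≤ T) hB i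
  -- Take expectations in `exponential_weights`.
  have hpath := integral_mono_ae (μ := P)
    (((integrable_finsetSum (Finset.range n) fun i _ => (hest i).1).sub (integrable_const
      (numCandidates T / mixing T * Real.log (numCandidates T)))).const_mul (1 - mixing T))
    (integrable_finsetSum (Finset.range n) fun i _ =>
      (hgain i).1.add ((hinv i).1.const_mul (mixing T / numCandidates T))) (by
    filter_upwards [h.ae_choice_mem (C := C) (T := T) (ρ := ρ) (by omega), h.ae_mem] with ω hω hω'
    exact exponential_weights hB (by omega) hj hω fun i _ hg =>
      blockGain_mem hC hT hlog hρ (fun k => hω'.1 _) i _ hg)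
  rw [integral_const_mul, integral_sub' (integrable_finsetSum _ fun i _ => (hest i).1)
    (integrable_const _), integral_finsetSum _ fun i _ => (hest i).1,
    integral_finsetSum _ fun i _ =>
      (hgain i).1.add ((hinv i).1.const_mul (mixing T / numCandidates T))] at hpath
  simp only [integral_const, probReal_univ, smul_eq_mul, one_mul] at hpath
  have hrhs : ∀ i ∈ Finset.range n, ∫ ω, (fun ω => prefixGood T (i + 1) (η · ω) *
      realGain C T ρ (m · ω) (η · ω) (U · ω) i + mixing T / numCandidates T *
      (prefixGood T (i + 1) (η · ω) * (1 / drawProb C T ρ (m · ω) (η · ω) (U · ω) i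
        (choice C T ρ (m · ω) (η · ω) (U · ω) i)))) ω ∂P ≤
      (∫ ω, prefixGood T i (η · ω) ∂P) *
      ∫ ω, tameBase C T i ((m · ω), blockShift T i (η · ω)) ∂P -
      (∫ ω, prefixGood T (i + 1) (η · ω) * realRegret C T ρ (m · ω) (η · ω) (U · ω) i ∂P) /
        gainScale C T + mixing T := fun i _ => by
    rw [integral_add (hgain i).1 ((hinv i).1.const_mul _), (hgain i).2, integral_const_mul]
    have : mixing T / numCandidates T * ∫ ω, prefixGood T (i + 1) (η · ω) *
      (1 / drawProb C T ρ (m · ω) (η · ω) (U · ω) i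
        (choice C T ρ (m · ω) (η · ω) (U · ω) i)) ∂P ≤ mixing T := by
      calc _ ≤ mixing T / numCandidates T * numCandidates T := by gcongr; exact (hinv i).2
        _ = mixing T := by field_simp
    linarith
  have hpath2 := hpath.trans (Finset.sum_le_sum hrhs)
  simp only [fun i => (hest i).2] at hpath2
  -- the gain of the comparison candidate, in each block
  have hγ : ∀ i, (∫ ω, prefixGood T i (η · ω) ∂P) *
      ∫ ω, tameBase C T i ((m · ω), blockShift T i (η · ω)) ∂P ≤
      (∫ ω, prefixGood T i (η · ω) ∂P) *
      (∫ ω, tameGain C T ρ i j ((m · ω), blockShift T i (η · ω)) ∂P) +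
        tameRegret P m η T ρ i j / gainScale C T := fun i => by
    rw [(h.integral_tameGain hC0 (by omega : 2 ≤ T) hρ i j).2]
    have h1 := h.integral_prefixGood_mem (T := T) i
    have h2 : 0 ≤ tameRegret P m η T ρ i j := by
      refine integral_nonneg_of_ae ?_
      filter_upwards [h.ae_mem] with ω hω
      exact Set.indicator_apply_nonneg fun _ => (blockEnd_regret_mem hρ hω.1 _ _ _).1
    have h3 : (∫ ω, prefixGood T i (η · ω) ∂P) * (tameRegret P m η T ρ i j / gainScale C T) ≤
        tameRegret P m η T ρ i j / gainScale C T :=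
      mul_le_of_le_one_left (by positivity) h1.2
    linarith
  have hγ1 : ∀ i, (∫ ω, prefixGood T i (η · ω) ∂P) *
      (∫ ω, tameGain C T ρ i j ((m · ω), blockShift T i (η · ω)) ∂P) ≤ 1 := fun i => by
    have h1 := h.integral_prefixGood_mem (T := T) i
    have hmem : ∀ᵐ ω ∂P, 0 ≤ tameGain C T ρ i j ((m · ω), blockShift T i (η · ω)) ∧
        tameGain C T ρ i j ((m · ω), blockShift T i (η · ω)) ≤ 1 := by
      filter_upwards [h.ae_mem] with ω hω
      unfold tameGain
      by_cases hg : BlockNoiseGood T i (η · ω)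
      · rw [Set.indicator_of_mem (by exact hg)]
        exact blockGain_mem hC hT hlog hρ hω.1 i j hg
      · rw [Set.indicator_of_notMem (by exact hg)]
        norm_num
    have h2 : ∫ ω, tameGain C T ρ i j ((m · ω), blockShift T i (η · ω)) ∂P ≤ 1 := by
      calc _ ≤ ∫ _ω, (1 : ℝ) ∂P := integral_mono_ae
            (h.integral_tameGain hC0 (by omega : 2 ≤ T) hρ i j).1 (integrable_const _) (by
              filter_upwards [hmem] with ω hω using hω.2)
        _ = 1 := by simp
    have h3 : 0 ≤ ∫ ω, tameGain C T ρ i j ((m · ω), blockShift T i (η · ω)) ∂P :=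
      integral_nonneg_of_ae (by filter_upwards [hmem] with ω hω using hω.1)
    exact mul_le_one₀ h1.2 h3 h2
  set Q : ℝ := ∑ i ∈ Finset.range n, (∫ ω, prefixGood T i (η · ω) ∂P) *
      (∫ ω, tameGain C T ρ i j ((m · ω), blockShift T i (η · ω)) ∂P) with hQ
  have hQn : Q ≤ n := by
    calc Q ≤ ∑ i ∈ Finset.range n, (1 : ℝ) := Finset.sum_le_sum fun i _ => hγ1 i
      _ = n := by simp
  have hsum := Finset.sum_le_sum fun i (_ : i ∈ Finset.range n) => hγ i
  rw [Finset.sum_add_distrib, ← hQ, ← Finset.sum_div] at hsum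
  rw [Finset.sum_add_distrib, Finset.sum_sub_distrib, ← Finset.sum_div] at hpath2
  simp only [Finset.sum_const, Finset.card_range, nsmul_eq_mul] at hpath2
  set X := ∑ i ∈ Finset.range n, ∫ ω, prefixGood T (i + 1) (η · ω) *
      realRegret C T ρ (m · ω) (η · ω) (U · ω) i ∂P
  set Y := ∑ i ∈ Finset.range n, tameRegret P m η T ρ i j
  set Z := (numCandidates T : ℝ) / mixing T * Real.log (numCandidates T) with hZ
  have hZ0 : 0 ≤ Z := by
    have := Real.log_nonneg hB1
    positivity
  have hfin : X / gainScale C T ≤ Y / gainScale C T + (2 * mixing T * n + Z) := by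
    have h1 : mixing T * Q ≤ mixing T * n := by gcongr
    have h2 : (1 - mixing T) * Z ≤ Z := mul_le_of_le_one_left hZ0 (by linarith)
    linarith
  rw [div_le_iff₀ hD] at hfin
  calc X ≤ (Y / gainScale C T + (2 * mixing T * n + Z)) * gainScale C T := hfin
    _ = _ := by field_simp

/-- The bound for the regret on tame noise, with the rare blocks of large noise added: each of them
costs at most `H (1 + H)`. -/
theorem RandomInput.sum_integral_regret_le (h : RandomInput P m η U) (hC : 25 ≤ C)
    (hT : 3 ≤ T) (hB : 2 ≤ numCandidates T) (hlog : Real.log (blockLength T) ≤ Real.log T)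
    (hρ : ∀ t, 1 ≤ t → 0 ≤ ρ t ∧ ρ t ≤ 1) {j : ℕ} (hj : j ∈ exponents T) {n : ℕ}
    (hn : n ≤ blockLength T) :
    ∑ i ∈ Finset.range n, ∫ ω, realRegret C T ρ (m · ω) (η · ω) (U · ω) i ∂P ≤
    ∑ i ∈ Finset.range n, tameRegret P m η T ρ i j + gainScale C T *
      (2 * mixing T * n + numCandidates T / mixing T * Real.log (numCandidates T)) +
      16 * blockLength T := by
  have h1 := h.sum_integral_prefix_regret_le hC hT hB hlog hρ hj n
  have hH : (1 : ℝ) ≤ blockLength T := by exact_mod_cast blockLength_pos (by omega : 1 ≤ T)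
  set H : ℝ := (blockLength T : ℝ) with hHd
  have hbad := h.integral_one_sub_prefixGood_le (by omega : 1 ≤ T) hn
  have hone : Integrable (fun ω => 1 - prefixGood T n (η · ω)) P :=
    (integrable_const _).sub (h.integrable_prefixGood n)
  have h2 : ∀ i ∈ Finset.range n, ∫ ω, realRegret C T ρ (m · ω) (η · ω) (U · ω) i ∂P ≤
      ∫ ω, prefixGood T (i + 1) (η · ω) * realRegret C T ρ (m · ω) (η · ω) (U · ω) i ∂P
        + H * (1 + H) * (8 / H ^ 2) := fun i hi => by
    have hi' := Finset.mem_range.1 hi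
    calc _ ≤ ∫ ω, (prefixGood T (i + 1) (η · ω) * realRegret C T ρ (m · ω) (η · ω) (U · ω) i +
          H * (1 + H) * (1 - prefixGood T n (η · ω))) ∂P := by
          refine integral_mono_ae (h.integrable_realRegret hρ i)
            ((h.integrable_prefixGood_mul _ (h.integrable_realRegret hρ i)).add
              (hone.const_mul _)) ?_
          filter_upwards [h.ae_realRegret_mem (C := C) (T := T) hρ i] with ω hω
          by_cases hg : ∀ l < n, BlockNoiseGood T l (η · ω)
          · have e1 : prefixGood T n (η · ω) = 1 := if_pos hg
            have e2 : prefixGood T (i + 1) (η · ω) = 1 := if_pos fun l hl => hg l (by omega)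
            rw [e1, e2]
            simp
          · have e1 : prefixGood T n (η · ω) = 0 := if_neg hg
            rw [e1]
            have := mul_nonneg (prefixGood_nonneg T (i + 1) (η · ω)) hω.1
            linarith [hω.2]
      _ = _ := by
          rw [integral_add (h.integrable_prefixGood_mul _ (h.integrable_realRegret hρ i))
            (hone.const_mul _), integral_const_mul]
      _ ≤ _ := by gcongr
  have h3 := Finset.sum_le_sum h2
  rw [Finset.sum_add_distrib] at h3
  simp only [Finset.sum_const, Finset.card_range, nsmul_eq_mul] at h3
  have h4 : (n : ℝ) * (H * (1 + H) * (8 / H ^ 2)) ≤ 16 * H := by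
    have hnH : (n : ℝ) ≤ H := Nat.cast_le.2 hn
    calc (n : ℝ) * (H * (1 + H) * (8 / H ^ 2)) ≤ H * (H * (1 + H) * (8 / H ^ 2)) := by gcongr
      _ = 8 * (1 + H) := by field_simp
      _ ≤ 16 * H := by linarith
  linarith

end

/-! ### The size of the parameters -/

lemma blockLength_le {T : ℕ} (hT : 1 ≤ T) : (blockLength T : ℝ) ≤ 2 * Real.sqrt T := by
  have h1 : (blockLength T : ℝ) < Real.sqrt T + 1 := Nat.ceil_lt_add_one (Real.sqrt_nonneg _)
  have h2 : 1 ≤ Real.sqrt T := Real.one_le_sqrt.2 (by exact_mod_cast hT)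
  linarith

lemma blockLength_le_self (T : ℕ) : blockLength T ≤ T := by
  unfold blockLength
  rw [Nat.ceil_le]
  rcases Nat.eq_zero_or_pos T with rfl | hT
  · simp
  · rw [Real.sqrt_le_left (Nat.cast_nonneg T)]
    have : (1 : ℝ) ≤ T := by exact_mod_cast hT
    nlinarith

lemma log_blockLength_le {T : ℕ} (hT : 1 ≤ T) : Real.log (blockLength T) ≤ Real.log T :=
  Real.log_le_log (by exact_mod_cast blockLength_pos hT) (by exact_mod_cast blockLength_le_self T)

lemma numBlocks_mul_le {T : ℕ} (hT : 1 ≤ T) : (numBlocks T : ℝ) * blockLength T ≤ 2 * T := by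
  have hH : (0 : ℝ) < blockLength T := by exact_mod_cast blockLength_pos hT
  have h1 : (numBlocks T : ℝ) < (T : ℝ) / blockLength T + 1 := Nat.ceil_lt_add_one (by positivity)
  have h2 : (blockLength T : ℝ) ≤ T := by exact_mod_cast blockLength_le_self T
  calc (numBlocks T : ℝ) * blockLength T
      ≤ ((T : ℝ) / blockLength T + 1) * blockLength T := by gcongr
    _ = T + blockLength T := by field_simp
    _ ≤ 2 * T := by linarith

/-- The largest exponent of a candidate. -/
noncomputable def maxExponent (T : ℕ) : ℕ := ⌈(3 / 2 : ℝ) * Real.logb 2 (blockLength T : ℝ)⌉₊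

lemma four_le_maxExponent {T : ℕ} (hT : 100 ≤ T) : 4 ≤ maxExponent T := by
  have hs : (10 : ℝ) ≤ Real.sqrt T := by
    rw [Real.le_sqrt (by norm_num) (Nat.cast_nonneg T)]
    have : (100 : ℝ) ≤ T := by exact_mod_cast hT
    linarith
  have hH : (10 : ℝ) ≤ blockLength T := hs.trans (Nat.le_ceil _)
  have h1 : (3 : ℝ) < Real.logb 2 (blockLength T : ℝ) := by
    rw [Real.lt_logb_iff_rpow_lt (by norm_num) (by linarith)]
    calc (2 : ℝ) ^ (3 : ℝ) = 8 := by norm_num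
      _ < blockLength T := by linarith
  have h2 : (3 : ℕ) < maxExponent T := by
    unfold maxExponent
    rw [Nat.lt_ceil]
    push_cast
    linarith
  exact h2

lemma numCandidates_eq (T : ℕ) : numCandidates T = maxExponent T + 1 - 3 := by
  rw [numCandidates, exponents, Nat.card_Icc, maxExponent]

lemma numCandidates_le {T : ℕ} (hT : 100 ≤ T) : (numCandidates T : ℝ) ≤ 3 * Real.log T := by
  have h4 := four_le_maxExponent hT
  have hH : (1 : ℝ) ≤ blockLength T := by exact_mod_cast blockLength_pos (by omega : 1 ≤ T)
  have hlog := log_blockLength_le (by omega : 1 ≤ T)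
  have h0 : 0 ≤ Real.logb 2 (blockLength T : ℝ) := Real.logb_nonneg (by norm_num) hH
  have h1 : (maxExponent T : ℝ) < (3 / 2 : ℝ) * Real.logb 2 (blockLength T : ℝ) + 1 :=
    Nat.ceil_lt_add_one (by positivity)
  have h2 : (numCandidates T : ℝ) + 2 = maxExponent T := by
    have := numCandidates_eq T
    exact_mod_cast (by omega : numCandidates T + 2 = maxExponent T)
  have h3 : Real.logb 2 (blockLength T : ℝ) ≤ 2 * Real.log T := by
    rw [Real.logb, div_le_iff₀ (Real.log_pos (by norm_num))]
    have := Real.log_two_gt_d9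
    nlinarith [Real.log_nonneg hH]
  linarith

/-- Up to logarithms, the price of exponential weights is the square root of the number of
blocks. -/
lemma mixing_cost_le {T : ℕ} (hT : 1 ≤ T) (hB : 2 ≤ numCandidates T) :
    2 * mixing T * numBlocks T + numCandidates T / mixing T * Real.log (numCandidates T) ≤
      5 * (numCandidates T : ℝ) ^ 2 * Real.sqrt (blockLength T) := by
  have hnpos : 0 < numBlocks T := by
    by_contra! h
    have := le_numBlocks_mul hT
    rw [Nat.le_zero.1 h] at this
    omega
  have hn : (1 : ℝ) ≤ numBlocks T := by exact_mod_cast hnpos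
  have hnH : (numBlocks T : ℝ) ≤ blockLength T := by exact_mod_cast numBlocks_le hT
  have hB2 : (2 : ℝ) ≤ numCandidates T := by exact_mod_cast hB
  have he1 : 1 ≤ Real.exp 1 - 1 := by linarith [Real.exp_one_gt_d9]
  have he2 : Real.exp 1 - 1 ≤ 4 := by linarith [Real.exp_one_lt_d9]
  have hl0 : 0 < Real.log (numCandidates T : ℝ) := Real.log_pos (by linarith)
  have hl1 : Real.log (numCandidates T : ℝ) ≤ numCandidates T := by
    have := Real.log_le_sub_one_of_pos (by linarith : (0 : ℝ) < numCandidates T)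
    linarith
  have hα := mixing_pos hB hT
  set B : ℝ := (numCandidates T : ℝ)
  set n : ℝ := (numBlocks T : ℝ)
  set H : ℝ := (blockLength T : ℝ)
  set l := Real.log B
  set c := Real.exp 1 - 1
  have hmix : mixing T = min 1 (Real.sqrt (B * l / (c * n))) := rfl
  have hx0 : 0 < B * l / (c * n) := by positivity
  set q := Real.sqrt (B * l / (c * n)) with hq
  have hq0 : 0 < q := Real.sqrt_pos.2 hx0
  have hsn : 1 ≤ Real.sqrt n := Real.one_le_sqrt.2 hn
  have hsnH : Real.sqrt n ≤ Real.sqrt H := Real.sqrt_le_sqrt hnH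
  have hn2 : Real.sqrt n ^ 2 = n := Real.sq_sqrt (by linarith)
  -- `q = √(B log B / (c n))` balances the two parts of the price, up to powers of `B`.
  have hqle : q * Real.sqrt n ≤ B := by
    rw [hq, ← Real.sqrt_mul hx0.le]
    refine Real.sqrt_le_iff.2 ⟨by linarith, ?_⟩
    have : B * l / (c * n) * n = B * l / c := by field_simp
    rw [this]
    refine (div_le_self (by positivity) he1).trans ?_
    nlinarith
  have h1 : mixing T * n ≤ B * Real.sqrt n := by
    have : mixing T ≤ q := by rw [hmix]; exact min_le_right _ _
    calc mixing T * n ≤ q * n := by gcongr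
      _ = (q * Real.sqrt n) * Real.sqrt n := by rw [mul_assoc, ← sq, hn2]
      _ ≤ _ := by gcongr
  have h2 : B / mixing T * l ≤ B ^ 2 + 2 * B * Real.sqrt n := by
    have h3 : 1 / mixing T ≤ 1 + 1 / q := by
      rw [hmix]
      rcases le_total 1 q with h | h
      · rw [min_eq_left h]
        have : 0 < 1 / q := by positivity
        norm_num
        positivity
      · rw [min_eq_right h]; linarith
    have h4 : B * l * (1 / q) ≤ 2 * B * Real.sqrt n := by
      rw [mul_one_div, div_le_iff₀ hq0]
      have h5 : B * l = q ^ 2 * (c * n) := by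
        rw [hq, Real.sq_sqrt hx0.le]; field_simp
      -- both sides are squares up to the factor `c ≤ 4`
      have h6 : (q * Real.sqrt n) ^ 2 * c = B * l := by rw [h5, mul_pow, hn2]; ring
      have h7 : q * Real.sqrt n * c ≤ 2 * B := by
        refine le_of_pow_le_pow_left₀ two_ne_zero (by positivity) ?_
        calc (q * Real.sqrt n * c) ^ 2 = B * l * c := by rw [← h6]; ring
          _ ≤ B * B * 4 := by gcongr
          _ = (2 * B) ^ 2 := by ring
      calc B * l = (q * Real.sqrt n * c) * (q * Real.sqrt n) := by rw [← h6]; ring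
        _ ≤ (2 * B) * (q * Real.sqrt n) := by gcongr
        _ = _ := by ring
    calc B / mixing T * l = B * l * (1 / mixing T) := by ring
      _ ≤ B * l * (1 + 1 / q) := by gcongr
      _ = B * l + B * l * (1 / q) := by ring
      _ ≤ B ^ 2 + 2 * B * Real.sqrt n := by nlinarith
  have h8 : B * Real.sqrt n ≤ B ^ 2 / 2 * Real.sqrt H := by
    have : B ≤ B ^ 2 / 2 := by nlinarith
    gcongr
  have h9 : B ^ 2 ≤ B ^ 2 * Real.sqrt H := le_mul_of_one_le_right (by positivity) (hsn.trans hsnH)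
  have h10 : 0 ≤ B ^ 2 * Real.sqrt H := by positivity
  linarith

lemma rate_antitone {i j : ℕ} (h : i ≤ j) : rate j ≤ rate i := by
  unfold rate
  gcongr
  norm_num

lemma rate_succ (j : ℕ) : rate j = 2 * rate (j + 1) := by
  unfold rate
  rw [pow_succ]
  field_simp

/-- The smallest candidate rate is `H^{-3/2}` up to a factor `2`. -/
lemma rate_maxExponent {T : ℕ} (hT : 1 ≤ T) :
    1 ≤ 4 * (blockLength T : ℝ) ^ 3 * rate (maxExponent T) ^ 2 ∧
    (blockLength T : ℝ) ^ 3 * rate (maxExponent T) ^ 2 ≤ 1 := by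
  have hH : (1 : ℝ) ≤ blockLength T := by exact_mod_cast blockLength_pos hT
  have h0 : 0 ≤ Real.logb 2 (blockLength T : ℝ) := Real.logb_nonneg (by norm_num) hH
  have h1 : (maxExponent T : ℝ) < (3 / 2 : ℝ) * Real.logb 2 (blockLength T : ℝ) + 1 :=
    Nat.ceil_lt_add_one (by positivity)
  have h2 : (3 / 2 : ℝ) * Real.logb 2 (blockLength T : ℝ) ≤ maxExponent T := Nat.le_ceil _
  have hl2 : 0 < Real.log 2 := Real.log_pos (by norm_num)
  have hlb : Real.logb 2 (blockLength T : ℝ) * Real.log 2 = Real.log (blockLength T) :=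
    div_mul_cancel₀ _ hl2.ne'
  set J := maxExponent T
  set H : ℝ := (blockLength T : ℝ)
  have e1 : Real.log (((2 : ℝ) ^ J) ^ 2) = 2 * (J * Real.log 2) := by
    rw [Real.log_pow, Real.log_pow]; norm_num
  have e2 : Real.log (H ^ 3) = 3 * Real.log H := by rw [Real.log_pow]; norm_num
  have e3 : Real.log (4 * H ^ 3) = 2 * Real.log 2 + 3 * Real.log H := by
    rw [Real.log_mul (by norm_num) (by positivity), e2, show (4 : ℝ) = 2 ^ 2 by norm_num,
      Real.log_pow]
    norm_num
  have e4 : rate J ^ 2 = 1 / ((2 : ℝ) ^ J) ^ 2 := by unfold rate; rw [inv_pow, one_div]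
  constructor
  · rw [e4, mul_one_div, one_le_div (by positivity),
      ← Real.log_le_log_iff (by positivity) (by positivity), e1, e3]
    nlinarith
  · rw [e4, mul_one_div, div_le_one (by positivity),
      ← Real.log_le_log_iff (by positivity) (by positivity), e1, e2]
    nlinarith

/-- The comparison candidate: the smallest one that bounds the rotting rates. -/
lemma exists_exponent {T : ℕ} (hT : 100 ≤ T) {r : ℝ} (hr0 : 0 ≤ r) (hr : r ≤ 1 / 8) :
    ∃ j ∈ exponents T, r ≤ rate j ∧
      1 ≤ 2 * blockLength T * (rate j ^ (1 / 3 : ℝ)) ^ 2 ∧ rate j ^ (1 / 3 : ℝ) ≤ 1 / 2 ∧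
      rate j ^ (1 / 3 : ℝ) * T ≤ 2 * max (r ^ (1 / 3 : ℝ) * T) ((T : ℝ) ^ (3 / 4 : ℝ)) := by
  have hT0 : (0 : ℝ) < T := by exact_mod_cast (by omega : 0 < T)
  have hJ := four_le_maxExponent hT
  have hH : (1 : ℝ) ≤ blockLength T := by exact_mod_cast blockLength_pos (by omega : 1 ≤ T)
  obtain ⟨hJ1, hJ2⟩ := rate_maxExponent (by omega : 1 ≤ T)
  classical
  have h3 : r ≤ rate 3 := hr.trans_eq (by norm_num [rate])
  have hspec : r ≤ rate (Nat.findGreatest (fun j => r ≤ rate j) (maxExponent T)) :=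
    Nat.findGreatest_spec (P := fun j => r ≤ rate j) (by omega : 3 ≤ maxExponent T) h3
  have hle := Nat.findGreatest_le (P := fun j => r ≤ rate j) (maxExponent T)
  have hge := Nat.le_findGreatest (P := fun j => r ≤ rate j) (by omega : 3 ≤ maxExponent T) h3
  have hmax : ∀ k, Nat.findGreatest (fun j => r ≤ rate j) (maxExponent T) < k →
      k ≤ maxExponent T → ¬ r ≤ rate k := fun k h1 h2 => Nat.findGreatest_is_greatest h1 h2
  set j := Nat.findGreatest (fun j => r ≤ rate j) (maxExponent T)
  have hd0 : 0 < rate j ^ (1 / 3 : ℝ) := Real.rpow_pos_of_pos (rate_pos j) _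
  have hcube := rate_rpow_third_pow j
  have hsix : (rate j ^ (1 / 3 : ℝ)) ^ 6 = rate j ^ 2 := by
    rw [show 6 = 3 * 2 by norm_num, pow_mul, hcube]
  refine ⟨j, Finset.mem_Icc.2 ⟨hge, hle⟩, hspec, ?_, ?_, ?_⟩
  · by_contra! hlt
    have h1 : (2 * blockLength T * (rate j ^ (1 / 3 : ℝ)) ^ 2) ^ 3 < 1 :=
      pow_lt_one₀ (by positivity) hlt (by norm_num)
    have h2 : (2 * blockLength T * (rate j ^ (1 / 3 : ℝ)) ^ 2) ^ 3 =
        2 * (4 * (blockLength T : ℝ) ^ 3 * rate j ^ 2) := by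
      rw [← hsix]; ring
    have h4 : rate (maxExponent T) ^ 2 ≤ rate j ^ 2 :=
      pow_le_pow_left₀ (rate_pos _).le (rate_antitone hle) 2
    have h5 : 4 * (blockLength T : ℝ) ^ 3 * rate (maxExponent T) ^ 2 ≤
        4 * (blockLength T : ℝ) ^ 3 * rate j ^ 2 := by gcongr
    linarith
  · refine le_of_pow_le_pow_left₀ (by norm_num : 3 ≠ 0) (by norm_num) ?_
    rw [hcube]
    exact (rate_antitone hge).trans_eq (by norm_num [rate])
  -- For the smallest of all candidates `δ ≤ T^{-1/4}`; otherwise the next one is below `r`.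
  · rcases hle.eq_or_lt with heq | hlt
    · have h1 : rate j ^ (1 / 3 : ℝ) ≤ (T : ℝ) ^ (-(1 / 4) : ℝ) := by
        refine le_of_pow_le_pow_left₀ (by norm_num : 6 ≠ 0) (by positivity) ?_
        have e1 : ((T : ℝ) ^ (-(1 / 4) : ℝ)) ^ 6 = (T : ℝ) ^ (-(3 / 2) : ℝ) := by
          rw [← Real.rpow_natCast, ← Real.rpow_mul hT0.le]; norm_num
        have e3 : (T : ℝ) ^ (3 / 2 : ℝ) ≤ (blockLength T : ℝ) ^ 3 := by
          calc (T : ℝ) ^ (3 / 2 : ℝ) ≤ ((blockLength T : ℝ) ^ 2) ^ (3 / 2 : ℝ) :=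
                Real.rpow_le_rpow hT0.le (le_blockLength_sq T) (by norm_num)
            _ = _ := by
                rw [← Real.rpow_natCast, ← Real.rpow_mul (by linarith), ← Real.rpow_natCast]
                norm_num
        rw [e1, hsix, Real.rpow_neg hT0.le, ← one_div, le_div_iff₀ (by positivity), heq, mul_comm]
        refine le_trans ?_ hJ2
        gcongr
      have h2 : (T : ℝ) ^ (-(1 / 4) : ℝ) * T = (T : ℝ) ^ (3 / 4 : ℝ) := by
        rw [← Real.rpow_add_one hT0.ne']; norm_num
      have h4 : rate j ^ (1 / 3 : ℝ) * T ≤ (T : ℝ) ^ (3 / 4 : ℝ) := by rw [← h2]; gcongr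
      have h5 := le_max_right (r ^ (1 / 3 : ℝ) * T) ((T : ℝ) ^ (3 / 4 : ℝ))
      have h6 : 0 ≤ (T : ℝ) ^ (3 / 4 : ℝ) := by positivity
      linarith
    · have h1 := hmax (j + 1) (by omega) (by omega)
      have h2 : rate j ≤ 2 * r := by rw [rate_succ]; linarith
      have h4 : rate j ^ (1 / 3 : ℝ) ≤ 2 * r ^ (1 / 3 : ℝ) := by
        calc rate j ^ (1 / 3 : ℝ) ≤ (2 * r) ^ (1 / 3 : ℝ) :=
              Real.rpow_le_rpow (rate_pos j).le h2 (by norm_num)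
          _ = 2 ^ (1 / 3 : ℝ) * r ^ (1 / 3 : ℝ) := Real.mul_rpow (by norm_num) hr0
          _ ≤ 2 * r ^ (1 / 3 : ℝ) := by
              gcongr
              calc (2 : ℝ) ^ (1 / 3 : ℝ) ≤ 2 ^ (1 : ℝ) :=
                    Real.rpow_le_rpow_of_exponent_le (by norm_num) (by norm_num)
                _ = 2 := Real.rpow_one 2
      have h5 := le_max_left (r ^ (1 / 3 : ℝ) * T) ((T : ℝ) ^ (3 / 4 : ℝ))
      calc rate j ^ (1 / 3 : ℝ) * T ≤ 2 * r ^ (1 / 3 : ℝ) * T := by gcongr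
        _ ≤ _ := by linarith

lemma blockLength_mul_sqrt_le {T : ℕ} (hT : 1 ≤ T) :
    (blockLength T : ℝ) * Real.sqrt (blockLength T) ≤ 4 * (T : ℝ) ^ (3 / 4 : ℝ) := by
  have hT0 : (0 : ℝ) < T := by exact_mod_cast hT
  have h := blockLength_le hT
  have h1 : Real.sqrt (blockLength T) ≤ 2 * Real.sqrt (Real.sqrt T) := by
    calc Real.sqrt (blockLength T) ≤ Real.sqrt (2 * Real.sqrt T) := Real.sqrt_le_sqrt h
      _ = Real.sqrt 2 * Real.sqrt (Real.sqrt T) := Real.sqrt_mul (by norm_num) _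
      _ ≤ 2 * Real.sqrt (Real.sqrt T) := by
          gcongr
          exact Real.sqrt_le_iff.2 ⟨by norm_num, by norm_num⟩
  have h2 : Real.sqrt T * Real.sqrt (Real.sqrt T) = (T : ℝ) ^ (3 / 4 : ℝ) := by
    rw [Real.sqrt_eq_rpow, Real.sqrt_eq_rpow, ← Real.rpow_mul hT0.le, ← Real.rpow_add hT0]
    norm_num
  calc (blockLength T : ℝ) * Real.sqrt (blockLength T) ≤
        (2 * Real.sqrt T) * (2 * Real.sqrt (Real.sqrt T)) := by gcongr
    _ = 4 * (Real.sqrt T * Real.sqrt (Real.sqrt T)) := by ring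
    _ = _ := by rw [h2]

lemma gainScale_le {C : ℝ} {T : ℕ} (hT : 1 ≤ T) (hlog : 1 ≤ Real.log T) :
    gainScale C T ≤ (2 * C + 4) * (blockLength T * Real.log T) := by
  have hH : (1 : ℝ) ≤ blockLength T := by exact_mod_cast blockLength_pos hT
  have h1 : 1 ≤ (blockLength T : ℝ) * Real.log T := one_le_mul_of_one_le_of_one_le hH hlog
  have h2 : Real.sqrt ((blockLength T : ℝ) * Real.log T) ≤ blockLength T * Real.log T :=
    Real.sqrt_le_iff.2 ⟨by linarith, by nlinarith⟩
  unfold gainScale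
  linarith

section

variable {Ω : Type*} [MeasurableSpace Ω] {P : Measure Ω} [IsProbabilityMeasure P]
  {m η U : ℕ → Ω → ℝ} {C : ℝ} {T : ℕ} {ρ : ℕ → ℝ}

/-- The total regret of the constant choice of a suitable candidate. -/
lemma RandomInput.sum_tameRegret_le (h : RandomInput P m η U) (hT : 1 ≤ T)
    (hlog : 1 ≤ Real.log T) {j : ℕ}
    (hρ : ∀ t, 1 ≤ t → 0 ≤ ρ t ∧ ρ t ≤ rate j)
    (hδ : 1 ≤ 2 * blockLength T * (rate j ^ (1 / 3 : ℝ)) ^ 2) (hδ2 : rate j ^ (1 / 3 : ℝ) ≤ 1 / 2) :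
    ∑ i ∈ Finset.range (numBlocks T), tameRegret P m η T ρ i j ≤
      26000 * Real.log T ^ 2 * (rate j ^ (1 / 3 : ℝ) * T) := by
  have hd0 : 0 < rate j ^ (1 / 3 : ℝ) := Real.rpow_pos_of_pos (rate_pos j) _
  have hreg := fun i => h.integral_good_regret_le hT hρ i hδ
  have hH : (1 : ℝ) ≤ blockLength T := by exact_mod_cast blockLength_pos hT
  have hL0 := confConst_nonneg hT
  have hHlog := log_blockLength_le hT
  have hL : confConst T ≤ 10 * Real.log T := by unfold confConst; linarith
  have hnH := numBlocks_mul_le hT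
  set δ := rate j ^ (1 / 3 : ℝ)
  have hlogδ : Real.log (1 / δ) ≤ Real.log T := by
    refine (Real.log_le_log (by positivity) ?_).trans hHlog
    rw [div_le_iff₀ hd0]
    nlinarith
  have hlogδ0 : 0 ≤ Real.log (1 / δ) := Real.log_nonneg (by rw [le_div_iff₀ hd0]; linarith)
  have hbr : 43 + 640 * confConst T * (1 + Real.log (1 / δ)) ≤ 13000 * Real.log T ^ 2 := by
    calc 43 + 640 * confConst T * (1 + Real.log (1 / δ)) ≤
          43 + 640 * (10 * Real.log T) * (Real.log T + Real.log T) := by gcongr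
      _ ≤ 13000 * Real.log T ^ 2 := by nlinarith
  calc ∑ i ∈ Finset.range (numBlocks T), tameRegret P m η T ρ i j
      ≤ ∑ _i ∈ Finset.range (numBlocks T), blockLength T * δ * (13000 * Real.log T ^ 2) := by
        refine Finset.sum_le_sum fun i _ => (hreg i).trans ?_
        gcongr
    _ = (numBlocks T * blockLength T) * (δ * (13000 * Real.log T ^ 2)) := by
        rw [Finset.sum_const, Finset.card_range, nsmul_eq_mul]; ring
    _ ≤ (2 * T) * (δ * (13000 * Real.log T ^ 2)) := by gcongr
    _ = _ := by ring

/-- The regret bound in terms of the blocks, with explicit constants. -/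
theorem RandomInput.sum_integral_regret_le_max (h : RandomInput P m η U) (hC : 25 ≤ C)
    (hT : 100 ≤ T) {r : ℝ} (hr0 : 0 ≤ r) (hr : r ≤ 1 / 8)
    (hρ : ∀ t, 1 ≤ t → 0 ≤ ρ t ∧ ρ t ≤ r) :
    ∑ i ∈ Finset.range (numBlocks T), ∫ ω, realRegret C T ρ (m · ω) (η · ω) (U · ω) i ∂P ≤
      (52064 + 180 * (2 * C + 4)) * Real.log T ^ 3 *
        max (r ^ (1 / 3 : ℝ) * T) ((T : ℝ) ^ (3 / 4 : ℝ)) := by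
  have hT1 : 1 ≤ T := by omega
  have hTr : (100 : ℝ) ≤ T := by exact_mod_cast hT
  have hlog : 1 ≤ Real.log T := by
    rw [Real.le_log_iff_exp_le (by linarith)]
    linarith [Real.exp_one_lt_d9]
  have hH : (1 : ℝ) ≤ blockLength T := by exact_mod_cast blockLength_pos hT1
  obtain ⟨j, hj, hrj, hδ, hδ2, hδT⟩ := exists_exponent hT hr0 hr
  have hB : 2 ≤ numCandidates T := by
    have := numCandidates_eq T
    have := four_le_maxExponent hT
    omega
  have hmain := h.sum_integral_regret_le hC (by omega : 3 ≤ T) hB (log_blockLength_le hT1)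
    (fun t ht => ⟨(hρ t ht).1, (hρ t ht).2.trans (hr.trans (by norm_num))⟩) hj (numBlocks_le hT1)
  have htame := h.sum_tameRegret_le hT1 hlog
    (fun t ht => ⟨(hρ t ht).1, (hρ t ht).2.trans hrj⟩) hδ hδ2
  have hmix := mixing_cost_le hT1 hB
  have hBl := numCandidates_le hT
  have hD := gainScale_le (C := C) hT1 hlog
  have hHs := blockLength_mul_sqrt_le hT1
  have hD0 := gainScale_pos (by linarith : 0 < C) (by omega : 2 ≤ T)
  set X := max (r ^ (1 / 3 : ℝ) * T) ((T : ℝ) ^ (3 / 4 : ℝ)) with hX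
  have hX1 : (T : ℝ) ^ (3 / 4 : ℝ) ≤ X := le_max_right _ _
  have hX0 : 0 ≤ X := le_trans (by positivity) hX1
  set l := Real.log (T : ℝ)
  set H : ℝ := (blockLength T : ℝ)
  set B : ℝ := (numCandidates T : ℝ)
  have hB0 : 0 ≤ B := Nat.cast_nonneg _
  have hsq : 1 ≤ Real.sqrt H := Real.one_le_sqrt.2 hH
  have a1 : 26000 * l ^ 2 * (rate j ^ (1 / 3 : ℝ) * T) ≤ 52000 * l ^ 3 * X := by
    calc 26000 * l ^ 2 * (rate j ^ (1 / 3 : ℝ) * T) ≤ 26000 * l ^ 2 * (2 * X) := by gcongr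
      _ = 52000 * l ^ 2 * X := by ring
      _ ≤ 52000 * l ^ 3 * X := by
          gcongr 52000 * ?_ * X
          exact pow_le_pow_right₀ hlog (by norm_num)
  have a2 : gainScale C T * (2 * mixing T * numBlocks T + B / mixing T * Real.log B) ≤
      180 * (2 * C + 4) * l ^ 3 * X := by
    have hC4 : 0 ≤ 2 * C + 4 := by linarith
    calc gainScale C T * (2 * mixing T * numBlocks T + B / mixing T * Real.log B) ≤
          gainScale C T * (5 * B ^ 2 * Real.sqrt H) := by gcongr
      _ ≤ ((2 * C + 4) * (H * l)) * (5 * (3 * l) ^ 2 * Real.sqrt H) := by gcongr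
      _ = 45 * (2 * C + 4) * l ^ 3 * (H * Real.sqrt H) := by ring
      _ ≤ 45 * (2 * C + 4) * l ^ 3 * (4 * X) := by
          have : H * Real.sqrt H ≤ 4 * X := by linarith
          gcongr
      _ = _ := by ring
  have a3 : 16 * H ≤ 64 * l ^ 3 * X := by
    have h1 : 16 * H ≤ 64 * X := by nlinarith
    have h2 : X ≤ l ^ 3 * X := le_mul_of_one_le_left hX0 (one_le_pow₀ hlog)
    linarith
  calc _ ≤ 52000 * l ^ 3 * X + 180 * (2 * C + 4) * l ^ 3 * X + 64 * l ^ 3 * X := by linarith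
    _ = _ := by ring

end

end RottingBandit

theorem theorem3 :
    ∃ C₀ : ℝ, 0 < C₀ ∧ ∀ C : ℝ, C₀ ≤ C →
    ∃ K : ℝ, 0 < K ∧ ∃ k : ℕ,
    ∀ ϱ : ℕ → ℝ, (∀ T, 0 ≤ ϱ T) → Tendsto ϱ atTop (𝓝 0) →
    ∃ T₀ : ℕ, ∀ T : ℕ, T₀ ≤ T →
    ∀ (ρ : ℕ → ℝ), (∀ t, 1 ≤ t → 0 ≤ ρ t ∧ ρ t ≤ ϱ T) →
    ∀ (𝒜 : Type*) (abar : ℕ → 𝒜), Function.Injective abar →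
    ∀ (Ω : Type*) [MeasurableSpace Ω] (P : Measure Ω) [IsProbabilityMeasure P]
      (μ₁ : 𝒜 → Ω → ℝ) (η U : ℕ → Ω → ℝ), RottingBandit.RandomInput P μ₁ η U →
    Integrable (fun ω => RottingBandit.regret C T abar (fun a => μ₁ a ω) ρ
      (fun t => η t ω) (fun i => U i ω)) P ∧
    ∫ ω, RottingBandit.regret C T abar (fun a => μ₁ a ω) ρ
      (fun t => η t ω) (fun i => U i ω) ∂P
      ≤ K * Real.log (T : ℝ) ^ k *
        max (ϱ T ^ (1 / 3 : ℝ) * (T : ℝ)) ((T : ℝ) ^ (3 / 4 : ℝ)) := by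
  refine ⟨25, by norm_num, fun C hC => ⟨52064 + 180 * (2 * C + 4), by linarith, 3,
    fun ϱ hϱ0 hϱ => ?_⟩⟩
  obtain ⟨T₁, hT₁⟩ := eventually_atTop.1 (hϱ.eventually_le_const (by norm_num : (0 : ℝ) < 1 / 8))
  refine ⟨max T₁ 100, fun T hT ρ hρ 𝒜 abar habar Ω _ P _ μ₁ η U hin => ?_⟩
  have h8 := hT₁ T ((le_max_left _ _).trans hT)
  have hT100 : 100 ≤ T := (le_max_right _ _).trans hT
  have h := hin.comp_injective habar
  have heq : (fun ω => RottingBandit.regret C T abar (fun a => μ₁ a ω) ρ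
      (fun t => η t ω) (fun i => U i ω)) = fun ω => ∑ i ∈ Finset.range (RottingBandit.numBlocks T),
      RottingBandit.realRegret C T ρ (fun k => μ₁ (abar k) ω) (fun t => η t ω)
        (fun i => U i ω) i := by
    funext ω
    exact RottingBandit.regret_eq_sum C _ ρ _ _ habar (by omega)
  have hint := fun i => h.integrable_realRegret (C := C) (T := T)
    (fun t ht => ⟨(hρ t ht).1, (hρ t ht).2.trans (h8.trans (by norm_num))⟩) i
  rw [heq]
  refine ⟨integrable_finsetSum _ fun i _ => hint i, ?_⟩
  rw [integral_finsetSum _ fun i _ => hint i]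
  exact h.sum_integral_regret_le_max hC hT100 (hϱ0 T) h8 hρ
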